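/- Let $M$ be a smooth manifold and let $(\mathcal A,\wedge,d)$ be its real de Rham algebra. A commutative $\mathrm{BV}_\infty$-algebra is a tuple $(A,\wedge,d=\Delta_0,\Delta_1,\Delta_2,\dots)$ such that $(A,\wedge,d)$ is a commutative dg-algebra, $\Delta_n$ has degree $1-2n$ and algebraic order at most $n+1$, and $\sum_{i=0}^n\Delta_i\Delta_{n-i}=0$ for all $n\ge 0$. Brackets are graded commutators. Let $\omega$ be an almost symplectic form on $M$ (a nondegenerate $2$-form), $\dim M=2n$, and let $L=\omega\wedge\cdot$, so that $[d,L]=d\omega\wedge\cdot$. Let $\omega^{-1}$ be the bilinear form on covectors whose matrix is the inverse of the matrix of $\omega$, and extend it to forms by $\langle a_1\wedge\dots\wedge a_k,b_1\wedge\dots\wedge b_k\rangle_\omega=\det(\omega^{-1}(a_i,b_j))$. Let $\star_\omega$ be the symplectic star operator, $\alpha\wedge\star_\omega\beta=\langle\alpha,\beta\rangle_\omega\,\omega^n/n!$, let $\varphi^\omega$ be the pointwise symplectic adjoint of a bundle endomorphism $\varphi$, $\langle\varphi\alpha,\beta\rangle_\omega=\langle\alpha,\varphi^\omega\beta\rangle_\omega$,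 let $\Lambda=L^\omega$, and let $d^\omega=(-1)^k\star_\omega d\,\star_\omega$ on $\mathcal A^k$. To the almost symplectic manifold $(M,\omega)$ one associates the tuple $$(\mathcal A,\wedge,d,\ \Delta_1=d^\omega+[\Lambda,[d,L]]^\omega,\ \Delta_2=-[d,L]^\omega).\qquad(1)$$ Suppose moreover that $(M,g,J,\omega)$ is almost Hermitian, i.e. $J$ is an almost complex structure and $g(X,Y)=\omega(X,JY)$ is a Riemannian metric. Let $J$ act on forms by $(J\alpha)(X_1,\dots,X_k)=\alpha(JX_1,\dots,JX_k)$, let $\star$ be the Hodge star of $g$ with volume form $\omega^n/n!$, and let ${}^*$ be the pointwise metric adjoint of bundle endomorphisms; $L^*$ is again denoted $\Lambda$. Put $d_c=J^{-1}dJ$, $d_c^*=-\star d_c\star$, $T=[\Lambda,d\omega\wedge\cdot]$, $T_c=J^{-1}TJ$ and $d\omega_c=J^{-1}(d\omega\wedge\cdot)J$. To the almost Hermitian manifold one associates the tuple $$(\mathcal A,\wedge,d,\ \Delta_1=-(d_c^*+T_c^*),\ \Delta_2=d\omega_c^*).\qquad(2)$$ Then, for every almost Hermitian manifold: (a) $d_c^*=-d^\omega$,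 $\ d\omega_c^*=-[d,L]^\omega$, $\ T_c^*=-[\Lambda,[d,L]]^\omega$ (where $[d,L]=d\omega\wedge\cdot$). (b) The tuples (1) and (2) (with $\Delta_n=0$ for $n\ge3$) are commutative $\mathrm{BV}_\infty$-algebras and they coincide. In particular (2) depends only on $\omega$: two almost Hermitian structures on $M$ with the same form $\omega$ give the same operators. (c) In the almost Kähler case $d\omega=0$, the commutative $\mathrm{BV}_\infty$-algebra (2) is $(\mathcal A,\wedge,d,\Delta_1=d^\omega,\Delta_2=0)$, which is Koszul's $\mathrm{BV}$-algebra $(\mathcal A,\wedge,d,\Delta=[i_\pi,d])$ of the Poisson bivector field $\pi=\omega^{-1}$, where $i_\pi=\tfrac12\sum_{i,j}\omega^{-1}(e^i,e^j)\,\iota_{e_i}\iota_{e_j}$ for a local frame $(e_i)$ with dual coframe $(e^i)$. -/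

import Mathlib

open scoped Manifold ContDiff ExteriorAlgebra
open Bundle

noncomputable section

/-! ### The exterior algebra of a cotangent space -/

/-- The exterior algebra `⋀ E*`.  As `TangentSpace 𝓘(ℝ, E) x` is by definition the vector space `E`
(through the preferred chart at `x`), this is the fibre `⋀ T*ₓM` at any point `x` of a manifold
modelled on `E`. -/
abbrev FormFibre (E : Type*) [NormedAddCommGroup E] [NormedSpace ℝ E] : Type _ :=
  ExteriorAlgebra ℝ (Module.Dual ℝ E)

namespace FormFibre

variable {E : Type*} [NormedAddCommGroup E] [NormedSpace ℝ E] [FiniteDimensional ℝ E]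

instance finite : Module.Finite ℝ (FormFibre E) :=
  Module.Finite.of_basis (Module.finBasis ℝ (Module.Dual ℝ E)).ExteriorAlgebra

/-- Some norm on the finite-dimensional space `⋀ E*`; it is used only to speak of smooth functions
with values in this space, a notion that does not depend on the choice of the norm. -/
instance normedAddCommGroup : NormedAddCommGroup (FormFibre E) :=
  NormedAddCommGroup.induced (FormFibre E)
    (Fin (Module.finrank ℝ (FormFibre E)) → ℝ)
    (Module.finBasis ℝ (FormFibre E)).equivFun.toLinearMap
    (Module.finBasis ℝ (FormFibre E)).equivFun.injective

instance normedSpace : NormedSpace ℝ (FormFibre E) :=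
  NormedSpace.induced ℝ (FormFibre E)
    (Fin (Module.finrank ℝ (FormFibre E)) → ℝ)
    (Module.finBasis ℝ (FormFibre E)).equivFun.toLinearMap

/-- The `k`-th exterior power inside `⋀ E*`; it is zero for `k < 0`. -/
def deg : ℤ → Submodule ℝ (FormFibre E)
  | Int.ofNat k => ⋀[ℝ]^k (Module.Dual ℝ E)
  | Int.negSucc _ => ⊥

/-- Pullback of covectors along a linear map `A`, `(A^* α)(v₁, …, vₖ) = α(A v₁, …, A vₖ)`. -/
def pullback (A : E →ₗ[ℝ] E) : FormFibre E →ₐ[ℝ] FormFibre E :=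
  ExteriorAlgebra.map A.dualMap

/-- The operator `(-1)^k` on `⋀ᵏ E*`. -/
def parity : FormFibre E →ₐ[ℝ] FormFibre E :=
  ExteriorAlgebra.map (-LinearMap.id)

/-- Interior product (contraction) with a vector `v`. -/
def interior (v : E) : FormFibre E →ₗ[ℝ] FormFibre E :=
  CliffordAlgebra.contractLeft (Module.Dual.eval ℝ E v)

/-- `v ↦ σ(v, ·)` for a `2`-form `σ`. -/
def flat (σ : FormFibre E) : E →ₗ[ℝ] Module.Dual ℝ E where
  toFun v := ExteriorAlgebra.ιInv (interior v σ)
  map_add' v w := by simp [interior]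
  map_smul' c v := by simp [interior]

/-- The bilinear form on covectors that is inverse to a nondegenerate bilinear form on vectors
given by `F v = B(v, ·)`: it sends `(B(v, ·), b)` to `b v`, so that its matrix in a dual basis is
the inverse of the matrix `B(eᵢ, eⱼ)`. -/
def inverseForm (F : E ≃ₗ[ℝ] Module.Dual ℝ E) :
    Module.Dual ℝ E →ₗ[ℝ] Module.Dual ℝ (Module.Dual ℝ E) :=
  Module.Dual.eval ℝ E ∘ₗ F.symm.toLinearMap

/-- The extension of a bilinear form `c` on covectors to `⋀ E*`: on `⋀ᵏ E*` it is
`⟨a₁ ∧ … ∧ aₖ, b₁ ∧ … ∧ bₖ⟩ = det (c(aᵢ, bⱼ))`, and different degrees are orthogonal. -/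
def pairing (c : Module.Dual ℝ E →ₗ[ℝ] Module.Dual ℝ (Module.Dual ℝ E))
    (α β : FormFibre E) : ℝ :=
  ∑ k ∈ Finset.range (Module.finrank ℝ E + 1),
    exteriorPower.pairingDual ℝ (Module.Dual ℝ E) k
      (exteriorPower.map k c (DirectSum.decompose (fun i : ℕ => ⋀[ℝ]^i (Module.Dual ℝ E)) α k))
      (DirectSum.decompose (fun i : ℕ => ⋀[ℝ]^i (Module.Dual ℝ E)) β k)

/-- The adjoint of a linear operator `φ` for the pairing extending `c`, that is, the operator `ψ`
with `⟨φ α, β⟩ = ⟨α, ψ β⟩` (there is exactly one if `c` is nondegenerate). -/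
def adjoint (c : Module.Dual ℝ E →ₗ[ℝ] Module.Dual ℝ (Module.Dual ℝ E))
    (φ : Module.End ℝ (FormFibre E)) : Module.End ℝ (FormFibre E) :=
  Classical.epsilon fun ψ => ∀ α β, pairing c (φ α) β = pairing c α (ψ β)

/-- The star operator of the pairing extending `c` and the volume element `vol`, that is, the
operator `s : ⋀ᵏ E* → ⋀ᵐ⁻ᵏ E*`, `m = dim E`, with `α ∧ s β = ⟨α, β⟩ vol` (there is exactly one
if `c` is nondegenerate and `vol` is a nonzero element of top degree). -/
def star (c : Module.Dual ℝ E →ₗ[ℝ] Module.Dual ℝ (Module.Dual ℝ E)) (vol : FormFibre E) :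
    Module.End ℝ (FormFibre E) :=
  Classical.epsilon fun s => ∀ k ≤ Module.finrank ℝ E, ∀ β ∈ ⋀[ℝ]^k (Module.Dual ℝ E),
    s β ∈ ⋀[ℝ]^(Module.finrank ℝ E - k) (Module.Dual ℝ E) ∧
    ∀ α ∈ ⋀[ℝ]^k (Module.Dual ℝ E), α * s β = pairing c α β • vol

end FormFibre

/-! ### Differential forms on a manifold -/

section Forms

variable (E : Type*) [NormedAddCommGroup E] [NormedSpace ℝ E] [FiniteDimensional ℝ E]
  (M : Type*) [TopologicalSpace M] [ChartedSpace E M]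

/-- Sections of `⋀ T*M`, not necessarily smooth, with the pointwise wedge product. -/
abbrev FormSection : Type _ := M → FormFibre E

variable {E M}

/-- The pullback of a section of `⋀ T*M` along the inverse of the preferred chart `φₓ` at `x`. As the
tangent space at `p = φₓ⁻¹(y)` is identified with `E` through the preferred chart `φₚ` at `p`, the
derivative of `φₓ⁻¹` at `y` is the derivative of `φₚ ∘ φₓ⁻¹` at `y`. -/
def FormSection.inChart (x : M) (α : FormSection E M) : E → FormFibre E := fun y =>
  FormFibre.pullback
    (fderiv ℝ (extChartAt 𝓘(ℝ, E) ((extChartAt 𝓘(ℝ, E) x).symm y) ∘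
      (extChartAt 𝓘(ℝ, E) x).symm) y).toLinearMap
    (α ((extChartAt 𝓘(ℝ, E) x).symm y))

/-- A differential form (of possibly mixed degree): a section that is smooth in the charts. -/
def FormSection.IsSmooth (α : FormSection E M) : Prop :=
  ∀ x : M, ContDiffOn ℝ ∞ (α.inChart x) (extChartAt 𝓘(ℝ, E) x).target

/-- The exterior derivative, `dα = ∑ᵢ eⁱ ∧ ∂ᵢα` in the chart at the point in question. -/
def FormSection.d (α : FormSection E M) : FormSection E M := fun x =>
  ∑ i, ExteriorAlgebra.ι ℝ ((Module.finBasis ℝ E).coord i) *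
    fderiv ℝ (α.inChart x) (extChartAt 𝓘(ℝ, E) x x) (Module.finBasis ℝ E i)

variable (E M) in
/-- The de Rham algebra: smooth sections of `⋀ T*M` with the wedge product. -/
def DeRham : Subalgebra ℝ (FormSection E M) where
  carrier := {α | α.IsSmooth}
  mul_mem' {α β} hα hβ x := by
    have h : FormSection.inChart x (α * β) = fun y => α.inChart x y * β.inChart x y := by
      funext y; simp [FormSection.inChart]
    rw [h]
    exact ((LinearMap.toContinuousLinearMap
      ((LinearMap.toContinuousLinearMap : (FormFibre E →ₗ[ℝ] FormFibre E) ≃ₗ[ℝ] _).toLinearMap ∘ₗ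
        LinearMap.mul ℝ (FormFibre E))).contDiff.comp_contDiffOn (hα x)).clm_apply (hβ x)
  add_mem' {α β} hα hβ x := by
    have h : FormSection.inChart x (α + β) = fun y => α.inChart x y + β.inChart x y := by
      funext y; simp [FormSection.inChart]
    rw [h]
    exact (hα x).add (hβ x)
  algebraMap_mem' r x := by
    have h : FormSection.inChart x (algebraMap ℝ (FormSection E M) r) =
        fun _ => algebraMap ℝ (FormFibre E) r := by
      funext y; simp [FormSection.inChart]
    rw [h]
    exact contDiffOn_const

variable (E M) in
/-- The `k`-forms inside the de Rham algebra. -/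
def DeRham.deg (k : ℤ) : Submodule ℝ (DeRham E M) where
  carrier := {α | ∀ x, (α : FormSection E M) x ∈ FormFibre.deg k}
  add_mem' hα hβ x := add_mem (hα x) (hβ x)
  zero_mem' := fun _ => zero_mem _
  smul_mem' c _ hα := fun x => Submodule.smul_mem _ c (hα x)

end Forms

/-! ### Commutative `BV_∞`-algebras -/

section BV

variable {A : Type*} [Ring A] [Algebra ℝ A]

/-- The graded commutator of operators `f`, `g` of degrees `p`, `q`. -/
def gradedCommutator (p q : ℤ) (f g : Module.End ℝ A) : Module.End ℝ A :=
  f * g - ((-1 : ℝ) ^ (p * q)) • (g * f)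

/-- `f` is an operator of degree `k` and of algebraic order at most `r`. -/
def HasOrderLE (𝒜 : ℤ → Submodule ℝ A) : ℕ → ℤ → Module.End ℝ A → Prop
  | 0, k, f => ∃ c ∈ 𝒜 k, f = LinearMap.mulLeft ℝ c
  | r + 1, k, f => (∀ j, ∀ a ∈ 𝒜 j, f a ∈ 𝒜 (j + k)) ∧
      ∀ j, ∀ a ∈ 𝒜 j,
        HasOrderLE 𝒜 r (j + k) (gradedCommutator j k (LinearMap.mulLeft ℝ a) f)

/-- The algebra `A` with the grading `𝒜` and the operators `d = Δ 0, Δ 1, Δ 2, …` is a commutative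
`BV_∞`-algebra. -/
structure IsCommBVInfty (𝒜 : ℤ → Submodule ℝ A) (Δ : ℕ → Module.End ℝ A) : Prop where
  isInternal : DirectSum.IsInternal 𝒜
  one_mem : (1 : A) ∈ 𝒜 0
  mul_mem : ∀ j k, ∀ a ∈ 𝒜 j, ∀ b ∈ 𝒜 k, a * b ∈ 𝒜 (j + k)
  graded_comm : ∀ j k, ∀ a ∈ 𝒜 j, ∀ b ∈ 𝒜 k, a * b = ((-1 : ℝ) ^ (j * k)) • (b * a)
  leibniz : ∀ j, ∀ a ∈ 𝒜 j, ∀ b, Δ 0 (a * b) = Δ 0 a * b + ((-1 : ℝ) ^ j) • (a * Δ 0 b)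
  degree : ∀ n : ℕ, ∀ j, ∀ a ∈ 𝒜 j, Δ n a ∈ 𝒜 (j + (1 - 2 * n))
  multicomplex : ∀ n : ℕ, ∑ i ∈ Finset.range (n + 1), Δ i * Δ (n - i) = 0
  order : ∀ n : ℕ, HasOrderLE 𝒜 (n + 1) (1 - 2 * n) (Δ n)

end BV

/-! ### Almost symplectic manifolds -/

section Geometry

variable (E : Type*) [NormedAddCommGroup E] [NormedSpace ℝ E] [FiniteDimensional ℝ E]
  (M : Type*) [TopologicalSpace M] [ChartedSpace E M]

/-- An almost symplectic structure: a smooth nondegenerate `2`-form `ω`. -/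
structure AlmostSymplectic where
  form : FormSection E M
  smooth : form.IsSmooth
  degree_two : ∀ x, form x ∈ ⋀[ℝ]^2 (Module.Dual ℝ E)
  nondegenerate : ∀ x, Function.Bijective (FormFibre.flat (form x))

namespace AlmostSymplectic

variable {E M} (S : AlmostSymplectic E M)

/-- The value `ωₓ(v, w)`. -/
def eval (x : M) (v w : TangentSpace 𝓘(ℝ, E) x) : ℝ := FormFibre.flat (E := E) (S.form x) v w

/-- The inverse `ω⁻¹` of the `2`-form, a bilinear form on covectors (the Poisson tensor if
`dω = 0`). -/
def inverse (x : M) : Module.Dual ℝ E →ₗ[ℝ] Module.Dual ℝ (Module.Dual ℝ E) :=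
  FormFibre.inverseForm (LinearEquiv.ofBijective (FormFibre.flat (S.form x)) (S.nondegenerate x))

/-- The volume form `ωⁿ / n!`, where `dim M = 2n`. -/
def vol (x : M) : FormFibre E :=
  ((Nat.factorial (Module.finrank ℝ E / 2) : ℝ))⁻¹ • (S.form x) ^ (Module.finrank ℝ E / 2)

/-- The symplectic star operator `⋆_ω` at a point. -/
def starω (x : M) : Module.End ℝ (FormFibre E) := FormFibre.star (S.inverse x) (S.vol x)

/-- The symplectic adjoint of an operator at a point. -/
def adjointω (x : M) (φ : Module.End ℝ (FormFibre E)) : Module.End ℝ (FormFibre E) :=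
  FormFibre.adjoint (S.inverse x) φ

/-- The Lefschetz operator `L = ω ∧ ·` at a point. -/
def L (x : M) : Module.End ℝ (FormFibre E) := LinearMap.mulLeft ℝ (S.form x)

/-- The operator `[d, L] = dω ∧ ·` at a point. -/
def dL (x : M) : Module.End ℝ (FormFibre E) := LinearMap.mulLeft ℝ (S.form.d x)

/-- The symplectic adjoint `Λ` of `L` at a point. -/
def Lam (x : M) : Module.End ℝ (FormFibre E) := S.adjointω x (S.L x)

/-- The operator `[Λ, [d, L]]` at a point. -/
def LamdL (x : M) : Module.End ℝ (FormFibre E) := S.Lam x * S.dL x - S.dL x * S.Lam x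

/-- The symplectic adjoint of the exterior derivative, `d^ω = (-1)ᵏ ⋆_ω d ⋆_ω` on `k`-forms. -/
def dω (α : FormSection E M) : FormSection E M := fun x =>
  S.starω x (FormSection.d (fun y => S.starω y (FormFibre.parity (α y))) x)

/-- `[d, L]^ω`. -/
def dLω (α : FormSection E M) : FormSection E M := fun x => S.adjointω x (S.dL x) (α x)

/-- `[Λ, [d, L]]^ω`. -/
def LamdLω (α : FormSection E M) : FormSection E M := fun x => S.adjointω x (S.LamdL x) (α x)

/-- The operators `d`, `Δ₁ = d^ω + [Λ, [d, L]]^ω`, `Δ₂ = -[d, L]^ω` and `Δₙ = 0` for `n ≥ 3` of the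
almost symplectic manifold. -/
def Δ : ℕ → FormSection E M → FormSection E M
  | 0 => fun α => α.d
  | 1 => fun α => S.dω α + S.LamdLω α
  | 2 => fun α => -S.dLω α
  | _ => fun _ => 0

/-- Contraction with the bivector `π = ω⁻¹`, `i_π = (1/2) ∑ᵢⱼ πⁱʲ i_{eᵢ} i_{eⱼ}`. -/
def contractPoisson (α : FormSection E M) : FormSection E M := fun x =>
  (1 / 2 : ℝ) • ∑ i, ∑ j,
    (S.inverse x ((Module.finBasis ℝ E).coord i) ((Module.finBasis ℝ E).coord j) : ℝ) •
      FormFibre.interior (Module.finBasis ℝ E i)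
        (FormFibre.interior (Module.finBasis ℝ E j) (α x))

/-- The operators `d`, `Δ₁ = [i_π, d]`, `Δₙ = 0` for `n ≥ 2` of Koszul's `BV`-algebra. -/
def koszul : ℕ → FormSection E M → FormSection E M
  | 0 => fun α => α.d
  | 1 => fun α => S.contractPoisson α.d - (S.contractPoisson α).d
  | _ => fun _ => 0

end AlmostSymplectic

/-! ### Almost Hermitian manifolds -/

/-- An almost Hermitian structure: an almost symplectic form `ω` and a smooth almost complex
structure `J` compatible with it, so that `g(X, Y) = ω(X, J Y)` is a Riemannian metric;
equivalently, `ω(X, Y) = g(J X, Y)` for a `J`-invariant metric `g`. -/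
structure AlmostHermitian [IsManifold 𝓘(ℝ, E) ∞ M] extends AlmostSymplectic E M where
  J : (x : M) → TangentSpace 𝓘(ℝ, E) x →L[ℝ] TangentSpace 𝓘(ℝ, E) x
  smooth_J : ContMDiff 𝓘(ℝ, E) (𝓘(ℝ, E).prod 𝓘(ℝ, E →L[ℝ] E)) ∞
    (fun x => TotalSpace.mk' (E →L[ℝ] E)
      (E := fun x : M => TangentSpace 𝓘(ℝ, E) x →L[ℝ] TangentSpace 𝓘(ℝ, E) x) x (J x))
  J_sq : ∀ x v, J x (J x v) = -v
  symm : ∀ x v w, toAlmostSymplectic.eval x v (J x w) = toAlmostSymplectic.eval x w (J x v)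
  pos : ∀ x v, v ≠ 0 → 0 < toAlmostSymplectic.eval x v (J x v)

namespace AlmostHermitian

variable {E M} [IsManifold 𝓘(ℝ, E) ∞ M] (H : AlmostHermitian E M)

/-- The endomorphism `J` of a tangent space, as a linear map. -/
def Jlin (x : M) : E →ₗ[ℝ] E := (H.J x).toLinearMap

/-- `v ↦ g(v, ·)` for the metric `g(v, w) = ω(v, J w)`. -/
def metricFlat (x : M) : E →ₗ[ℝ] Module.Dual ℝ E :=
  (H.Jlin x).dualMap ∘ₗ FormFibre.flat (H.form x)

theorem metricFlat_bijective (x : M) : Function.Bijective (H.metricFlat x) := by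
  have hJ : Function.Injective (H.Jlin x).dualMap := by
    intro a b hab
    ext v
    have h := LinearMap.congr_fun hab (-(H.Jlin x v))
    have hv : H.Jlin x (-(H.Jlin x v)) = v := by
      have := H.J_sq x v
      rw [map_neg]
      exact neg_eq_iff_eq_neg.mpr this
    simpa [LinearMap.dualMap_apply, hv] using h
  have h2 : Function.Bijective (H.Jlin x).dualMap :=
    ⟨hJ, (LinearMap.injective_iff_surjective).mp hJ⟩
  exact h2.comp (H.nondegenerate x)

/-- The metric on covectors. -/
def inverseMetric (x : M) : Module.Dual ℝ E →ₗ[ℝ] Module.Dual ℝ (Module.Dual ℝ E) :=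
  FormFibre.inverseForm (LinearEquiv.ofBijective (H.metricFlat x) (H.metricFlat_bijective x))

/-- The Hodge star operator `⋆` at a point; the Riemannian volume form is `ωⁿ / n!`. -/
def hodgeStar (x : M) : Module.End ℝ (FormFibre E) :=
  FormFibre.star (H.inverseMetric x) (H.vol x)

/-- The metric adjoint of an operator at a point. -/
def adjoint (x : M) (φ : Module.End ℝ (FormFibre E)) : Module.End ℝ (FormFibre E) :=
  FormFibre.adjoint (H.inverseMetric x) φ

/-- The extension of `J` to forms as an algebra automorphism, `(Jα)(X, …) = α(JX, …)`. -/
def Jform (x : M) : Module.End ℝ (FormFibre E) :=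
  (FormFibre.pullback (H.Jlin x)).toLinearMap

/-- The inverse `J⁻¹` on forms, induced by `J⁻¹ = -J` on vectors. -/
def JformInv (x : M) : Module.End ℝ (FormFibre E) :=
  (FormFibre.pullback (-H.Jlin x)).toLinearMap

/-- The metric adjoint `Λ = L^*` of the Lefschetz operator at a point. -/
def metricLam (x : M) : Module.End ℝ (FormFibre E) := H.adjoint x (H.L x)

/-- The torsion operator `T = [Λ, dω ∧ ·]` at a point. -/
def torsion (x : M) : Module.End ℝ (FormFibre E) :=
  H.metricLam x * LinearMap.mulLeft ℝ (H.form.d x) - LinearMap.mulLeft ℝ (H.form.d x) * H.metricLam x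

/-- `d_c = J⁻¹ d J`. -/
def dc (α : FormSection E M) : FormSection E M := fun x =>
  H.JformInv x (FormSection.d (fun y => H.Jform y (α y)) x)

/-- `d_c^* = -⋆ d_c ⋆ = -⋆ J⁻¹ d J ⋆`. -/
def dcStar (α : FormSection E M) : FormSection E M := fun x =>
  -H.hodgeStar x (H.dc (fun y => H.hodgeStar y (α y)) x)

/-- `T_c^*`, the metric adjoint of `T_c = J⁻¹ T J`. -/
def TcStar (α : FormSection E M) : FormSection E M := fun x =>
  H.adjoint x (H.JformInv x * H.torsion x * H.Jform x) (α x)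

/-- `dω_c^*`, the metric adjoint of `dω_c = J⁻¹ (dω ∧ ·) J`. -/
def dωcStar (α : FormSection E M) : FormSection E M := fun x =>
  H.adjoint x (H.JformInv x * LinearMap.mulLeft ℝ (H.form.d x) * H.Jform x) (α x)

/-- The operators `d`, `Δ₁ = -(d_c^* + T_c^*)`, `Δ₂ = dω_c^*` and `Δₙ = 0` for `n ≥ 3` of the
almost Hermitian manifold. -/
def hermitianΔ : ℕ → FormSection E M → FormSection E M
  | 0 => fun α => α.d
  | 1 => fun α => -(H.dcStar α + H.TcStar α)
  | 2 => fun α => H.dωcStar α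
  | _ => fun _ => 0

end AlmostHermitian

end Geometry

end

/-!
Let `π = ω⁻¹`. Contraction `Λ = i_π` has degree `-2` and order `2`, and it is the symplectic adjoint
of `L = ω ∧ ·`. On the symplectic side `Δ₁ = d^ω + [Λ, [d, L]]^ω` is the commutator `[Λ, d]`, and
`Δ₂ = -[d, L]^ω` is `½ [Λ, [Λ, d]]`. As the adjoint of multiplication by `dω`, up to sign, `Δ₂`
commutes with the adjoint `Λ` of multiplication by `ω`. Hence `d, Δ₁, Δ₂, 0, …` are the coefficients
of `exp(tΛ) d exp(-tΛ)`: the `BV_∞` relations are the coefficients of `exp(tΛ) d² exp(-tΛ) = 0`, and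
the bounds on the orders follow from those of `Λ` and `d`, since a commutator has order one less
than a composition. On the Hermitian side, the metric on covectors is the form `ω⁻¹` composed with
`J`, so the metric star operator and adjoints are the symplectic ones up to the action of `J` on
forms.
-/

noncomputable section

open scoped Topology
open CliffordAlgebra (contractLeft contractLeft_ι_mul involute)
open ExteriorAlgebra (ι ιMulti ιMulti_succ_apply algebraMapInv)
open Module (Basis Dual End finBasis finrank)

/-! ### Contraction on exterior algebras -/

section Contraction

variable {R V : Type*} [CommRing R] [AddCommGroup V] [Module R V]

theorem contractLeft_involute {Q : QuadraticForm R V} (d : Dual R V) (x : CliffordAlgebra Q) :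
    contractLeft d (involute x) = -involute (contractLeft d x) := by
  induction x using CliffordAlgebra.left_induction with
  | algebraMap r => simp
  | add x y hx hy => simp only [map_add, hx, hy, neg_add]
  | ι_mul x v hx =>
    simp only [map_mul, CliffordAlgebra.involute_ι, neg_mul, map_neg, contractLeft_ι_mul, hx,
      map_sub, map_smul, mul_neg]

theorem contractLeft_mul {Q : QuadraticForm R V} (d : Dual R V) (x y : CliffordAlgebra Q) :
    contractLeft d (x * y) = contractLeft d x * y + involute x * contractLeft d y := by
  induction x using CliffordAlgebra.left_induction with
  | algebraMap r => simp [← Algebra.smul_def]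
  | add x z hx hz => simp only [add_mul, map_add, hx, hz]; abel
  | ι_mul x v hx =>
    simp only [mul_assoc, contractLeft_ι_mul, hx, mul_add, sub_mul, map_mul,
      CliffordAlgebra.involute_ι, neg_mul, smul_mul_assoc]
    abel

theorem ι_mul_ι_anticomm (v w : V) : ι R v * ι R w = -(ι R w * ι R v) :=
  eq_neg_of_add_eq_zero_left (ExteriorAlgebra.ι_add_mul_swap v w)

theorem ι_mul_eq_involute_mul_ι (v : V) (x : ExteriorAlgebra R V) :
    ι R v * x = involute x * ι R v := by
  induction x using CliffordAlgebra.left_induction with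
  | algebraMap r => simp [Algebra.commutes]
  | add x y hx hy => simp only [mul_add, map_add, add_mul, hx, hy]
  | ι_mul x w hx =>
    rw [map_mul, CliffordAlgebra.involute_ι, mul_assoc, ← hx, neg_mul, ← mul_assoc, ← mul_assoc,
      ι_mul_ι_anticomm, neg_mul]

theorem ι_mem_exteriorPower (v : V) : ι R v ∈ ⋀[R]^1 V := by
  simp only [pow_one, LinearMap.mem_range_self]

theorem mul_mem_exteriorPower {j k : ℕ} {x y : ExteriorAlgebra R V} (hx : x ∈ ⋀[R]^j V)
    (hy : y ∈ ⋀[R]^k V) : x * y ∈ ⋀[R]^(j + k) V :=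
  SetLike.mul_mem_graded (A := fun i : ℕ => ⋀[R]^i V) hx hy

theorem ι_mul_mem_exteriorPower (v : V) {k : ℕ} {x : ExteriorAlgebra R V} (hx : x ∈ ⋀[R]^k V) :
    ι R v * x ∈ ⋀[R]^(k + 1) V :=
  add_comm 1 k ▸ mul_mem_exteriorPower (ι_mem_exteriorPower v) hx

theorem mem_exteriorPower_zero {x : ExteriorAlgebra R V} :
    x ∈ ⋀[R]^0 V ↔ ∃ r, algebraMap R _ r = x := by
  simp only [pow_zero, Submodule.mem_one]

theorem mem_exteriorPower_one {x : ExteriorAlgebra R V} : x ∈ ⋀[R]^1 V ↔ ∃ v, ι R v = x := by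
  simp only [pow_one, LinearMap.mem_range]

theorem exteriorPower_induction {p : ∀ k, ∀ x ∈ ⋀[R]^k V, Prop}
    (algebraMap : ∀ r, p 0 (algebraMap R _ r) (by simp [Submodule.mem_one]))
    (add : ∀ k x y hx hy, p k x hx → p k y hy → p k (x + y) (add_mem hx hy))
    (ι_mul : ∀ k v x hx, p k x hx → p (k + 1) (ι R v * x) (ι_mul_mem_exteriorPower v hx))
    {k : ℕ} {x : ExteriorAlgebra R V} (hx : x ∈ ⋀[R]^k V) : p k x hx := by
  induction hx using Submodule.pow_induction_on_left' with
  | algebraMap r => exact algebraMap r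
  | add x y k hx hy ihx ihy => exact add k x y hx hy ihx ihy
  | mem_mul m hm k x hx ih =>
    obtain ⟨v, rfl⟩ := hm
    exact ι_mul k v x hx ih

theorem involute_of_mem_exteriorPower {k : ℕ} {x : ExteriorAlgebra R V} (hx : x ∈ ⋀[R]^k V) :
    involute x = (-1 : R) ^ k • x := by
  induction hx using exteriorPower_induction with
  | algebraMap r => simp
  | add k x y _ _ hx hy => rw [map_add, hx, hy, smul_add]
  | ι_mul k v x _ ih => simp [ih, pow_succ]

theorem mul_comm_of_mem_exteriorPower {j k : ℕ} {x y : ExteriorAlgebra R V} (hx : x ∈ ⋀[R]^j V)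
    (hy : y ∈ ⋀[R]^k V) : x * y = (-1 : R) ^ (j * k) • (y * x) := by
  induction hx using exteriorPower_induction with
  | algebraMap r => simp [Algebra.commutes]
  | add j x x' _ _ hx hx' => rw [add_mul, mul_add, hx, hx', smul_add]
  | ι_mul j v x _ ih =>
    rw [mul_assoc, ih, mul_smul_comm, ← mul_assoc, ι_mul_eq_involute_mul_ι,
      involute_of_mem_exteriorPower hy, smul_mul_assoc, smul_mul_assoc, smul_smul, mul_assoc,
      ← pow_add, add_one_mul]

theorem commute_of_mem_exteriorPower_two {τ : ExteriorAlgebra R V} (hτ : τ ∈ ⋀[R]^2 V)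
    (x : ExteriorAlgebra R V) : Commute τ x := by
  induction x using ExteriorAlgebra.induction with
  | algebraMap r => exact Algebra.commute_algebraMap_right r τ
  | ι v => exact (by simpa using mul_comm_of_mem_exteriorPower hτ (ι_mem_exteriorPower v) :
      τ * ι R v = ι R v * τ)
  | mul x y hx hy => exact hx.mul_right hy
  | add x y hx hy => exact hx.add_right hy

theorem exteriorPower_two_induction {p : ∀ τ ∈ ⋀[R]^2 V, Prop}
    (ι_mul_ι : ∀ v w, p (ι R v * ι R w)
      (ι_mul_mem_exteriorPower v (ι_mem_exteriorPower w)))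
    (add : ∀ x y hx hy, p x hx → p y hy → p (x + y) (add_mem hx hy))
    {τ : ExteriorAlgebra R V} (hτ : τ ∈ ⋀[R]^2 V) : p τ hτ := by
  have mem_range_mul : τ ∈ LinearMap.range (ι R (M := V)) * LinearMap.range (ι R) := by
    rwa [← pow_two]
  induction mem_range_mul using Submodule.mul_induction_on' with
  | mem_mul_mem x hx y hy =>
    obtain ⟨v, rfl⟩ := hx
    obtain ⟨w, rfl⟩ := hy
    exact ι_mul_ι v w
  | add x hx y hy ihx ihy =>
    rw [← pow_two] at hx hy
    exact add x y hx hy (ihx hx) (ihy hy)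

theorem contractLeft_of_mem_exteriorPower_zero (d : Dual R V) {x : ExteriorAlgebra R V}
    (hx : x ∈ ⋀[R]^0 V) : contractLeft d x = 0 := by
  obtain ⟨r, rfl⟩ := mem_exteriorPower_zero.mp hx
  exact CliffordAlgebra.contractLeft_algebraMap _ _ _

theorem contractLeft_mem_exteriorPower (d : Dual R V) {k : ℕ} {x : ExteriorAlgebra R V}
    (hx : x ∈ ⋀[R]^(k + 1) V) : contractLeft d x ∈ ⋀[R]^k V := by
  suffices h : ∀ l, ∀ x ∈ ⋀[R]^l V, ∀ k, l = k + 1 → contractLeft d x ∈ ⋀[R]^k V from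
    h _ x hx k rfl
  intro l x hx
  induction hx using exteriorPower_induction with
  | algebraMap r => simp
  | add l x y _ _ hx hy =>
    intro k hk
    rw [map_add]
    exact add_mem (hx k hk) (hy k hk)
  | ι_mul l v x hx ih =>
    intro k hk
    obtain rfl : l = k := by omega
    rw [contractLeft_ι_mul]
    refine sub_mem (Submodule.smul_mem _ _ hx) ?_
    cases l with
    | zero => simp [contractLeft_of_mem_exteriorPower_zero d hx]
    | succ l => exact ι_mul_mem_exteriorPower v (ih l rfl)

theorem algebraMapInv_of_mem_exteriorPower_succ {k : ℕ} {x : ExteriorAlgebra R V}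
    (hx : x ∈ ⋀[R]^(k + 1) V) : algebraMapInv x = 0 := by
  suffices h : ∀ l, ∀ x ∈ ⋀[R]^l V, l ≠ 0 → algebraMapInv x = 0 from h _ x hx k.succ_ne_zero
  intro l x hx
  induction hx using exteriorPower_induction with
  | algebraMap r => simp
  | add l x y _ _ hx hy => intro hl; rw [map_add, hx hl, hy hl, add_zero]
  | ι_mul l v x _ _ => intro _; simp [ExteriorAlgebra.algebraMapInv]

theorem contractLeft_ιMulti (d : Dual R V) {k : ℕ} (v : Fin (k + 1) → V) :
    contractLeft d (ιMulti R (k + 1) v) =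
      ∑ j : Fin (k + 1), (-1 : R) ^ (j : ℕ) • d (v j) • ιMulti R k fun i => v (j.succAbove i) := by
  induction k with
  | zero => simp [ιMulti_succ_apply, Algebra.algebraMap_eq_smul_one]
  | succ k ih =>
    rw [ιMulti_succ_apply, contractLeft_ι_mul, ih, Fin.sum_univ_succ (n := k + 1), Finset.mul_sum,
      sub_eq_add_neg, ← Finset.sum_neg_distrib]
    congr 1
    · simp [Matrix.vecTail, Function.comp_def]
    · refine Finset.sum_congr rfl fun j _ => ?_
      rw [ιMulti_succ_apply (v := fun i => v (j.succ.succAbove i))]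
      simp [Matrix.vecTail, Function.comp_def, pow_succ]

section DualFamilies

variable {κ : Type*} [Fintype κ] {e : κ → V} {f : κ → Dual R V}

theorem sum_ι_mul_contractLeft (hef : ∀ v, ∑ i, f i v • e i = v) {k : ℕ} {x : ExteriorAlgebra R V}
    (hx : x ∈ ⋀[R]^k V) : ∑ i, ι R (e i) * contractLeft (f i) x = (k : R) • x := by
  induction hx using exteriorPower_induction with
  | algebraMap r => simp
  | add k x y _ _ hx hy => simp only [map_add, mul_add, Finset.sum_add_distrib, hx, hy, smul_add]
  | ι_mul k v x _ ih =>
    have move_past_v : ∀ i, ι R (e i) * contractLeft (f i) (ι R v * x) =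
        ι R (f i v • e i) * x + ι R v * (ι R (e i) * contractLeft (f i) x) := fun i => by
      rw [contractLeft_ι_mul, mul_sub, ← mul_assoc, ι_mul_ι_anticomm, map_smul, ← mul_assoc]
      simp
    simp_rw [move_past_v]
    rw [Finset.sum_add_distrib, ← Finset.sum_mul, ← map_sum, hef, ← Finset.mul_sum, ih,
      mul_smul_comm, Nat.cast_succ, add_smul, one_smul, add_comm]

theorem sum_contractLeft_ι_mul (hef : ∀ v, ∑ i, f i v • e i = v) {k : ℕ} {x : ExteriorAlgebra R V}
    (hx : x ∈ ⋀[R]^k V) :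
    ∑ i, contractLeft (f i) (ι R (e i) * x) = (∑ i, f i (e i) - k) • x := by
  simp_rw [contractLeft_ι_mul]
  rw [Finset.sum_sub_distrib, sum_ι_mul_contractLeft hef hx, sub_smul, Finset.sum_smul]

end DualFamilies

end Contraction

section Field

variable {K V : Type*} [Field K] [AddCommGroup V] [Module K V] [FiniteDimensional K V]

theorem eq_zero_of_mem_exteriorPower_of_finrank_lt {k : ℕ} (hk : finrank K V < k)
    {x : ExteriorAlgebra K V} (hx : x ∈ ⋀[K]^k V) : x = 0 := by
  have finrank_eq_zero : finrank K (⋀[K]^k V) = 0 := by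
    rw [exteriorPower.finrank_eq, Nat.choose_eq_zero_of_lt hk]
  rwa [Submodule.finrank_eq_zero.mp finrank_eq_zero, Submodule.mem_bot] at hx

theorem exteriorAlgebra_linearMap_ext {N : Type*} [AddCommGroup N] [Module K N]
    {f g : ExteriorAlgebra K V →ₗ[K] N}
    (h : ∀ k ≤ finrank K V, ∀ x ∈ ⋀[K]^k V, f x = g x) : f = g := by
  refine LinearMap.ext fun x => ?_
  induction x using DirectSum.Decomposition.inductionOn (fun i : ℕ => ⋀[K]^i V) with
  | zero => simp only [map_zero]
  | add x y hx hy => rw [map_add, map_add, hx, hy]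
  | @homogeneous k x =>
    by_cases hk : k ≤ finrank K V
    · exact h k hk x x.2
    · simp [eq_zero_of_mem_exteriorPower_of_finrank_lt (not_le.mp hk) x.2]

theorem sum_decompose_exteriorPower (x : ExteriorAlgebra K V) :
    ∑ k ∈ Finset.range (finrank K V + 1),
      (DirectSum.decompose (fun i : ℕ => ⋀[K]^i V) x k : ExteriorAlgebra K V) = x := by
  classical
  conv_rhs => rw [← DirectSum.sum_support_decompose (fun i : ℕ => ⋀[K]^i V) x]
  refine (Finset.sum_subset (fun k hk => ?_) fun k _ hk => ?_).symm
  · by_contra hlt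
    rw [Finset.mem_range, Nat.lt_succ_iff, not_le] at hlt
    exact DFinsupp.mem_support_iff.mp hk
      (Subtype.ext (eq_zero_of_mem_exteriorPower_of_finrank_lt hlt (SetLike.coe_mem _)))
  · rw [DFinsupp.notMem_support_iff.mp hk, ZeroMemClass.coe_zero]

variable [CharZero K]

theorem eq_zero_of_forall_contractLeft_eq_zero {k : ℕ} {x : ExteriorAlgebra K V}
    (hx : x ∈ ⋀[K]^(k + 1) V) (h : ∀ d, contractLeft d x = 0) : x = 0 := by
  have euler := sum_ι_mul_contractLeft (f := (finBasis K V).coord) (finBasis K V).sum_repr hx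
  simp only [h, mul_zero, Finset.sum_const_zero] at euler
  exact (smul_eq_zero.mp euler.symm).resolve_left (Nat.cast_ne_zero.mpr k.succ_ne_zero)

theorem eq_zero_of_forall_ι_mul_eq_zero {k : ℕ} (hk : k < finrank K V) {x : ExteriorAlgebra K V}
    (hx : x ∈ ⋀[K]^k V) (h : ∀ v, ι K v * x = 0) : x = 0 := by
  have euler := sum_contractLeft_ι_mul (f := (finBasis K V).coord) (finBasis K V).sum_repr hx
  simp only [h, map_zero, Finset.sum_const_zero, Basis.coord_apply, Basis.repr_self,
    Finsupp.single_eq_same, Finset.sum_const, Finset.card_univ, Fintype.card_fin, nsmul_one]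
    at euler
  exact (smul_eq_zero.mp euler.symm).resolve_left
    (sub_ne_zero.mpr (Nat.cast_injective.ne hk.ne'))

theorem eq_zero_of_forall_mul_eq_zero {k l : ℕ} (hkl : k + l = finrank K V)
    {x : ExteriorAlgebra K V} (hx : x ∈ ⋀[K]^l V) (h : ∀ y ∈ ⋀[K]^k V, y * x = 0) : x = 0 := by
  induction k generalizing l x with
  | zero => simpa using h 1 (by simp)
  | succ k ih =>
    refine eq_zero_of_forall_ι_mul_eq_zero (by omega) hx fun v => ?_
    refine ih (l := l + 1) (by omega) (ι_mul_mem_exteriorPower v hx) fun y hy => ?_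
    rw [← mul_assoc]
    exact h _ (mul_mem_exteriorPower hy (ι_mem_exteriorPower v))

end Field

/-! ### Extending a pairing of vector spaces to exterior algebras -/

section Pairing

variable {R V W : Type*} [CommRing R] [AddCommGroup V] [Module R V] [AddCommGroup W] [Module R W]
  (c : V →ₗ[R] Dual R W)

/-- The iterated contraction `v₁ ∧ … ∧ vₖ ↦ i(c vₖ) ⋯ i(c v₁)` on `⋀ W`; it reverses products, hence
the opposite algebra. -/
def iteratedContraction : ExteriorAlgebra R V →ₐ[R] (End R (ExteriorAlgebra R W))ᵐᵒᵖ :=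
  ExteriorAlgebra.lift R ⟨(MulOpposite.opLinearEquiv R).toLinearMap ∘ₗ contractLeft ∘ₗ c, fun v =>
    MulOpposite.unop_injective <| LinearMap.ext fun x =>
      CliffordAlgebra.contractLeft_contractLeft (c v) x⟩

theorem iteratedContraction_ι (v : V) :
    (iteratedContraction c (ι R v)).unop = contractLeft (c v) := by
  simp [iteratedContraction]

theorem iteratedContraction_ι_mul (v : V) (x : ExteriorAlgebra R V) (y : ExteriorAlgebra R W) :
    (iteratedContraction c (ι R v * x)).unop y =
      (iteratedContraction c x).unop (contractLeft (c v) y) := by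
  rw [map_mul, MulOpposite.unop_mul, iteratedContraction_ι, Module.End.mul_apply]

/-- The pairing of `⋀ V` with `⋀ W` extending `c`: the scalar part of the iterated contraction. -/
def exteriorPairing : ExteriorAlgebra R V →ₗ[R] ExteriorAlgebra R W →ₗ[R] R :=
  LinearMap.mk₂ R (fun x y => algebraMapInv ((iteratedContraction c x).unop y))
    (by simp) (by simp) (by simp) (by simp)

theorem exteriorPairing_ι_mul (v : V) (x : ExteriorAlgebra R V) (y : ExteriorAlgebra R W) :
    exteriorPairing c (ι R v * x) y = exteriorPairing c x (contractLeft (c v) y) :=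
  congrArg algebraMapInv (iteratedContraction_ι_mul c v x y)

theorem exteriorPairing_algebraMap (r : R) (y : ExteriorAlgebra R W) :
    exteriorPairing c (algebraMap R _ r) y = r * algebraMapInv y := by
  simp [exteriorPairing]

theorem exteriorPairing_mul_ι (w : W) (x : ExteriorAlgebra R V) (y : ExteriorAlgebra R W) :
    exteriorPairing c x (ι R w * y) = exteriorPairing c (contractLeft (c.flip w) x) y := by
  induction x using CliffordAlgebra.left_induction generalizing y with
  | algebraMap r =>
    rw [exteriorPairing_algebraMap, CliffordAlgebra.contractLeft_algebraMap]
    simp [algebraMapInv]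
  | add x z hx hz => simp only [map_add, LinearMap.add_apply, hx, hz]
  | ι_mul x v hx =>
    rw [exteriorPairing_ι_mul, contractLeft_ι_mul, map_sub, hx, contractLeft_ι_mul, map_sub,
      LinearMap.sub_apply, exteriorPairing_ι_mul]
    simp

theorem exteriorPairing_ιMulti {k : ℕ} (v : Fin k → V) (w : Fin k → W) :
    exteriorPairing c (ιMulti R k v) (ιMulti R k w) =
      Matrix.det (Matrix.of fun i j => c (v i) (w j)) := by
  induction k with
  | zero => simp [exteriorPairing]
  | succ k ih =>
    rw [ιMulti_succ_apply (v := v), exteriorPairing_ι_mul, contractLeft_ιMulti, map_sum,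
      Matrix.det_succ_row_zero]
    refine Finset.sum_congr rfl fun j _ => ?_
    rw [map_smul, map_smul, ih]
    simp only [smul_eq_mul, Matrix.of_apply, mul_assoc]
    rfl

theorem exteriorPairing_of_ne {k l : ℕ} (hkl : k ≠ l) {x : ExteriorAlgebra R V}
    {y : ExteriorAlgebra R W} (hx : x ∈ ⋀[R]^k V) (hy : y ∈ ⋀[R]^l W) :
    exteriorPairing c x y = 0 := by
  induction hx using exteriorPower_induction generalizing l y with
  | algebraMap r =>
    obtain ⟨l, rfl⟩ := Nat.exists_eq_succ_of_ne_zero hkl.symm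
    rw [exteriorPairing_algebraMap, algebraMapInv_of_mem_exteriorPower_succ hy, mul_zero]
  | add k x z _ _ hx hz => rw [map_add, LinearMap.add_apply, hx hkl hy, hz hkl hy, add_zero]
  | ι_mul k v x _ ih =>
    rw [exteriorPairing_ι_mul]
    cases l with
    | zero => rw [contractLeft_of_mem_exteriorPower_zero _ hy, map_zero]
    | succ l => exact ih (by omega) (contractLeft_mem_exteriorPower _ hy)

theorem exteriorPairing_decompose_left (x : ExteriorAlgebra R V) {k : ℕ} {y : ExteriorAlgebra R W}
    (hy : y ∈ ⋀[R]^k W) :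
    exteriorPairing c (DirectSum.decompose (fun i : ℕ => ⋀[R]^i V) x k) y =
      exteriorPairing c x y := by
  induction x using DirectSum.Decomposition.inductionOn (fun i : ℕ => ⋀[R]^i V) with
  | zero => simp
  | add x z hx hz =>
    rw [DirectSum.decompose_add, DirectSum.add_apply, Submodule.coe_add, map_add, map_add,
      LinearMap.add_apply, LinearMap.add_apply, hx, hz]
  | @homogeneous i x =>
    obtain rfl | hik := eq_or_ne i k
    · rw [DirectSum.decompose_of_mem_same (fun i : ℕ => ⋀[R]^i V) x.2]
    · rw [DirectSum.decompose_of_mem_ne (fun i : ℕ => ⋀[R]^i V) x.2 hik, map_zero,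
        LinearMap.zero_apply, exteriorPairing_of_ne c hik x.2 hy]

theorem exteriorPairing_decompose_right {k : ℕ} {x : ExteriorAlgebra R V} (hx : x ∈ ⋀[R]^k V)
    (y : ExteriorAlgebra R W) :
    exteriorPairing c x (DirectSum.decompose (fun i : ℕ => ⋀[R]^i W) y k) =
      exteriorPairing c x y := by
  induction y using DirectSum.Decomposition.inductionOn (fun i : ℕ => ⋀[R]^i W) with
  | zero => simp
  | add y z hy hz =>
    rw [DirectSum.decompose_add, DirectSum.add_apply, Submodule.coe_add, map_add, map_add, hy,
      hz]
  | @homogeneous i y =>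
    obtain rfl | hik := eq_or_ne i k
    · rw [DirectSum.decompose_of_mem_same (fun i : ℕ => ⋀[R]^i W) y.2]
    · rw [DirectSum.decompose_of_mem_ne (fun i : ℕ => ⋀[R]^i W) y.2 hik, map_zero,
        exteriorPairing_of_ne c hik.symm hx y.2]

theorem pairingDual_map_eq_exteriorPairing (c : V →ₗ[R] Dual R W) {k : ℕ} (x : ⋀[R]^k V)
    (y : ⋀[R]^k W) :
    exteriorPower.pairingDual R W k (exteriorPower.map k c x) y =
      exteriorPairing c (x : ExteriorAlgebra R V) (y : ExteriorAlgebra R W) := by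
  suffices h : exteriorPower.pairingDual R W k ∘ₗ exteriorPower.map k c =
      (exteriorPairing c).compl₁₂ (⋀[R]^k V).subtype (⋀[R]^k W).subtype from
    congrArg (fun f => f x y) h
  apply exteriorPower.linearMap_ext
  ext v : 1
  apply exteriorPower.linearMap_ext
  ext w : 1
  simp only [LinearMap.compAlternatingMap_apply, LinearMap.comp_apply,
    exteriorPower.map_apply_ιMulti, exteriorPower.pairingDual_ιMulti_ιMulti,
    LinearMap.compl₁₂_apply, Submodule.subtype_apply, exteriorPower.ιMulti_apply_coe,
    exteriorPairing_ιMulti, Function.comp_apply]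
  exact (Matrix.det_transpose _).symm

end Pairing

theorem eq_zero_of_forall_exteriorPairing_eq_zero {K V W : Type*} [Field K] [CharZero K]
    [AddCommGroup V] [Module K V] [AddCommGroup W] [Module K W] [FiniteDimensional K W]
    {c : V →ₗ[K] Dual K W} (hc : Function.Surjective c) {y : ExteriorAlgebra K W}
    (h : ∀ x, exteriorPairing c x y = 0) : y = 0 := by
  have homogeneous : ∀ k, ∀ y ∈ ⋀[K]^k W, (∀ x, exteriorPairing c x y = 0) → y = 0 := by
    intro k
    induction k with
    | zero =>
      intro y hy h
      obtain ⟨r, rfl⟩ := mem_exteriorPower_zero.mp hy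
      have := h 1
      rw [← map_one (algebraMap K _), exteriorPairing_algebraMap, one_mul,
        ExteriorAlgebra.algebraMap_leftInverse] at this
      rw [this, map_zero]
    | succ k ih =>
      intro y hy h
      refine eq_zero_of_forall_contractLeft_eq_zero hy fun d =>
        ih _ (contractLeft_mem_exteriorPower d hy) fun x => ?_
      obtain ⟨v, rfl⟩ := hc d
      rw [← exteriorPairing_ι_mul, h]
  rw [← sum_decompose_exteriorPower y]
  refine Finset.sum_eq_zero fun k _ => homogeneous k _ (SetLike.coe_mem _) fun x => ?_
  rw [← exteriorPairing_decompose_left c x (SetLike.coe_mem _),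
    exteriorPairing_decompose_right c (SetLike.coe_mem _), h]

/-! ### Operators of finite order -/

section Order

variable {A : Type*} [Ring A] [Algebra ℝ A] {𝒜 : ℤ → Submodule ℝ A}

theorem neg_one_zpow_sq (n : ℤ) : (-1 : ℝ) ^ n * (-1 : ℝ) ^ n = 1 := by
  rw [← zpow_add₀ (by norm_num), Even.neg_one_zpow ⟨n, rfl⟩]

theorem gradedCommutator_add (p q : ℤ) (f g g' : End ℝ A) :
    gradedCommutator p q f (g + g') = gradedCommutator p q f g + gradedCommutator p q f g' := by
  simp only [gradedCommutator, mul_add, add_mul, smul_add]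
  abel

theorem gradedCommutator_smul (p q : ℤ) (f : End ℝ A) (r : ℝ) (g : End ℝ A) :
    gradedCommutator p q f (r • g) = r • gradedCommutator p q f g := by
  simp only [gradedCommutator, mul_smul_comm, smul_mul_assoc, smul_sub, smul_comm r]

theorem gradedCommutator_swap (p q : ℤ) (f g : End ℝ A) :
    gradedCommutator p q f g = (-(-1 : ℝ) ^ (p * q)) • gradedCommutator q p g f := by
  simp only [gradedCommutator, smul_sub, smul_smul, neg_mul, mul_comm q p, neg_one_zpow_sq]
  module

theorem gradedCommutator_mul (j p q : ℤ) (a f g : End ℝ A) :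
    gradedCommutator j (p + q) a (f * g) =
      gradedCommutator j p a f * g + (-1 : ℝ) ^ (j * p) • (f * gradedCommutator j q a g) := by
  simp only [gradedCommutator, mul_add, zpow_add₀ (show (-1 : ℝ) ≠ 0 by norm_num), sub_mul,
    mul_sub, smul_mul_assoc, mul_smul_comm, mul_assoc, smul_sub, smul_smul]
  abel

theorem gradedCommutator_jacobi (j p q : ℤ) (a f g : End ℝ A) :
    gradedCommutator j (p + q) a (gradedCommutator p q f g) =
      gradedCommutator (j + p) q (gradedCommutator j p a f) g +
        (-1 : ℝ) ^ (j * p) • gradedCommutator p (j + q) f (gradedCommutator j q a g) := by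
  have sq_eq_one := neg_one_zpow_sq (j * p)
  simp only [gradedCommutator, mul_add, add_mul, zpow_add₀ (show (-1 : ℝ) ≠ 0 by norm_num),
    mul_comm p j]
  generalize (-1 : ℝ) ^ (j * p) = x at *
  generalize (-1 : ℝ) ^ (j * q) = y at *
  generalize (-1 : ℝ) ^ (p * q) = z at *
  simp only [sub_mul, mul_sub, smul_mul_assoc, mul_smul_comm, mul_assoc, smul_sub, smul_smul]
  rw [← mul_assoc x x z, sq_eq_one, ← mul_assoc x x (z * y), sq_eq_one, one_mul, one_mul]
  module

namespace HasOrderLE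

theorem zero (r : ℕ) (k : ℤ) : HasOrderLE 𝒜 r k (0 : End ℝ A) := by
  induction r generalizing k with
  | zero => exact ⟨0, zero_mem _, by simp⟩
  | succ r ih =>
    refine ⟨fun j a _ => by simp, fun j a _ => ?_⟩
    simpa only [gradedCommutator, mul_zero, zero_mul, smul_zero, sub_zero] using ih (j + k)

theorem add {r : ℕ} {k : ℤ} {f g : End ℝ A} (hf : HasOrderLE 𝒜 r k f)
    (hg : HasOrderLE 𝒜 r k g) : HasOrderLE 𝒜 r k (f + g) := by
  induction r generalizing k f g with
  | zero =>
    obtain ⟨c, hc, rfl⟩ := hf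
    obtain ⟨c', hc', rfl⟩ := hg
    exact ⟨c + c', add_mem hc hc', LinearMap.ext fun x => (add_mul c c' x).symm⟩
  | succ r ih =>
    refine ⟨fun j a ha => add_mem (hf.1 j a ha) (hg.1 j a ha), fun j a ha => ?_⟩
    rw [gradedCommutator_add]
    exact ih (hf.2 j a ha) (hg.2 j a ha)

theorem smul {r : ℕ} {k : ℤ} {f : End ℝ A} (hf : HasOrderLE 𝒜 r k f) (t : ℝ) :
    HasOrderLE 𝒜 r k (t • f) := by
  induction r generalizing k f with
  | zero =>
    obtain ⟨c, hc, rfl⟩ := hf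
    exact ⟨t • c, Submodule.smul_mem _ t hc, LinearMap.ext fun x => (smul_mul_assoc t c x).symm⟩
  | succ r ih =>
    refine ⟨fun j a ha => Submodule.smul_mem _ t (hf.1 j a ha), fun j a ha => ?_⟩
    rw [gradedCommutator_smul]
    exact ih (hf.2 j a ha)

theorem sum {ι : Type*} (s : Finset ι) {r : ℕ} {k : ℤ} {f : ι → End ℝ A}
    (hf : ∀ i, HasOrderLE 𝒜 r k (f i)) : HasOrderLE 𝒜 r k (∑ i ∈ s, f i) :=
  Finset.sum_induction f (HasOrderLE 𝒜 r k) (fun _ _ => add) (zero r k) fun i _ => hf i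

theorem of_leibniz {k : ℤ} {f : End ℝ A} (hf : ∀ j, ∀ a ∈ 𝒜 j, f a ∈ 𝒜 (j + k))
    (leibniz : ∀ j, ∀ a ∈ 𝒜 j, ∀ b, f (a * b) = f a * b + (-1 : ℝ) ^ (j * k) • (a * f b)) :
    HasOrderLE 𝒜 1 k f := by
  refine ⟨hf, fun j a ha => ⟨(-(-1 : ℝ) ^ (j * k)) • f a, Submodule.smul_mem _ _ (hf j a ha),
    LinearMap.ext fun b => ?_⟩⟩
  simp only [gradedCommutator, LinearMap.sub_apply, LinearMap.smul_apply, Module.End.mul_apply,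
    LinearMap.mulLeft_apply, leibniz j a ha, smul_add, smul_smul, neg_one_zpow_sq, smul_mul_assoc]
  module

variable (hmul : ∀ j k, ∀ a ∈ 𝒜 j, ∀ b ∈ 𝒜 k, a * b ∈ 𝒜 (j + k))
  (hcomm : ∀ j k, ∀ a ∈ 𝒜 j, ∀ b ∈ 𝒜 k, a * b = ((-1 : ℝ) ^ (j * k)) • (b * a))

include hmul in
theorem map_mem {r : ℕ} {k : ℤ} {f : End ℝ A} (hf : HasOrderLE 𝒜 r k f) {j : ℤ} {a : A}
    (ha : a ∈ 𝒜 j) : f a ∈ 𝒜 (j + k) := by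
  cases r with
  | zero =>
    obtain ⟨c, hc, rfl⟩ := hf
    rw [add_comm]
    exact hmul _ _ c hc a ha
  | succ r => exact hf.1 j a ha

include hcomm in
theorem gradedCommutator_mulLeft {j k : ℤ} {a c : A} (ha : a ∈ 𝒜 j) (hc : c ∈ 𝒜 k) :
    gradedCommutator j k (LinearMap.mulLeft ℝ a) (LinearMap.mulLeft ℝ c) = 0 :=
  LinearMap.ext fun x => by
    simp only [gradedCommutator, LinearMap.sub_apply, LinearMap.smul_apply, Module.End.mul_apply,
      LinearMap.mulLeft_apply, ← mul_assoc, hcomm j k a ha c hc, smul_mul_assoc, sub_self,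
      LinearMap.zero_apply]

include hmul hcomm in
theorem mul {r s : ℕ} {p q : ℤ} {f g : End ℝ A} (hf : HasOrderLE 𝒜 r p f)
    (hg : HasOrderLE 𝒜 s q g) : HasOrderLE 𝒜 (r + s) (p + q) (f * g) := by
  induction hn : r + s generalizing r s p q f g with
  | zero =>
    obtain ⟨rfl, rfl⟩ : r = 0 ∧ s = 0 := by omega
    obtain ⟨c, hc, rfl⟩ := hf
    obtain ⟨c', hc', rfl⟩ := hg
    exact ⟨c * c', hmul _ _ c hc c' hc', LinearMap.ext fun x => (mul_assoc c c' x).symm⟩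
  | succ n ih =>
    refine ⟨fun j a ha => ?_, fun j a ha => ?_⟩
    · rw [add_comm p q, ← add_assoc]
      exact hf.map_mem hmul (hg.map_mem hmul ha)
    · rw [gradedCommutator_mul]
      refine add ?_ (smul ?_ _)
      · cases r with
        | zero =>
          obtain ⟨c, hc, rfl⟩ := hf
          rw [gradedCommutator_mulLeft hcomm ha hc, zero_mul]
          exact zero _ _
        | succ r =>
          rw [← add_assoc]
          exact ih (hf.2 j a ha) hg (by omega)
      · cases s with
        | zero =>
          obtain ⟨c, hc, rfl⟩ := hg
          rw [gradedCommutator_mulLeft hcomm ha hc, mul_zero]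
          exact zero _ _
        | succ s =>
          rw [add_left_comm]
          exact ih hf (hg.2 j a ha) (by omega)

theorem commutator {r s : ℕ} {p q : ℤ} {f g : End ℝ A}
    (hf : HasOrderLE 𝒜 (r + 1) p f) (hg : HasOrderLE 𝒜 (s + 1) q g) :
    HasOrderLE 𝒜 (r + s + 1) (p + q) (_root_.gradedCommutator p q f g) := by
  induction hn : r + s using Nat.strong_induction_on generalizing r s p q f g with
  | _ n ih =>
  refine ⟨fun j a ha => ?_, fun j a ha => ?_⟩
  · refine sub_mem ?_ (Submodule.smul_mem _ _ ?_)
    · rw [add_comm p q, ← add_assoc]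
      exact hf.1 _ _ (hg.1 _ _ ha)
    · rw [← add_assoc]
      exact hg.1 _ _ (hf.1 _ _ ha)
  · rw [gradedCommutator_jacobi]
    refine add ?_ (smul ?_ _)
    · rw [← add_assoc]
      have hfa := hf.2 j a ha
      cases r with
      | zero =>
        obtain ⟨c, hc, hfa_eq⟩ := hfa
        rw [hfa_eq, ← hn, zero_add]
        exact hg.2 _ c hc
      | succ r =>
        obtain rfl : r + s + 1 = n := by omega
        exact ih (r + s) (by omega) hfa hg rfl
    · rw [add_left_comm]
      have hga := hg.2 j a ha
      cases s with
      | zero =>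
        obtain ⟨c, hc, hga_eq⟩ := hga
        rw [hga_eq, gradedCommutator_swap, ← hn, add_zero, add_comm p]
        exact smul (hf.2 _ c hc) _
      | succ s =>
        obtain rfl : r + s + 1 = n := by omega
        exact ih (r + s) (by omega) hf hga rfl

end HasOrderLE

end Order

/-! ### Conjugating a square-zero operator by an exponential -/

section ExpConj

open Finset.HasAntidiagonal (antidiagonal mem_antidiagonal)

variable (𝕜 : Type*) {R : Type*} [Field 𝕜] [Ring R] [Algebra 𝕜 R]

/-- The coefficient of `tⁿ` in the formal power series `exp(tΛ) D exp(-tΛ)`, that is,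
`(ad Λ)ⁿ(D) / n!`. -/
def expConjCoeff (Λ D : R) : ℕ → R
  | 0 => D
  | n + 1 => (n + 1 : 𝕜)⁻¹ • ⁅Λ, expConjCoeff Λ D n⁆

theorem expConjCoeff_eq_zero_of_le {Λ D : R} {m n : ℕ} (hmn : m ≤ n)
    (hm : expConjCoeff 𝕜 Λ D m = 0) : expConjCoeff 𝕜 Λ D n = 0 := by
  induction n, hmn using Nat.le_induction with
  | base => exact hm
  | succ n _ ih => rw [expConjCoeff, ih, Ring.lie_def, mul_zero, zero_mul, sub_zero, smul_zero]

theorem expConjCoeff_zero_right (Λ : R) (n : ℕ) : expConjCoeff 𝕜 Λ 0 n = 0 :=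
  expConjCoeff_eq_zero_of_le 𝕜 n.zero_le rfl

variable [CharZero 𝕜]

theorem lie_expConjCoeff (Λ D : R) (n : ℕ) :
    ⁅Λ, expConjCoeff 𝕜 Λ D n⁆ = (n + 1 : 𝕜) • expConjCoeff 𝕜 Λ D (n + 1) := by
  rw [expConjCoeff, smul_inv_smul₀ n.cast_add_one_ne_zero]

/-- Conjugation by `exp(tΛ)` is multiplicative. -/
theorem expConjCoeff_mul (Λ D D' : R) (n : ℕ) :
    expConjCoeff 𝕜 Λ (D * D') n = ∑ p ∈ antidiagonal n,
      expConjCoeff 𝕜 Λ D p.1 * expConjCoeff 𝕜 Λ D' p.2 := by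
  induction n with
  | zero => simp [expConjCoeff]
  | succ n ih =>
    have lie_mul (X Y : R) : ⁅Λ, X * Y⁆ = ⁅Λ, X⁆ * Y + X * ⁅Λ, Y⁆ := by
      simp only [Ring.lie_def]
      noncomm_ring
    have sum_fst : ∑ p ∈ antidiagonal n,
          ⁅Λ, expConjCoeff 𝕜 Λ D p.1⁆ * expConjCoeff 𝕜 Λ D' p.2 =
        ∑ p ∈ antidiagonal (n + 1),
          (p.1 : 𝕜) • (expConjCoeff 𝕜 Λ D p.1 * expConjCoeff 𝕜 Λ D' p.2) := by
      simp [Finset.Nat.sum_antidiagonal_succ, lie_expConjCoeff]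
    have sum_snd : ∑ p ∈ antidiagonal n,
          expConjCoeff 𝕜 Λ D p.1 * ⁅Λ, expConjCoeff 𝕜 Λ D' p.2⁆ =
        ∑ p ∈ antidiagonal (n + 1),
          (p.2 : 𝕜) • (expConjCoeff 𝕜 Λ D p.1 * expConjCoeff 𝕜 Λ D' p.2) := by
      simp [Finset.Nat.sum_antidiagonal_succ', lie_expConjCoeff]
    have lie_sum (s : Finset (ℕ × ℕ)) (f : ℕ × ℕ → R) : ⁅Λ, ∑ p ∈ s, f p⁆ = ∑ p ∈ s, ⁅Λ, f p⁆ := by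
      simp only [Ring.lie_def, Finset.mul_sum, Finset.sum_mul, Finset.sum_sub_distrib]
    rw [expConjCoeff, ih, lie_sum, inv_smul_eq_iff₀ n.cast_add_one_ne_zero, Finset.smul_sum]
    simp only [lie_mul, Finset.sum_add_distrib]
    rw [sum_fst, sum_snd, ← Finset.sum_add_distrib]
    refine Finset.sum_congr rfl fun p hp => ?_
    rw [← add_smul, ← Nat.cast_add, mem_antidiagonal.mp hp, Nat.cast_succ]

theorem sum_expConjCoeff_mul_expConjCoeff {Λ D : R} (hD : D * D = 0) (n : ℕ) :
    ∑ i ∈ Finset.range (n + 1), expConjCoeff 𝕜 Λ D i * expConjCoeff 𝕜 Λ D (n - i) = 0 := by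
  rw [← Finset.Nat.sum_antidiagonal_eq_sum_range_succ
    fun i j => expConjCoeff 𝕜 Λ D i * expConjCoeff 𝕜 Λ D j, ← expConjCoeff_mul, hD,
    expConjCoeff_zero_right]

end ExpConj

theorem HasOrderLE.expConjCoeff {A : Type*} [Ring A] [Algebra ℝ A] {𝒜 : ℤ → Submodule ℝ A}
    {D Λ : End ℝ A} (hD : HasOrderLE 𝒜 1 1 D) (hΛ : HasOrderLE 𝒜 2 (-2) Λ) (n : ℕ) :
    HasOrderLE 𝒜 (n + 1) (1 - 2 * n) (expConjCoeff ℝ Λ D n) := by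
  induction n with
  | zero => exact hD
  | succ n ih =>
    have order_lie := hΛ.commutator ih
    rw [gradedCommutator, Even.neg_one_zpow ((even_two.neg).mul_right _), one_smul,
      ← Ring.lie_def, add_comm 1 n] at order_lie
    convert order_lie.smul (n + 1 : ℝ)⁻¹ using 1
    · push_cast
      ring
    · rfl

/-! ### Two-forms on a vector space -/

namespace FormFibre

variable {E : Type*} [NormedAddCommGroup E] [NormedSpace ℝ E]

theorem parity_eq_involute (β : FormFibre E) : parity β = involute β := by
  suffices h : parity = (involute : FormFibre E →ₐ[ℝ] FormFibre E) from DFunLike.congr_fun h β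
  refine ExteriorAlgebra.hom_ext (LinearMap.ext fun a => ?_)
  simp [parity]

@[simp] theorem parity_ι (a : Dual ℝ E) : parity (ι ℝ a) = -ι ℝ a := by
  rw [parity_eq_involute, CliffordAlgebra.involute_ι]

@[simp] theorem parity_parity (β : FormFibre E) : parity (parity β) = β := by
  rw [parity_eq_involute, parity_eq_involute, CliffordAlgebra.involute_involute]

theorem parity_of_mem {k : ℕ} {β : FormFibre E} (hβ : β ∈ ⋀[ℝ]^k (Dual ℝ E)) :
    parity β = (-1 : ℝ) ^ k • β := by
  rw [parity_eq_involute, involute_of_mem_exteriorPower hβ]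

theorem parity_of_mem_two {τ : FormFibre E} (hτ : τ ∈ ⋀[ℝ]^2 (Dual ℝ E)) : parity τ = τ := by
  rw [parity_of_mem hτ, neg_one_sq, one_smul]

theorem ι_mul_eq_parity_mul_ι (a : Dual ℝ E) (β : FormFibre E) :
    ι ℝ a * β = parity β * ι ℝ a := by
  rw [parity_eq_involute, ι_mul_eq_involute_mul_ι]

variable [FiniteDimensional ℝ E]

/-- Exterior multiplication by a covector, linear in the covector. -/
def wedge : Dual ℝ E →ₗ[ℝ] End ℝ (FormFibre E) := LinearMap.mul ℝ (FormFibre E) ∘ₗ ι ℝ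

theorem wedge_apply (a : Dual ℝ E) (β : FormFibre E) : wedge a β = ι ℝ a * β := rfl

/-- The interior product, linear in the vector. -/
def interiorHom : E →ₗ[ℝ] End ℝ (FormFibre E) := contractLeft ∘ₗ Dual.eval ℝ E

theorem interiorHom_apply (v : E) : interiorHom v = interior v := rfl

theorem interior_add (v w : E) : interior (v + w) = interior v + interior w :=
  map_add interiorHom v w

theorem interior_sub (v w : E) : interior (v - w) = interior v - interior w :=
  map_sub interiorHom v w

theorem interior_neg (v : E) : interior (-v) = -interior v := map_neg interiorHom v

theorem interior_smul (r : ℝ) (v : E) : interior (r • v) = r • interior v :=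
  map_smul interiorHom r v

theorem interior_sum {κ : Type*} (s : Finset κ) (v : κ → E) :
    interior (∑ i ∈ s, v i) = ∑ i ∈ s, interior (v i) :=
  map_sum interiorHom v s

@[simp] theorem interior_algebraMap (v : E) (r : ℝ) :
    interior v (algebraMap ℝ (FormFibre E) r) = 0 :=
  CliffordAlgebra.contractLeft_algebraMap _ _ _

@[simp] theorem interior_ι (v : E) (a : Dual ℝ E) :
    interior v (ι ℝ a) = algebraMap ℝ (FormFibre E) (a v) :=
  CliffordAlgebra.contractLeft_ι _ _ _

theorem interior_ι_mul (v : E) (a : Dual ℝ E) (β : FormFibre E) :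
    interior v (ι ℝ a * β) = a v • β - ι ℝ a * interior v β :=
  contractLeft_ι_mul _ _ _

theorem interior_comm (v w : E) (β : FormFibre E) :
    interior v (interior w β) = -interior w (interior v β) :=
  CliffordAlgebra.contractLeft_comm _ _ _

theorem interior_mem (v : E) {k : ℕ} {β : FormFibre E} (hβ : β ∈ ⋀[ℝ]^(k + 1) (Dual ℝ E)) :
    interior v β ∈ ⋀[ℝ]^k (Dual ℝ E) :=
  contractLeft_mem_exteriorPower _ hβ

theorem interior_parity (v : E) (β : FormFibre E) :
    interior v (parity β) = -parity (interior v β) := by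
  rw [parity_eq_involute, parity_eq_involute]
  exact contractLeft_involute _ β

theorem interior_mul (v : E) (α β : FormFibre E) :
    interior v (α * β) = interior v α * β + parity α * interior v β := by
  rw [parity_eq_involute]
  exact contractLeft_mul _ α β

theorem flat_apply (τ : FormFibre E) (v : E) : flat τ v = ExteriorAlgebra.ιInv (interior v τ) := rfl

theorem flat_add (τ τ' : FormFibre E) : flat (τ + τ') = flat τ + flat τ' := by
  ext1 v
  simp [flat_apply]

theorem flat_ι_mul_ι (a b : Dual ℝ E) (v : E) :
    flat (ι ℝ a * ι ℝ b) v = a v • b - b v • a := by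
  rw [flat_apply, interior_ι_mul, interior_ι, ← Algebra.commutes, ← Algebra.smul_def, map_sub,
    map_smul, map_smul, ExteriorAlgebra.ι_leftInverse, ExteriorAlgebra.ι_leftInverse]

theorem ι_flat {τ : FormFibre E} (hτ : τ ∈ ⋀[ℝ]^2 (Dual ℝ E)) (v : E) :
    ι ℝ (flat τ v) = interior v τ := by
  obtain ⟨a, ha⟩ := mem_exteriorPower_one.mp (interior_mem v hτ)
  rw [flat_apply, ← ha, ExteriorAlgebra.ι_leftInverse]

theorem flat_antisymm {τ : FormFibre E} (hτ : τ ∈ ⋀[ℝ]^2 (Dual ℝ E)) (v w : E) :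
    flat τ v w = -flat τ w v := by
  have interior_swap := interior_comm w v τ
  rw [← ι_flat hτ, ← ι_flat hτ, interior_ι, interior_ι, ← map_neg] at interior_swap
  exact (ExteriorAlgebra.algebraMap_leftInverse _).injective interior_swap

theorem interior_two_mul {τ : FormFibre E} (hτ : τ ∈ ⋀[ℝ]^2 (Dual ℝ E)) (v : E)
    (β : FormFibre E) : interior v (τ * β) = ι ℝ (flat τ v) * β + τ * interior v β := by
  rw [interior_mul, parity_of_mem_two hτ, ι_flat hτ]

theorem eq_zero_of_mem_of_finrank_lt {k : ℕ} (hk : finrank ℝ E < k) {β : FormFibre E}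
    (hβ : β ∈ ⋀[ℝ]^k (Dual ℝ E)) : β = 0 :=
  eq_zero_of_mem_exteriorPower_of_finrank_lt (Subspace.dual_finrank_eq.trans_lt hk) hβ

theorem sum_apply_smul_coord (a : Dual ℝ E) :
    ∑ i, a (finBasis ℝ E i) • (finBasis ℝ E).coord i = a :=
  (finBasis ℝ E).ext fun j => by simp

theorem sum_coord_smul (v : E) :
    ∑ i, (finBasis ℝ E).coord i v • finBasis ℝ E i = v :=
  (finBasis ℝ E).sum_repr v

theorem sum_ι_mul_interior {k : ℕ} {β : FormFibre E} (hβ : β ∈ ⋀[ℝ]^k (Dual ℝ E)) :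
    ∑ i, ι ℝ ((finBasis ℝ E).coord i) * interior (finBasis ℝ E i) β = (k : ℝ) • β :=
  sum_ι_mul_contractLeft (f := fun i => Dual.eval ℝ E (finBasis ℝ E i)) sum_apply_smul_coord hβ

theorem sum_interior_ι_mul {k : ℕ} {β : FormFibre E} (hβ : β ∈ ⋀[ℝ]^k (Dual ℝ E)) :
    ∑ i, interior (finBasis ℝ E i) (ι ℝ ((finBasis ℝ E).coord i) * β) =
      ((finrank ℝ E : ℝ) - k) • β := by
  have trace_eq : ∑ i, Dual.eval ℝ E (finBasis ℝ E i) ((finBasis ℝ E).coord i) = finrank ℝ E :=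
    by simp
  rw [← trace_eq]
  exact sum_contractLeft_ι_mul (f := fun i => Dual.eval ℝ E (finBasis ℝ E i))
    sum_apply_smul_coord hβ

theorem eq_of_flat_eq {τ τ' : FormFibre E} (hτ : τ ∈ ⋀[ℝ]^2 (Dual ℝ E))
    (hτ' : τ' ∈ ⋀[ℝ]^2 (Dual ℝ E)) (h : flat τ = flat τ') : τ = τ' := by
  refine sub_eq_zero.mp (eq_zero_of_forall_contractLeft_eq_zero (k := 1) (sub_mem hτ hτ') ?_)
  refine (Module.evalEquiv ℝ E).surjective.forall.mpr fun v => ?_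
  change interior v (τ - τ') = 0
  rw [map_sub, ← ι_flat hτ, ← ι_flat hτ', h, sub_self]

/-! ### Adjoints and star operators -/

section Adjoint

variable {c : Dual ℝ E →ₗ[ℝ] Dual ℝ (Dual ℝ E)}

theorem pairing_eq (α β : FormFibre E) : pairing c α β = exteriorPairing c α β := by
  rw [pairing, ← Subspace.dual_finrank_eq (K := ℝ) (V := E)]
  simp only [pairingDual_map_eq_exteriorPairing, exteriorPairing_decompose_left c α
    (SetLike.coe_mem _), ← map_sum, sum_decompose_exteriorPower]

theorem eq_of_forall_pairing_eq (hc : Function.Surjective c) {β β' : FormFibre E}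
    (h : ∀ α, exteriorPairing c α β = exteriorPairing c α β') : β = β' :=
  sub_eq_zero.mp <| eq_zero_of_forall_exteriorPairing_eq_zero hc fun α => by
    rw [map_sub, h, sub_self]

theorem pairing_adjoint (hc : Function.Surjective c) (φ : End ℝ (FormFibre E))
    (α β : FormFibre E) :
    exteriorPairing c (φ α) β = exteriorPairing c α (adjoint c φ β) := by
  let pairingForm : LinearMap.BilinForm ℝ (FormFibre E) := exteriorPairing c
  have nondegenerate : pairingForm.flip.Nondegenerate :=
    LinearMap.BilinForm.Nondegenerate.ofSeparatingLeft fun _ h =>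
      eq_zero_of_forall_exteriorPairing_eq_zero hc h
  have exists_adjoint : ∃ ψ : End ℝ (FormFibre E), ∀ α β, pairing c (φ α) β = pairing c α (ψ β) :=
    ⟨pairingForm.flip.leftAdjointOfNondegenerate nondegenerate φ, fun α β => by
      rw [pairing_eq, pairing_eq]
      exact (pairingForm.flip.isAdjointPairLeftAdjointOfNondegenerate nondegenerate φ β α).symm⟩
  have spec := Classical.epsilon_spec exists_adjoint α β
  rwa [pairing_eq, pairing_eq] at spec

theorem adjoint_eq (hc : Function.Surjective c) {φ ψ : End ℝ (FormFibre E)}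
    (h : ∀ α β, exteriorPairing c (φ α) β = exteriorPairing c α (ψ β)) : adjoint c φ = ψ :=
  LinearMap.ext fun β => eq_of_forall_pairing_eq hc fun α => by rw [← pairing_adjoint hc, h]

theorem adjoint_mul (hc : Function.Surjective c) (φ ψ : End ℝ (FormFibre E)) :
    adjoint c (φ * ψ) = adjoint c ψ * adjoint c φ :=
  adjoint_eq hc fun α β => by
    rw [Module.End.mul_apply, Module.End.mul_apply, pairing_adjoint hc, pairing_adjoint hc]

theorem adjoint_add (hc : Function.Surjective c) (φ ψ : End ℝ (FormFibre E)) :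
    adjoint c (φ + ψ) = adjoint c φ + adjoint c ψ :=
  adjoint_eq hc fun α β => by
    simp only [LinearMap.add_apply, map_add, pairing_adjoint hc]

theorem adjoint_sub (hc : Function.Surjective c) (φ ψ : End ℝ (FormFibre E)) :
    adjoint c (φ - ψ) = adjoint c φ - adjoint c ψ :=
  adjoint_eq hc fun α β => by
    simp only [LinearMap.sub_apply, map_sub, pairing_adjoint hc]

theorem adjoint_zero (hc : Function.Surjective c) : adjoint c 0 = 0 :=
  adjoint_eq hc fun α β => by simp

theorem adjoint_sum (hc : Function.Surjective c) {κ : Type*} (s : Finset κ)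
    (φ : κ → End ℝ (FormFibre E)) : adjoint c (∑ i ∈ s, φ i) = ∑ i ∈ s, adjoint c (φ i) :=
  adjoint_eq hc fun α β => by
    simp only [LinearMap.sum_apply, map_sum, pairing_adjoint hc]

end Adjoint

end FormFibre

/-! ### Contraction with a bivector -/

namespace FormFibre

variable {E : Type*} [NormedAddCommGroup E] [NormedSpace ℝ E] [FiniteDimensional ℝ E]

theorem sum_apply_antisymm {Q : Dual ℝ E →ₗ[ℝ] E} (hQ : ∀ a b : Dual ℝ E, a (Q b) = -b (Q a))
    (a : Dual ℝ E) : ∑ i, a (Q ((finBasis ℝ E).coord i)) • finBasis ℝ E i = -Q a := by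
  simp_rw [hQ a, neg_smul]
  rw [Finset.sum_neg_distrib, sum_coord_smul]

theorem sum_antisymm_swap {N : Type*} [AddCommGroup N] [Module ℝ N] {Q : Dual ℝ E →ₗ[ℝ] E}
    (hQ : ∀ a b : Dual ℝ E, a (Q b) = -b (Q a)) (B : E →ₗ[ℝ] E →ₗ[ℝ] N) :
    ∑ i, B (finBasis ℝ E i) (Q ((finBasis ℝ E).coord i)) =
      -∑ i, B (Q ((finBasis ℝ E).coord i)) (finBasis ℝ E i) := by
  let e := finBasis ℝ E
  have expand_left : ∀ v w, B v w = ∑ i, e.coord i v • B (e i) w := fun v w => by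
    conv_lhs => rw [← sum_coord_smul v, map_sum, LinearMap.sum_apply]
    simp only [map_smul, LinearMap.smul_apply, e]
  calc ∑ i, B (e i) (Q (e.coord i))
      = ∑ i, ∑ j, e.coord j (Q (e.coord i)) • B (e i) (e j) := by
        simp only [← map_smul, ← map_sum, e, sum_coord_smul]
    _ = ∑ j, ∑ i, e.coord j (Q (e.coord i)) • B (e i) (e j) := Finset.sum_comm
    _ = -∑ j, ∑ i, e.coord i (Q (e.coord j)) • B (e i) (e j) := by
        simp only [← Finset.sum_neg_distrib, ← neg_smul, ← hQ]
    _ = -∑ j, B (Q (e.coord j)) (e j) := by simp only [← expand_left]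

/-- Contraction `½ ∑ᵢ i(eᵢ) i(Q eⁱ)` with a bivector, which is encoded by the map `Q` from
covectors to vectors that it induces. -/
def contractBivector (Q : Dual ℝ E →ₗ[ℝ] E) : End ℝ (FormFibre E) :=
  (1 / 2 : ℝ) • ∑ i, interior (finBasis ℝ E i) * interior (Q ((finBasis ℝ E).coord i))

theorem contractBivector_apply (Q : Dual ℝ E →ₗ[ℝ] E) (β : FormFibre E) :
    contractBivector Q β = (1 / 2 : ℝ) •
      ∑ i, interior (finBasis ℝ E i) (interior (Q ((finBasis ℝ E).coord i)) β) := by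
  simp only [contractBivector, LinearMap.smul_apply, LinearMap.sum_apply, Module.End.mul_apply]

theorem contractBivector_add (Q Q' : Dual ℝ E →ₗ[ℝ] E) :
    contractBivector (Q + Q') = contractBivector Q + contractBivector Q' := by
  simp only [contractBivector, LinearMap.add_apply, interior_add, mul_add,
    Finset.sum_add_distrib, smul_add]

@[simp] theorem contractBivector_algebraMap (Q : Dual ℝ E →ₗ[ℝ] E) (r : ℝ) :
    contractBivector Q (algebraMap ℝ _ r) = 0 := by
  simp [contractBivector_apply]

@[simp] theorem contractBivector_one (Q : Dual ℝ E →ₗ[ℝ] E) : contractBivector Q 1 = 0 := by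
  simpa using contractBivector_algebraMap Q 1

theorem interior_contractBivector (Q : Dual ℝ E →ₗ[ℝ] E) (v : E) (β : FormFibre E) :
    interior v (contractBivector Q β) = contractBivector Q (interior v β) := by
  simp only [contractBivector_apply, map_smul, map_sum, interior_comm v, map_neg, neg_neg]

theorem contractBivector_comm (Q Q' : Dual ℝ E →ₗ[ℝ] E) (β : FormFibre E) :
    contractBivector Q (contractBivector Q' β) = contractBivector Q' (contractBivector Q β) := by
  rw [contractBivector_apply, contractBivector_apply Q β, map_smul, map_sum]
  simp only [interior_contractBivector]

theorem contractBivector_parity (Q : Dual ℝ E →ₗ[ℝ] E) (β : FormFibre E) :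
    contractBivector Q (parity β) = parity (contractBivector Q β) := by
  simp only [contractBivector_apply, interior_parity, map_neg, neg_neg, map_smul, map_sum]

theorem contractBivector_ι_mul {Q : Dual ℝ E →ₗ[ℝ] E}
    (hQ : ∀ a b : Dual ℝ E, a (Q b) = -b (Q a)) (a : Dual ℝ E) (β : FormFibre E) :
    contractBivector Q (ι ℝ a * β) = ι ℝ a * contractBivector Q β - interior (Q a) β := by
  have summand_eq : ∀ i, interior (finBasis ℝ E i)
      (interior (Q ((finBasis ℝ E).coord i)) (ι ℝ a * β)) =
        interior (a (Q ((finBasis ℝ E).coord i)) • finBasis ℝ E i) β -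
          interior (Q (a (finBasis ℝ E i) • (finBasis ℝ E).coord i)) β +
        ι ℝ a * interior (finBasis ℝ E i) (interior (Q ((finBasis ℝ E).coord i)) β) := fun i => by
    rw [interior_ι_mul, map_sub, map_smul, interior_ι_mul, map_smul, interior_smul, interior_smul,
      LinearMap.smul_apply, LinearMap.smul_apply]
    abel
  simp only [contractBivector_apply, summand_eq, Finset.sum_add_distrib, Finset.sum_sub_distrib,
    ← LinearMap.sum_apply, ← interior_sum, ← map_sum, sum_apply_antisymm hQ,
    sum_apply_smul_coord, interior_neg, LinearMap.neg_apply, mul_smul_comm, Finset.mul_sum]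
  module

/-- The operator `½ ∑ᵢ [i(eᵢ), R eⁱ ∧ ·]`: up to the constant `½ tr R` it is minus the derivation
extending the endomorphism `R` of the covectors. -/
def weight (R : End ℝ (Dual ℝ E)) : End ℝ (FormFibre E) :=
  (1 / 2 : ℝ) • ∑ i, (interior (finBasis ℝ E i) * wedge (R ((finBasis ℝ E).coord i)) -
    wedge (R ((finBasis ℝ E).coord i)) * interior (finBasis ℝ E i))

theorem weight_apply (R : End ℝ (Dual ℝ E)) (β : FormFibre E) :
    weight R β = (1 / 2 : ℝ) •
      (∑ i, interior (finBasis ℝ E i) (ι ℝ (R ((finBasis ℝ E).coord i)) * β) -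
        ∑ i, ι ℝ (R ((finBasis ℝ E).coord i)) * interior (finBasis ℝ E i) β) := by
  simp only [weight, LinearMap.smul_apply, LinearMap.sum_apply, LinearMap.sub_apply,
    Module.End.mul_apply, wedge_apply, Finset.sum_sub_distrib]

theorem weight_one_of_mem {k : ℕ} {β : FormFibre E} (hβ : β ∈ ⋀[ℝ]^k (Dual ℝ E)) :
    weight 1 β = ((finrank ℝ E : ℝ) / 2 - k) • β := by
  simp only [weight_apply, Module.End.one_apply, sum_interior_ι_mul hβ, sum_ι_mul_interior hβ]
  module

theorem weight_parity (R : End ℝ (Dual ℝ E)) (β : FormFibre E) :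
    weight R (parity β) = parity (weight R β) := by
  have ι_mul_parity : ∀ (a : Dual ℝ E) (γ : FormFibre E),
      ι ℝ a * parity γ = -parity (ι ℝ a * γ) := fun a γ => by
    rw [map_mul, parity_ι, neg_mul, neg_neg]
  simp only [weight_apply, interior_parity, ι_mul_parity, map_smul, map_sum, map_sub, map_neg,
    neg_neg, mul_neg]

theorem contractBivector_two_mul {Q : Dual ℝ E →ₗ[ℝ] E}
    (hQ : ∀ a b : Dual ℝ E, a (Q b) = -b (Q a)) {τ : FormFibre E}
    (hτ : τ ∈ ⋀[ℝ]^2 (Dual ℝ E)) (β : FormFibre E) :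
    contractBivector Q (τ * β) = τ * contractBivector Q β + weight (flat τ ∘ₗ Q) β := by
  have swap : ∑ i, ι ℝ (flat τ (finBasis ℝ E i)) * interior (Q ((finBasis ℝ E).coord i)) β =
      -∑ i, ι ℝ (flat τ (Q ((finBasis ℝ E).coord i))) * interior (finBasis ℝ E i) β :=
    sum_antisymm_swap hQ
      ((LinearMap.mul ℝ (FormFibre E)).compl₁₂ (ι ℝ ∘ₗ flat τ) (interiorHom.flip β))
  simp only [contractBivector_apply, interior_two_mul hτ, map_add, Finset.sum_add_distrib, swap,
    weight_apply, LinearMap.comp_apply, mul_smul_comm, Finset.mul_sum]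
  module

end FormFibre

/-! ### Nondegenerate two-forms -/

namespace FormFibre

variable {E : Type*} [NormedAddCommGroup E] [NormedSpace ℝ E]

/-- The bilinear form `(a, b) ↦ b (P a)` on covectors. For `P` inverse to a map `F` from vectors to
covectors it is `inverseForm F`. -/
def dualForm (P : Dual ℝ E →ₗ[ℝ] E) : Dual ℝ E →ₗ[ℝ] Dual ℝ (Dual ℝ E) := Dual.eval ℝ E ∘ₗ P

theorem dualForm_apply (P : Dual ℝ E →ₗ[ℝ] E) (a b : Dual ℝ E) : dualForm P a b = b (P a) := rfl

variable [FiniteDimensional ℝ E]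

theorem adjoint_wedge {P : Dual ℝ E →ₗ[ℝ] E} (hP : Function.Surjective (dualForm P))
    (a : Dual ℝ E) : adjoint (dualForm P) (wedge a) = interior (P a) :=
  adjoint_eq hP fun α β => exteriorPairing_ι_mul _ a α β

/-- Contraction with the bivector obtained from the `2`-form `τ` by raising both indices with `P`.
It is the adjoint of `τ ∧ ·`, see `IsSharp.adjoint_mulLeft`. -/
def dualLefschetz (P : Dual ℝ E →ₗ[ℝ] E) (τ : FormFibre E) : End ℝ (FormFibre E) :=
  contractBivector (P ∘ₗ flat τ ∘ₗ P)

theorem dualLefschetz_add (P : Dual ℝ E →ₗ[ℝ] E) (τ τ' : FormFibre E) :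
    dualLefschetz P (τ + τ') = dualLefschetz P τ + dualLefschetz P τ' := by
  rw [dualLefschetz, flat_add, LinearMap.add_comp, LinearMap.comp_add, contractBivector_add]
  rfl

/-- The Liouville volume form `σⁿ / n!`, where `n = ⌊dim E / 2⌋`. -/
def liouvilleVolume (σ : FormFibre E) : FormFibre E :=
  (Nat.factorial (finrank ℝ E / 2) : ℝ)⁻¹ • σ ^ (finrank ℝ E / 2)

/-- The star operator of a symplectic form `σ` with inverse `P`, given explicitly by
`a₁ ∧ … ∧ aₖ ↦ (-1)ᵏ i(P aₖ) ⋯ i(P a₁) (σⁿ / n!)`. -/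
def symplecticStar (P : Dual ℝ E →ₗ[ℝ] E) (σ : FormFibre E) : End ℝ (FormFibre E) where
  toFun β := (iteratedContraction (-dualForm P) β).unop (liouvilleVolume σ)
  map_add' := by simp
  map_smul' := by simp

theorem symplecticStar_algebraMap (P : Dual ℝ E →ₗ[ℝ] E) (σ : FormFibre E) (r : ℝ) :
    symplecticStar P σ (algebraMap ℝ _ r) = r • liouvilleVolume σ := by
  simp [symplecticStar, Algebra.algebraMap_eq_smul_one]

theorem symplecticStar_mul_ι (P : Dual ℝ E →ₗ[ℝ] E) (σ β : FormFibre E) (b : Dual ℝ E) :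
    symplecticStar P σ (β * ι ℝ b) = -interior (P b) (symplecticStar P σ β) := by
  change (iteratedContraction (-dualForm P) (β * ι ℝ b)).unop (liouvilleVolume σ) = _
  rw [map_mul, MulOpposite.unop_mul, Module.End.mul_apply, iteratedContraction_ι,
    LinearMap.neg_apply, map_neg]
  rfl

theorem symplecticStar_ι_mul (P : Dual ℝ E →ₗ[ℝ] E) (σ β : FormFibre E) (b : Dual ℝ E) :
    symplecticStar P σ (ι ℝ b * β) = -interior (P b) (symplecticStar P σ (parity β)) := by
  rw [ι_mul_eq_parity_mul_ι, symplecticStar_mul_ι]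

/-- `P` is inverse to the map `v ↦ σ(v, ·)` of the nondegenerate `2`-form `σ`. -/
structure IsSharp (σ : FormFibre E) (P : Dual ℝ E →ₗ[ℝ] E) : Prop where
  mem : σ ∈ ⋀[ℝ]^2 (Dual ℝ E)
  sharp_flat : ∀ v, P (flat σ v) = v
  flat_sharp : ∀ a, flat σ (P a) = a

namespace IsSharp

variable {σ : FormFibre E} {P : Dual ℝ E →ₗ[ℝ] E} (h : IsSharp σ P)
include h

theorem antisymm (a b : Dual ℝ E) : a (P b) = -b (P a) := by
  conv_lhs => rw [← h.flat_sharp a, flat_antisymm h.mem, h.flat_sharp]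

theorem antisymm_comp {τ : FormFibre E} (hτ : τ ∈ ⋀[ℝ]^2 (Dual ℝ E)) (a b : Dual ℝ E) :
    a ((P ∘ₗ flat τ ∘ₗ P) b) = -b ((P ∘ₗ flat τ ∘ₗ P) a) := by
  simp only [LinearMap.comp_apply]
  rw [h.antisymm, flat_antisymm hτ, neg_neg, h.antisymm]

theorem flat_comp_sharp : flat σ ∘ₗ P = 1 := LinearMap.ext h.flat_sharp

theorem surjective_dualForm : Function.Surjective (dualForm P) :=
  (Module.evalEquiv ℝ E).surjective.comp fun v => ⟨_, h.sharp_flat v⟩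

/-! ### The Liouville volume form -/

theorem pow_mem (r : ℕ) : σ ^ r ∈ ⋀[ℝ]^(2 * r) (Dual ℝ E) := by
  have graded := SetLike.pow_mem_graded (A := fun i : ℕ => ⋀[ℝ]^i (Dual ℝ E)) r h.mem
  rwa [smul_eq_mul, mul_comm] at graded

theorem contractBivector_pow (r : ℕ) : contractBivector P (σ ^ (r + 1)) =
    (((r : ℝ) + 1) * ((finrank ℝ E : ℝ) / 2 - r)) • σ ^ r := by
  induction r with
  | zero =>
    rw [pow_succ', contractBivector_two_mul h.antisymm h.mem, h.flat_comp_sharp,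
      weight_one_of_mem (h.pow_mem 0)]
    simp
  | succ r ih =>
    rw [pow_succ', contractBivector_two_mul h.antisymm h.mem, h.flat_comp_sharp,
      weight_one_of_mem (h.pow_mem _), ih, mul_smul_comm, ← pow_succ', ← add_smul]
    congr 1
    push_cast
    ring

theorem even_finrank : Even (finrank ℝ E) := by
  by_contra not_even
  -- in odd dimension the factor in `contractBivector_pow` never vanishes
  have pow_ne_zero : ∀ r : ℕ, σ ^ r ≠ 0 := by
    intro r
    induction r with
    | zero => simp
    | succ r ih =>
      intro pow_eq_zero
      have factor_smul := h.contractBivector_pow r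
      rw [pow_eq_zero, map_zero, eq_comm, smul_eq_zero] at factor_smul
      have finrank_eq : (finrank ℝ E : ℝ) = (r + r : ℕ) := by
        have := (mul_eq_zero.mp (factor_smul.resolve_right ih)).resolve_left (by positivity)
        push_cast
        linarith
      exact not_even ⟨r, mod_cast finrank_eq⟩
  exact pow_ne_zero _ (eq_zero_of_mem_of_finrank_lt (by omega) (h.pow_mem (finrank ℝ E + 1)))

theorem two_mul_finrank_half : 2 * (finrank ℝ E / 2) = finrank ℝ E :=
  Nat.two_mul_div_two_of_even h.even_finrank

theorem cast_finrank_half : ((finrank ℝ E / 2 : ℕ) : ℝ) = (finrank ℝ E : ℝ) / 2 :=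
  Nat.cast_div_charZero h.even_finrank.two_dvd

theorem liouvilleVolume_mem : liouvilleVolume σ ∈ ⋀[ℝ]^(finrank ℝ E) (Dual ℝ E) := by
  have pow_mem := h.pow_mem (finrank ℝ E / 2)
  rw [h.two_mul_finrank_half] at pow_mem
  exact Submodule.smul_mem _ _ pow_mem

theorem parity_liouvilleVolume : parity (liouvilleVolume σ) = liouvilleVolume σ := by
  rw [parity_of_mem h.liouvilleVolume_mem, h.even_finrank.neg_one_pow, one_smul]

theorem mul_liouvilleVolume {k : ℕ} {x : FormFibre E} (hx : x ∈ ⋀[ℝ]^(k + 1) (Dual ℝ E)) :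
    x * liouvilleVolume σ = 0 :=
  eq_zero_of_mem_of_finrank_lt (k := k + 1 + finrank ℝ E) (by omega)
    (mul_mem_exteriorPower hx h.liouvilleVolume_mem)

theorem contractBivector_iterate (r : ℕ) (hr : r ≤ finrank ℝ E / 2) :
    (contractBivector P ^ r) (σ ^ (finrank ℝ E / 2)) =
      ((Nat.descFactorial (finrank ℝ E / 2) r : ℝ) * Nat.factorial r) •
        σ ^ (finrank ℝ E / 2 - r) := by
  induction r with
  | zero => simp
  | succ r ih =>
    obtain ⟨s, half_eq⟩ : ∃ s, finrank ℝ E / 2 = r + 1 + s := Nat.exists_eq_add_of_le hr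
    have half_sub : finrank ℝ E / 2 - r = s + 1 := by omega
    have half_sub_succ : finrank ℝ E / 2 - (r + 1) = s := by omega
    rw [pow_succ', Module.End.mul_apply, ih (by omega), map_smul, half_sub, half_sub_succ,
      h.contractBivector_pow, smul_smul, ← h.cast_finrank_half, Nat.descFactorial_succ,
      Nat.factorial_succ, half_sub]
    congr 1
    rw [half_eq]
    push_cast
    ring

/-! ### The symplectic star operator -/

theorem symplecticStar_parity (β : FormFibre E) :
    symplecticStar P σ (parity β) = parity (symplecticStar P σ β) := by
  induction β using CliffordAlgebra.left_induction with
  | algebraMap r =>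
    rw [AlgHom.commutes, symplecticStar_algebraMap, map_smul, h.parity_liouvilleVolume]
  | add x y hx hy => simp only [map_add, hx, hy]
  | ι_mul x a hx =>
    rw [map_mul, parity_ι, neg_mul, map_neg, symplecticStar_ι_mul, symplecticStar_ι_mul,
      parity_parity, map_neg, hx, neg_neg, interior_parity, map_neg, parity_parity, neg_neg]

theorem symplecticStar_interior (v : E) (β : FormFibre E) :
    symplecticStar P σ (interior v β) =
      -(ι ℝ (flat σ v) * symplecticStar P σ (parity β)) := by
  induction β using CliffordAlgebra.left_induction with
  | algebraMap r =>
    rw [interior_algebraMap, map_zero, AlgHom.commutes, symplecticStar_algebraMap, mul_smul_comm,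
      h.mul_liouvilleVolume (k := 0) (ι_mem_exteriorPower _), smul_zero, neg_zero]
  | add x y hx hy => simp only [map_add, mul_add, hx, hy, neg_add]
  | ι_mul x a hx =>
    have star_parity_ι_mul : symplecticStar P σ (parity (ι ℝ a * x)) =
        interior (P a) (symplecticStar P σ x) := by
      rw [map_mul, parity_ι, neg_mul, map_neg, symplecticStar_ι_mul, parity_parity, neg_neg]
    have parity_ι_mul_star : parity (ι ℝ (flat σ v) * symplecticStar P σ (parity x)) =
        -(ι ℝ (flat σ v) * symplecticStar P σ x) := by
      rw [map_mul, ← h.symplecticStar_parity, parity_parity, parity_ι, neg_mul]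
    rw [star_parity_ι_mul, interior_ι_mul, map_sub, map_smul, symplecticStar_ι_mul,
      h.symplecticStar_parity, hx, map_neg, parity_ι_mul_star, neg_neg, interior_ι_mul,
      flat_antisymm h.mem, h.flat_sharp]
    module

theorem symplecticStar_mem {k : ℕ} (hk : k ≤ finrank ℝ E) {β : FormFibre E}
    (hβ : β ∈ ⋀[ℝ]^k (Dual ℝ E)) :
    symplecticStar P σ β ∈ ⋀[ℝ]^(finrank ℝ E - k) (Dual ℝ E) := by
  induction hβ using exteriorPower_induction with
  | algebraMap r =>
    rw [symplecticStar_algebraMap]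
    exact Submodule.smul_mem _ _ h.liouvilleVolume_mem
  | add k x y _ _ hx hy =>
    rw [map_add]
    exact add_mem (hx hk) (hy hk)
  | ι_mul k a x hx ih =>
    rw [symplecticStar_ι_mul, parity_of_mem hx, map_smul, map_smul]
    refine neg_mem (Submodule.smul_mem _ _ (interior_mem _ ?_))
    have star_mem := ih (by omega)
    rwa [show finrank ℝ E - k = finrank ℝ E - (k + 1) + 1 by omega] at star_mem

theorem mul_symplecticStar {k : ℕ} (hk : k ≤ finrank ℝ E) {α β : FormFibre E}
    (hα : α ∈ ⋀[ℝ]^k (Dual ℝ E)) (hβ : β ∈ ⋀[ℝ]^k (Dual ℝ E)) :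
    α * symplecticStar P σ β = exteriorPairing (dualForm P) α β • liouvilleVolume σ := by
  induction hβ using exteriorPower_induction generalizing α with
  | algebraMap r =>
    obtain ⟨s, rfl⟩ := mem_exteriorPower_zero.mp hα
    rw [symplecticStar_algebraMap, exteriorPairing_algebraMap,
      ExteriorAlgebra.algebraMap_leftInverse, ← Algebra.smul_def, smul_smul]
  | add k x y _ _ hx hy => rw [map_add, mul_add, hx hk hα, hy hk hα, map_add, add_smul]
  | ι_mul k b x hx ih =>
    have contractLeft_eq : contractLeft ((dualForm P).flip b) α = -interior (P b) α := by
      have flip_eq : (dualForm P).flip b = Dual.eval ℝ E (-P b) :=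
        LinearMap.ext fun a => by simp [dualForm_apply, h.antisymm a b]
      rw [← LinearMap.neg_apply, ← interior_neg, flip_eq]
      rfl
    have interior_mul_eq_zero : interior (P b) (α * symplecticStar P σ x) = 0 := by
      rw [eq_zero_of_mem_of_finrank_lt (k := k + 1 + (finrank ℝ E - k)) (by omega)
        (mul_mem_exteriorPower hα (h.symplecticStar_mem (by omega) hx)), map_zero]
    rw [interior_mul, parity_of_mem hα, smul_mul_assoc] at interior_mul_eq_zero
    rw [exteriorPairing_mul_ι, contractLeft_eq,
      ← ih (by omega) (neg_mem (interior_mem _ hα)), symplecticStar_ι_mul, parity_of_mem hx,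
      map_smul, map_smul, neg_mul, eq_neg_of_add_eq_zero_left interior_mul_eq_zero, pow_succ,
      mul_neg, mul_smul_comm]
    simp

end IsSharp

end FormFibre

namespace FormFibre

variable {E : Type*} [NormedAddCommGroup E] [NormedSpace ℝ E] [FiniteDimensional ℝ E]

/-- The property characterizing the star operator of the pairing extending `c` and the volume
element `vol`, with the bilinear pairing `exteriorPairing c` in place of `pairing c`. -/
def IsStar (c : Dual ℝ E →ₗ[ℝ] Dual ℝ (Dual ℝ E)) (vol : FormFibre E)
    (s : End ℝ (FormFibre E)) : Prop :=
  ∀ k ≤ finrank ℝ E, ∀ β ∈ ⋀[ℝ]^k (Dual ℝ E), s β ∈ ⋀[ℝ]^(finrank ℝ E - k) (Dual ℝ E) ∧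
    ∀ α ∈ ⋀[ℝ]^k (Dual ℝ E), α * s β = exteriorPairing c α β • vol

theorem star_eq {c : Dual ℝ E →ₗ[ℝ] Dual ℝ (Dual ℝ E)} {vol : FormFibre E}
    {s : End ℝ (FormFibre E)} (hs : IsStar c vol s) : star c vol = s := by
  have star_spec : IsStar c vol (star c vol) := by
    have isStar_iff : IsStar c vol = fun s => ∀ k ≤ finrank ℝ E, ∀ β ∈ ⋀[ℝ]^k (Dual ℝ E),
        s β ∈ ⋀[ℝ]^(finrank ℝ E - k) (Dual ℝ E) ∧
          ∀ α ∈ ⋀[ℝ]^k (Dual ℝ E), α * s β = pairing c α β • vol := by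
      simp only [funext_iff, IsStar, pairing_eq, implies_true]
    rw [star, ← isStar_iff]
    exact Classical.epsilon_spec ⟨s, hs⟩
  refine exteriorAlgebra_linearMap_ext fun k hk β hβ => sub_eq_zero.mp ?_
  rw [Subspace.dual_finrank_eq] at hk
  refine eq_zero_of_forall_mul_eq_zero (k := k) (l := finrank ℝ E - k) ?_
    (sub_mem (star_spec k hk β hβ).1 (hs k hk β hβ).1) fun α hα => ?_
  · rw [Subspace.dual_finrank_eq]
    omega
  · rw [mul_sub, (star_spec k hk β hβ).2 α hα, (hs k hk β hβ).2 α hα, sub_self]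

namespace IsSharp

variable {σ : FormFibre E} {P : Dual ℝ E →ₗ[ℝ] E} (h : IsSharp σ P)
include h

theorem isStar : IsStar (dualForm P) (liouvilleVolume σ) (symplecticStar P σ) := fun _ hk _ hβ =>
  ⟨h.symplecticStar_mem hk hβ, fun _ hα => h.mul_symplecticStar hk hα hβ⟩

theorem star_eq_symplecticStar :
    star (dualForm P) (liouvilleVolume σ) = symplecticStar P σ :=
  star_eq h.isStar

/-! ### Symplectic adjoints -/

theorem dualLefschetz_ι_mul_ι (a b : Dual ℝ E) :
    dualLefschetz P (ι ℝ a * ι ℝ b) = interior (P b) * interior (P a) := by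
  refine LinearMap.ext fun β => ?_
  have summand_eq : ∀ i, interior (finBasis ℝ E i)
      (interior ((P ∘ₗ flat (ι ℝ a * ι ℝ b) ∘ₗ P) ((finBasis ℝ E).coord i)) β) =
        interior (a (P ((finBasis ℝ E).coord i)) • finBasis ℝ E i) (interior (P b) β) -
          interior (b (P ((finBasis ℝ E).coord i)) • finBasis ℝ E i) (interior (P a) β) := by
    intro i
    simp only [LinearMap.comp_apply, flat_ι_mul_ι, interior_sub, interior_smul, map_smul,
      LinearMap.sub_apply, LinearMap.smul_apply, map_sub]
  rw [dualLefschetz, contractBivector_apply]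
  simp only [summand_eq, Finset.sum_sub_distrib, ← LinearMap.sum_apply, ← interior_sum,
    sum_apply_antisymm h.antisymm, interior_neg, LinearMap.neg_apply, Module.End.mul_apply]
  rw [interior_comm (P a) (P b)]
  module

theorem dualLefschetz_self : dualLefschetz P σ = contractBivector P := by
  rw [dualLefschetz, h.flat_comp_sharp]
  rfl

theorem dualLefschetz_two_mul {τ : FormFibre E} (hτ : τ ∈ ⋀[ℝ]^2 (Dual ℝ E))
    (β : FormFibre E) :
    dualLefschetz P τ (σ * β) = σ * dualLefschetz P τ β + weight (flat τ ∘ₗ P) β := by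
  have comp_eq : flat σ ∘ₗ P ∘ₗ flat τ ∘ₗ P = flat τ ∘ₗ P :=
    LinearMap.ext fun a => h.flat_sharp _
  rw [dualLefschetz, contractBivector_two_mul (h.antisymm_comp hτ) h.mem, comp_eq]

theorem adjoint_mulLeft {τ : FormFibre E} (hτ : τ ∈ ⋀[ℝ]^2 (Dual ℝ E)) :
    adjoint (dualForm P) (LinearMap.mulLeft ℝ τ) = dualLefschetz P τ := by
  induction hτ using exteriorPower_two_induction with
  | ι_mul_ι a b =>
    have mulLeft_eq : LinearMap.mulLeft ℝ (ι ℝ a * ι ℝ b : FormFibre E) = wedge a * wedge b :=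
      LinearMap.ext fun β => mul_assoc _ _ _
    rw [mulLeft_eq, adjoint_mul h.surjective_dualForm, adjoint_wedge h.surjective_dualForm,
      adjoint_wedge h.surjective_dualForm, h.dualLefschetz_ι_mul_ι]
  | add x y _ _ hx hy =>
    have mulLeft_eq : LinearMap.mulLeft ℝ (x + y) = LinearMap.mulLeft ℝ x + LinearMap.mulLeft ℝ y :=
      LinearMap.ext fun β => add_mul _ _ _
    rw [mulLeft_eq, adjoint_add h.surjective_dualForm, hx, hy, dualLefschetz_add]

theorem adjoint_ι_mul {τ : FormFibre E} (hτ : τ ∈ ⋀[ℝ]^2 (Dual ℝ E)) (a : Dual ℝ E) :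
    adjoint (dualForm P) (LinearMap.mulLeft ℝ (ι ℝ a * τ)) =
      dualLefschetz P τ * interior (P a) := by
  have mulLeft_eq : LinearMap.mulLeft ℝ (ι ℝ a * τ : FormFibre E) =
      wedge a * LinearMap.mulLeft ℝ τ := LinearMap.ext fun β => mul_assoc _ _ _
  rw [mulLeft_eq, adjoint_mul h.surjective_dualForm, adjoint_wedge h.surjective_dualForm,
    h.adjoint_mulLeft hτ]

theorem adjoint_interior (v : E) :
    adjoint (dualForm P) (interior v) = wedge (-flat σ v) := by
  refine adjoint_eq h.surjective_dualForm fun α β => ?_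
  have flip_eq : (dualForm P).flip (-flat σ v) = Dual.eval ℝ E v :=
    LinearMap.ext fun a => by
      simp [dualForm_apply, flat_antisymm h.mem, h.flat_sharp]
  rw [wedge_apply, exteriorPairing_mul_ι, flip_eq]
  rfl

theorem adjoint_contractBivector :
    adjoint (dualForm P) (contractBivector P) = LinearMap.mulLeft ℝ σ := by
  have hc := h.surjective_dualForm
  refine adjoint_eq hc fun α β => ?_
  have pairing_summand : ∀ i, exteriorPairing (dualForm P)
      (interior (finBasis ℝ E i) (interior (P ((finBasis ℝ E).coord i)) α)) β =
        exteriorPairing (dualForm P) α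
          (ι ℝ ((finBasis ℝ E).coord i) * interior (finBasis ℝ E i) σ * β) := fun i => by
    rw [pairing_adjoint hc, pairing_adjoint hc, h.adjoint_interior, h.adjoint_interior,
      h.flat_sharp, ← ι_flat h.mem]
    simp [wedge_apply, mul_assoc]
  rw [contractBivector_apply, map_smul, LinearMap.smul_apply, map_sum, LinearMap.sum_apply]
  simp only [pairing_summand]
  rw [← map_sum, ← Finset.sum_mul, sum_ι_mul_interior h.mem, smul_mul_assoc, map_smul, smul_smul]
  norm_num

/-! ### Conjugation by the symplectic star -/

theorem symplecticStar_two_mul {τ : FormFibre E} (hτ : τ ∈ ⋀[ℝ]^2 (Dual ℝ E))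
    (β : FormFibre E) :
    symplecticStar P σ (τ * β) = dualLefschetz P τ (symplecticStar P σ β) := by
  induction hτ using exteriorPower_two_induction with
  | ι_mul_ι a b =>
    rw [mul_assoc, symplecticStar_ι_mul, map_mul, parity_ι, neg_mul, map_neg,
      symplecticStar_ι_mul, parity_parity, neg_neg, h.dualLefschetz_ι_mul_ι, interior_comm, neg_neg]
    rfl
  | add x y _ _ hx hy => rw [add_mul, map_add, hx, hy, dualLefschetz_add, LinearMap.add_apply]

theorem symplecticStar_liouvilleVolume : symplecticStar P σ (liouvilleVolume σ) = 1 := by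
  have star_pow : ∀ r : ℕ,
      symplecticStar P σ (σ ^ r) = (contractBivector P ^ r) (liouvilleVolume σ) := by
    intro r
    induction r with
    | zero => simpa using symplecticStar_algebraMap P σ 1
    | succ r ih =>
      rw [pow_succ', h.symplecticStar_two_mul h.mem, ih, h.dualLefschetz_self, pow_succ',
        Module.End.mul_apply]
  have star_volume : symplecticStar P σ (liouvilleVolume σ) =
      (Nat.factorial (finrank ℝ E / 2) : ℝ)⁻¹ •
        (contractBivector P ^ (finrank ℝ E / 2)) (liouvilleVolume σ) := by
    conv_lhs => rw [liouvilleVolume, map_smul, star_pow]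
  have factorial_ne_zero : (Nat.factorial (finrank ℝ E / 2) : ℝ) ≠ 0 := by positivity
  rw [star_volume, liouvilleVolume, map_smul, h.contractBivector_iterate _ le_rfl,
    Nat.descFactorial_self, Nat.sub_self, pow_zero, mul_smul, inv_smul_smul₀ factorial_ne_zero,
    inv_smul_smul₀ factorial_ne_zero]

theorem symplecticStar_symplecticStar (β : FormFibre E) :
    symplecticStar P σ (symplecticStar P σ β) = β := by
  induction β using CliffordAlgebra.left_induction with
  | algebraMap r =>
    rw [symplecticStar_algebraMap, map_smul, h.symplecticStar_liouvilleVolume,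
      Algebra.algebraMap_eq_smul_one]
  | add x y hx hy => rw [map_add, map_add, hx, hy]
  | ι_mul x a hx =>
    rw [symplecticStar_ι_mul, map_neg, h.symplecticStar_interior, h.flat_sharp,
      ← h.symplecticStar_parity, parity_parity, hx, neg_neg]

theorem symplecticStar_contractBivector (β : FormFibre E) :
    symplecticStar P σ (contractBivector P β) = σ * symplecticStar P σ β := by
  have star_mul := h.symplecticStar_two_mul h.mem (symplecticStar P σ β)
  rw [h.symplecticStar_symplecticStar, h.dualLefschetz_self] at star_mul
  rw [← star_mul, h.symplecticStar_symplecticStar]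

theorem symplecticStar_weight {τ : FormFibre E} (hτ : τ ∈ ⋀[ℝ]^2 (Dual ℝ E))
    (β : FormFibre E) : symplecticStar P σ (weight (flat τ ∘ₗ P) β) =
      -weight (flat τ ∘ₗ P) (symplecticStar P σ β) := by
  -- the star exchanges the two commutators `[i_π, τ ∧ ·]` and `[dualLefschetz P τ, σ ∧ ·]`
  rw [eq_sub_of_add_eq' (contractBivector_two_mul h.antisymm hτ β).symm, map_sub,
    h.symplecticStar_contractBivector, h.symplecticStar_two_mul hτ, h.symplecticStar_two_mul hτ,
    h.symplecticStar_contractBivector, h.dualLefschetz_two_mul hτ]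
  abel

theorem symplecticStar_ι_mul_symplecticStar (a : Dual ℝ E) (β : FormFibre E) :
    symplecticStar P σ (ι ℝ a * symplecticStar P σ (parity β)) = -interior (P a) β := by
  rw [symplecticStar_ι_mul, ← h.symplecticStar_parity, parity_parity,
    h.symplecticStar_symplecticStar]

theorem symplecticStar_ι_mul_weight {τ : FormFibre E} (hτ : τ ∈ ⋀[ℝ]^2 (Dual ℝ E))
    (a : Dual ℝ E) (β : FormFibre E) :
    symplecticStar P σ (ι ℝ a * weight (flat τ ∘ₗ P) (symplecticStar P σ (parity β))) =
      interior (P a) (weight (flat τ ∘ₗ P) β) := by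
  rw [symplecticStar_ι_mul, ← weight_parity, ← h.symplecticStar_parity, parity_parity,
    h.symplecticStar_weight hτ, h.symplecticStar_symplecticStar, map_neg, neg_neg]

theorem interior_weight {τ : FormFibre E} (hτ : τ ∈ ⋀[ℝ]^2 (Dual ℝ E)) (v : E)
    (β : FormFibre E) :
    interior v (weight (flat τ ∘ₗ P) β) =
      weight (flat τ ∘ₗ P) (interior v β) - interior (P (flat τ v)) β := by
  rw [eq_sub_of_add_eq' (contractBivector_two_mul h.antisymm hτ β).symm,
    eq_sub_of_add_eq' (contractBivector_two_mul h.antisymm hτ (interior v β)).symm, map_sub,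
    interior_contractBivector, interior_two_mul hτ, interior_two_mul hτ, map_add,
    contractBivector_ι_mul h.antisymm, interior_contractBivector]
  abel

theorem ι_mul_dualLefschetz_sub_adjoint {τ : FormFibre E} (hτ : τ ∈ ⋀[ℝ]^2 (Dual ℝ E))
    (a : Dual ℝ E) (β : FormFibre E) :
    ι ℝ a * dualLefschetz P τ β -
      adjoint (dualForm P) (contractBivector P * LinearMap.mulLeft ℝ (ι ℝ a * τ) -
        LinearMap.mulLeft ℝ (ι ℝ a * τ) * contractBivector P) β =
      -interior (P a) (weight (flat τ ∘ₗ P) β) := by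
  have adjoint_commutator : adjoint (dualForm P)
      (contractBivector P * LinearMap.mulLeft ℝ (ι ℝ a * τ) -
        LinearMap.mulLeft ℝ (ι ℝ a * τ) * contractBivector P) β =
      dualLefschetz P τ (interior (P a) (σ * β)) -
        σ * dualLefschetz P τ (interior (P a) β) := by
    rw [adjoint_sub h.surjective_dualForm, adjoint_mul h.surjective_dualForm,
      adjoint_mul h.surjective_dualForm, h.adjoint_ι_mul hτ, h.adjoint_contractBivector]
    rfl
  rw [adjoint_commutator, interior_two_mul h.mem, h.flat_sharp, map_add,
    h.dualLefschetz_two_mul hτ, h.interior_weight hτ, dualLefschetz,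
    contractBivector_ι_mul (h.antisymm_comp hτ)]
  simp only [LinearMap.comp_apply]
  abel

end IsSharp

end FormFibre

namespace FormFibre

variable {E : Type*} [NormedAddCommGroup E] [NormedSpace ℝ E]

/-! ### Pullback -/

@[simp] theorem pullback_ι (A : E →ₗ[ℝ] E) (a : Dual ℝ E) :
    pullback A (ι ℝ a) = ι ℝ (a ∘ₗ A) :=
  ExteriorAlgebra.map_apply_ι _ _

theorem pullback_pullback (A B : E →ₗ[ℝ] E) (β : FormFibre E) :
    pullback A (pullback B β) = pullback (B ∘ₗ A) β := by
  rw [← AlgHom.comp_apply, pullback, pullback, ExteriorAlgebra.map_comp_map]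
  rfl

theorem pullback_id (β : FormFibre E) : pullback LinearMap.id β = β := by
  rw [pullback, LinearMap.dualMap_id, ExteriorAlgebra.map_id, AlgHom.id_apply]

theorem pullback_neg_id (β : FormFibre E) : pullback (-LinearMap.id) β = parity β := by
  have dualMap_neg_id : (-LinearMap.id : E →ₗ[ℝ] E).dualMap = -LinearMap.id :=
    LinearMap.ext fun a => LinearMap.comp_neg _ _
  rw [pullback, dualMap_neg_id, parity]

theorem pullback_parity (A : E →ₗ[ℝ] E) (β : FormFibre E) :
    pullback A (parity β) = parity (pullback A β) := by
  simp only [← pullback_neg_id, pullback_pullback, LinearMap.neg_comp, LinearMap.comp_neg,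
    LinearMap.id_comp, LinearMap.comp_id]

theorem pullback_mem (A : E →ₗ[ℝ] E) {k : ℕ} {β : FormFibre E} (hβ : β ∈ ⋀[ℝ]^k (Dual ℝ E)) :
    pullback A β ∈ ⋀[ℝ]^k (Dual ℝ E) := by
  induction hβ using exteriorPower_induction with
  | algebraMap r => exact mem_exteriorPower_zero.mpr ⟨r, (AlgHom.commutes _ r).symm⟩
  | add k x y _ _ hx hy => rw [map_add]; exact add_mem hx hy
  | ι_mul k a x _ hx => rw [map_mul, pullback_ι]; exact ι_mul_mem_exteriorPower _ hx

theorem algebraMapInv_pullback (A : E →ₗ[ℝ] E) (β : FormFibre E) :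
    algebraMapInv (pullback A β) = algebraMapInv β := by
  induction β using CliffordAlgebra.left_induction with
  | algebraMap r => rw [AlgHom.commutes]
  | add x y hx hy => rw [map_add, map_add, map_add, hx, hy]
  | ι_mul x a _ => simp [algebraMapInv]

variable [FiniteDimensional ℝ E]

theorem interior_pullback (A : E →ₗ[ℝ] E) (v : E) (β : FormFibre E) :
    interior v (pullback A β) = pullback A (interior (A v) β) := by
  induction β using CliffordAlgebra.left_induction with
  | algebraMap r => simp
  | add x y hx hy => simp [hx, hy]
  | ι_mul x a hx => simp [interior_ι_mul, hx]

theorem flat_pullback (A : E →ₗ[ℝ] E) {τ : FormFibre E} (hτ : τ ∈ ⋀[ℝ]^2 (Dual ℝ E)) (v : E) :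
    flat (pullback A τ) v = flat τ (A v) ∘ₗ A := by
  rw [flat_apply, interior_pullback, ← ι_flat hτ, pullback_ι, ExteriorAlgebra.ι_leftInverse]

theorem liouvilleVolume_pullback (A : E →ₗ[ℝ] E) (σ : FormFibre E) :
    liouvilleVolume (pullback A σ) = pullback A (liouvilleVolume σ) := by
  simp [liouvilleVolume]

theorem exteriorPairing_dualForm_comp (P : Dual ℝ E →ₗ[ℝ] E) (J : E →ₗ[ℝ] E)
    (α β : FormFibre E) :
    exteriorPairing (dualForm (J ∘ₗ P)) α β = exteriorPairing (dualForm P) α (pullback J β) := by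
  induction α using CliffordAlgebra.left_induction generalizing β with
  | algebraMap r =>
    rw [exteriorPairing_algebraMap, exteriorPairing_algebraMap, algebraMapInv_pullback]
  | add x y hx hy => simp [hx, hy]
  | ι_mul x a hx =>
    rw [exteriorPairing_ι_mul, exteriorPairing_ι_mul, hx]
    exact congrArg _ (interior_pullback J (P a) β).symm

namespace IsSharp

variable {σ : FormFibre E} {P P' : Dual ℝ E →ₗ[ℝ] E} (h : IsSharp σ P)
include h

theorem of_pullback {A B : E →ₗ[ℝ] E} (hAB : ∀ v, A (B v) = v) (hBA : ∀ v, B (A v) = v) :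
    IsSharp (pullback A σ) (B ∘ₗ P ∘ₗ B.dualMap) where
  mem := pullback_mem A h.mem
  sharp_flat v := by
    have dualMap_comp : B.dualMap (flat σ (A v) ∘ₗ A) = flat σ (A v) :=
      LinearMap.ext fun w => by simp [hAB]
    rw [flat_pullback A h.mem, LinearMap.comp_apply, LinearMap.comp_apply, dualMap_comp,
      h.sharp_flat, hBA]
  flat_sharp a := by
    rw [flat_pullback A h.mem]
    exact LinearMap.ext fun w => by simp [hAB, hBA, h.flat_sharp]

variable {A : E →ₗ[ℝ] E}

theorem map_sharp_comp (hA : Function.Surjective A) (h' : IsSharp (pullback A σ) P')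
    (b : Dual ℝ E) : A (P' (b ∘ₗ A)) = P b := by
  have flat_comp : flat σ (A (P' (b ∘ₗ A))) ∘ₗ A = b ∘ₗ A := by
    rw [← flat_pullback A h.mem, h'.flat_sharp]
  rw [LinearMap.cancel_right hA] at flat_comp
  rw [← flat_comp, h.sharp_flat, flat_comp]

theorem contractBivector_pullback (hA : Function.Surjective A) (h' : IsSharp (pullback A σ) P')
    (β : FormFibre E) :
    contractBivector P' (pullback A β) = pullback A (contractBivector P β) := by
  induction β using CliffordAlgebra.left_induction with
  | algebraMap r => simp
  | add x y hx hy => simp [hx, hy]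
  | ι_mul x a hx =>
    rw [map_mul, pullback_ι, contractBivector_ι_mul h'.antisymm, hx, interior_pullback,
      h.map_sharp_comp hA h', contractBivector_ι_mul h.antisymm, map_sub, map_mul, pullback_ι]

theorem symplecticStar_pullback (hA : Function.Surjective A) (h' : IsSharp (pullback A σ) P')
    (β : FormFibre E) :
    symplecticStar P' (pullback A σ) (pullback A β) = pullback A (symplecticStar P σ β) := by
  induction β using CliffordAlgebra.left_induction with
  | algebraMap r => simp [symplecticStar_algebraMap, liouvilleVolume_pullback]
  | add x y hx hy => simp [hx, hy]
  | ι_mul x a hx =>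
    rw [map_mul, pullback_ι, symplecticStar_ι_mul, h'.symplecticStar_parity, hx,
      ← pullback_parity, interior_pullback, h.map_sharp_comp hA h', symplecticStar_ι_mul, map_neg,
      h.symplecticStar_parity]

theorem star_dualForm_comp (J : E →ₗ[ℝ] E) :
    star (dualForm (J ∘ₗ P)) (liouvilleVolume σ) =
      symplecticStar P σ * (pullback J).toLinearMap :=
  star_eq fun _ hk β hβ =>
    ⟨h.symplecticStar_mem hk (pullback_mem J hβ), fun α hα => by
      rw [exteriorPairing_dualForm_comp]
      exact h.mul_symplecticStar hk hα (pullback_mem J hβ)⟩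

theorem adjoint_parity : adjoint (dualForm P) parity.toLinearMap = parity.toLinearMap := by
  refine adjoint_eq h.surjective_dualForm fun α β => ?_
  simp only [AlgHom.toLinearMap_apply]
  induction α using CliffordAlgebra.left_induction generalizing β with
  | algebraMap r =>
    rw [AlgHom.commutes, exteriorPairing_algebraMap, exteriorPairing_algebraMap,
      ← pullback_neg_id, algebraMapInv_pullback]
  | add x y hx hy => simp only [map_add, LinearMap.add_apply, hx, hy]
  | ι_mul x a hx =>
    have contractLeft_parity : contractLeft (dualForm P a) (parity β) =
        -parity (contractLeft (dualForm P a) β) := interior_parity (P a) β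
    rw [map_mul, parity_ι, neg_mul, map_neg, LinearMap.neg_apply, exteriorPairing_ι_mul,
      exteriorPairing_ι_mul, hx, contractLeft_parity, map_neg]

theorem adjoint_conj_parity {φ : End ℝ (FormFibre E)} (hφ : ∀ β, φ (parity β) = -parity (φ β)) :
    parity.toLinearMap * adjoint (dualForm P) φ * parity.toLinearMap =
      -adjoint (dualForm P) φ := by
  have hc := h.surjective_dualForm
  have conj_eq : parity.toLinearMap * φ * parity.toLinearMap = 0 - φ :=
    LinearMap.ext fun β => by simp [Module.End.mul_apply, hφ]
  conv_lhs => rw [← h.adjoint_parity]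
  rw [mul_assoc, ← adjoint_mul hc, ← adjoint_mul hc, conj_eq, adjoint_sub hc, adjoint_zero hc,
    zero_sub]

end IsSharp

/-! ### Compatible almost complex structures -/

/-- `J` is a complex structure on the vector space `E` for which the bilinear form `σ(·, J ·)` is
symmetric; it need not be positive. -/
structure IsCompatible (σ : FormFibre E) (J : E →ₗ[ℝ] E) : Prop where
  sq : ∀ v, J (J v) = -v
  symm : ∀ v w, flat σ v (J w) = flat σ w (J v)

namespace IsCompatible

variable {σ : FormFibre E} {P : Dual ℝ E →ₗ[ℝ] E} {J : E →ₗ[ℝ] E}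
  (hJ : IsCompatible σ J) (h : IsSharp σ P)
include hJ

theorem surjective : Function.Surjective J := fun v => ⟨-J v, by rw [map_neg, hJ.sq, neg_neg]⟩

theorem comp_self : J ∘ₗ J = -LinearMap.id := LinearMap.ext hJ.sq

theorem pullback_sq (β : FormFibre E) : pullback J (pullback J β) = parity β := by
  rw [pullback_pullback, hJ.comp_self, pullback_neg_id]

theorem pullback_neg_pullback (β : FormFibre E) : pullback (-J) (pullback J β) = β := by
  rw [pullback_pullback, LinearMap.comp_neg, hJ.comp_self, neg_neg, pullback_id]

theorem pullback_pullback_neg (β : FormFibre E) : pullback J (pullback (-J) β) = β := by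
  rw [pullback_pullback, LinearMap.neg_comp, hJ.comp_self, neg_neg, pullback_id]

theorem pullback_neg_sq (β : FormFibre E) : pullback (-J) (pullback (-J) β) = parity β := by
  rw [pullback_pullback, LinearMap.neg_comp, LinearMap.comp_neg, neg_neg, hJ.comp_self,
    pullback_neg_id]

include h

theorem pullback_form : pullback J σ = σ := by
  refine eq_of_flat_eq (pullback_mem J h.mem) h.mem <|
    LinearMap.ext fun v => LinearMap.ext fun w => ?_
  rw [flat_pullback J h.mem, LinearMap.comp_apply, hJ.symm, hJ.sq, map_neg,
    flat_antisymm h.mem, neg_neg]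

theorem isSharp_pullback : IsSharp (pullback J σ) P := (hJ.pullback_form h).symm ▸ h

theorem contractBivector_pullback (β : FormFibre E) :
    contractBivector P (pullback J β) = pullback J (contractBivector P β) :=
  h.contractBivector_pullback hJ.surjective (hJ.isSharp_pullback h) β

theorem symplecticStar_pullback (β : FormFibre E) :
    symplecticStar P σ (pullback J β) = pullback J (symplecticStar P σ β) := by
  rw [← h.symplecticStar_pullback hJ.surjective (hJ.isSharp_pullback h), hJ.pullback_form h]

theorem exteriorPairing_pullback (α β : FormFibre E) :
    exteriorPairing (dualForm P) (pullback J α) (pullback J β) =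
      exteriorPairing (dualForm P) α β := by
  induction α using CliffordAlgebra.left_induction generalizing β with
  | algebraMap r =>
    rw [AlgHom.commutes, exteriorPairing_algebraMap, exteriorPairing_algebraMap,
      algebraMapInv_pullback]
  | add x y hx hy => simp [hx, hy]
  | ι_mul x a hx =>
    have contractLeft_pullback : contractLeft (dualForm P (a ∘ₗ J)) (pullback J β) =
        pullback J (contractLeft (dualForm P a) β) := by
      refine (interior_pullback J (P (a ∘ₗ J)) β).trans ?_
      rw [h.map_sharp_comp hJ.surjective (hJ.isSharp_pullback h)]
      rfl
    rw [map_mul, pullback_ι, exteriorPairing_ι_mul, exteriorPairing_ι_mul, contractLeft_pullback,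
      hx]

theorem surjective_dualForm : Function.Surjective (dualForm (J ∘ₗ P)) :=
  (Module.evalEquiv ℝ E).surjective.comp (hJ.surjective.comp fun v => ⟨_, h.sharp_flat v⟩)

theorem adjoint_metric (φ : End ℝ (FormFibre E)) :
    adjoint (dualForm (J ∘ₗ P)) φ =
      (pullback (-J)).toLinearMap * adjoint (dualForm P) φ * (pullback J).toLinearMap := by
  refine adjoint_eq (hJ.surjective_dualForm h) fun α β => ?_
  rw [exteriorPairing_dualForm_comp, exteriorPairing_dualForm_comp,
    pairing_adjoint h.surjective_dualForm]
  simp [Module.End.mul_apply, hJ.pullback_pullback_neg]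

theorem adjoint_pullback :
    adjoint (dualForm P) (pullback J).toLinearMap = (pullback (-J)).toLinearMap :=
  adjoint_eq h.surjective_dualForm fun α β => by
    conv_lhs => rw [← hJ.pullback_pullback_neg β]
    exact hJ.exteriorPairing_pullback h _ _

theorem adjoint_pullback_neg :
    adjoint (dualForm P) (pullback (-J)).toLinearMap = (pullback J).toLinearMap :=
  adjoint_eq h.surjective_dualForm fun α β => by
    rw [← hJ.exteriorPairing_pullback h]
    simp [hJ.pullback_pullback_neg]

theorem adjoint_metric_mulLeft :
    adjoint (dualForm (J ∘ₗ P)) (LinearMap.mulLeft ℝ σ) = contractBivector P := by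
  rw [hJ.adjoint_metric h, h.adjoint_mulLeft h.mem, h.dualLefschetz_self]
  refine LinearMap.ext fun β => ?_
  simp [Module.End.mul_apply, hJ.contractBivector_pullback h, hJ.pullback_neg_pullback]

-- conjugating by `J` twice is conjugating by the parity, whence the sign for odd operators
theorem adjoint_metric_conj {φ : End ℝ (FormFibre E)}
    (hφ : ∀ β, φ (parity β) = -parity (φ β)) :
    adjoint (dualForm (J ∘ₗ P)) ((pullback (-J)).toLinearMap * φ * (pullback J).toLinearMap) =
      -adjoint (dualForm P) φ := by
  rw [← h.adjoint_conj_parity hφ, hJ.adjoint_metric h, adjoint_mul h.surjective_dualForm,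
    adjoint_mul h.surjective_dualForm, hJ.adjoint_pullback h, hJ.adjoint_pullback_neg h]
  refine LinearMap.ext fun β => ?_
  simp [Module.End.mul_apply, hJ.pullback_sq, hJ.pullback_neg_sq]

end IsCompatible

end FormFibre

/-! ### Differentiating families of linear maps -/

section LinearFamilies

variable {E V W : Type*} [NormedAddCommGroup E] [NormedSpace ℝ E]
  [NormedAddCommGroup V] [NormedSpace ℝ V] [FiniteDimensional ℝ V]
  [NormedAddCommGroup W] [NormedSpace ℝ W]

section Composition

variable (L : V →ₗ[ℝ] W) {f : E → V} {y : E}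

theorem differentiableAt_linearMap_comp (hf : DifferentiableAt ℝ f y) :
    DifferentiableAt ℝ (fun z => L (f z)) y :=
  L.toContinuousLinearMap.differentiableAt.comp y hf

theorem fderiv_linearMap_comp (hf : DifferentiableAt ℝ f y) (v : E) :
    fderiv ℝ (fun z => L (f z)) y v = L (fderiv ℝ f y v) :=
  DFunLike.congr_fun (L.toContinuousLinearMap.hasFDerivAt.comp y hf.hasFDerivAt).fderiv v

theorem contDiffOn_linearMap_comp {s : Set E} {n : WithTop ℕ∞} (hf : ContDiffOn ℝ n f s) :
    ContDiffOn ℝ n (fun z => L (f z)) s :=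
  L.toContinuousLinearMap.contDiff.comp_contDiffOn hf

theorem fderiv_mem_of_eventually (hf : DifferentiableAt ℝ f y) (K : Submodule ℝ V)
    (hK : ∀ᶠ z in 𝓝 y, f z ∈ K) (v : E) : fderiv ℝ f y v ∈ K := by
  rw [← Subspace.forall_mem_dualAnnihilator_apply_eq_zero_iff]
  intro φ hφ
  have comp_eq_zero : (fun z => φ (f z)) =ᶠ[𝓝 y] fun _ => 0 :=
    hK.mono fun z hz => (Submodule.mem_dualAnnihilator φ).mp hφ _ hz
  rw [← fderiv_linearMap_comp φ hf v, comp_eq_zero.fderiv_eq, fderiv_const_apply, zero_apply]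

end Composition

theorem differentiableAt_toContinuousLinearMap {T : E → V →ₗ[ℝ] W} {y : E}
    (hT : ∀ x, DifferentiableAt ℝ (fun z => T z x) y) :
    DifferentiableAt ℝ (fun z => (T z).toContinuousLinearMap) y := by
  let e := (((finBasis ℝ V).equivFunL.arrowCongr (.refl ℝ W)).trans
    (ContinuousLinearEquiv.piRing (Fin (finrank ℝ V))) : (V →L[ℝ] W) ≃L[ℝ] _)
  exact e.comp_differentiableAt_iff.mp (differentiableAt_pi.mpr fun i => hT _)

section Family

variable {T : E → V →ₗ[ℝ] W} {f : E → V}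

theorem differentiableAt_linearMap_apply {y : E} (hT : ∀ x, DifferentiableAt ℝ (fun z => T z x) y)
    (hf : DifferentiableAt ℝ f y) : DifferentiableAt ℝ (fun z => T z (f z)) y :=
  (differentiableAt_toContinuousLinearMap hT).clm_apply hf

theorem fderiv_linearMap_apply {y : E} (hT : ∀ x, DifferentiableAt ℝ (fun z => T z x) y)
    (hf : DifferentiableAt ℝ f y) (v : E) :
    fderiv ℝ (fun z => T z (f z)) y v =
      T y (fderiv ℝ f y v) + fderiv ℝ (fun z => T z (f y)) y v := by
  have hT' := differentiableAt_toContinuousLinearMap hT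
  have fderiv_apply := DFunLike.congr_fun (fderiv_clm_apply hT' hf) v
  have fderiv_apply_const :=
    DFunLike.congr_fun (fderiv_clm_apply hT' (differentiableAt_const (f y))) v
  simp only [LinearMap.coe_toContinuousLinearMap', fderiv_const_apply,
    ContinuousLinearMap.comp_zero, zero_add] at fderiv_apply fderiv_apply_const
  rw [fderiv_apply, fderiv_apply_const]
  rfl

theorem contDiffOn_linearMap_apply {s : Set E} {n : WithTop ℕ∞}
    (hT : ∀ x, ContDiffOn ℝ n (fun z => T z x) s) (hf : ContDiffOn ℝ n f s) :
    ContDiffOn ℝ n (fun z => T z (f z)) s :=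
  (contDiffOn_clm_apply (f := fun z => (T z).toContinuousLinearMap).mpr hT).clm_apply hf

end Family

section Bilinear

variable {U : Type*} [NormedAddCommGroup U] [NormedSpace ℝ U] [FiniteDimensional ℝ U]
  (B : U →ₗ[ℝ] V →ₗ[ℝ] W) {f : E → U} {g : E → V}

theorem differentiableAt_bilin {y : E} (hf : DifferentiableAt ℝ f y)
    (hg : DifferentiableAt ℝ g y) : DifferentiableAt ℝ (fun z => B (f z) (g z)) y :=
  differentiableAt_linearMap_apply (T := fun z => B (f z))
    (fun x => differentiableAt_linearMap_comp (B.flip x) hf) hg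

theorem fderiv_bilin {y : E} (hf : DifferentiableAt ℝ f y) (hg : DifferentiableAt ℝ g y) (v : E) :
    fderiv ℝ (fun z => B (f z) (g z)) y v =
      B (fderiv ℝ f y v) (g y) + B (f y) (fderiv ℝ g y v) := by
  rw [fderiv_linearMap_apply (T := fun z => B (f z))
    (fun x => differentiableAt_linearMap_comp (B.flip x) hf) hg, add_comm]
  exact congrArg (· + _) (fderiv_linearMap_comp (B.flip (g y)) hf v)

theorem contDiffOn_bilin {s : Set E} {n : WithTop ℕ∞} (hf : ContDiffOn ℝ n f s)
    (hg : ContDiffOn ℝ n g s) : ContDiffOn ℝ n (fun z => B (f z) (g z)) s :=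
  contDiffOn_linearMap_apply (T := fun z => B (f z))
    (fun x => contDiffOn_linearMap_comp (B.flip x) hf) hg

end Bilinear

end LinearFamilies

theorem differentiableAt_fderiv {E V : Type*} [NormedAddCommGroup E] [NormedSpace ℝ E]
    [NormedAddCommGroup V] [NormedSpace ℝ V] {f : E → V} {y : E} (hf : ContDiffAt ℝ 2 f y) :
    DifferentiableAt ℝ (fderiv ℝ f) y :=
  (hf.fderiv_right (m := 1) (by norm_num)).differentiableAt one_ne_zero

namespace FormFibre

variable {E : Type*} [NormedAddCommGroup E] [NormedSpace ℝ E] [FiniteDimensional ℝ E]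

/-! ### The exterior derivative on a vector space -/

/-- The map `E* ⊗ ⋀ E* → ⋀ E*`, `a ⊗ β ↦ a ∧ β`, where `E* ⊗ ⋀ E*` is encoded as the space of
linear maps `E → ⋀ E*`. -/
def antisymmetrize : (E →L[ℝ] FormFibre E) →ₗ[ℝ] FormFibre E :=
  ∑ i, wedge ((finBasis ℝ E).coord i) ∘ₗ
    (ContinuousLinearMap.apply ℝ (FormFibre E) (finBasis ℝ E i)).toLinearMap

theorem antisymmetrize_apply (T : E →L[ℝ] FormFibre E) :
    antisymmetrize T = ∑ i, ι ℝ ((finBasis ℝ E).coord i) * T (finBasis ℝ E i) := by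
  simp [antisymmetrize, wedge_apply]

theorem antisymmetrize_pullback_comp (A : E →L[ℝ] E) (T S : E →L[ℝ] FormFibre E)
    (hS : ∀ v, S v = pullback A.toLinearMap (T (A v))) :
    antisymmetrize S = pullback A.toLinearMap (antisymmetrize T) := by
  have map_expand : ∀ v, T v = ∑ j, (finBasis ℝ E).coord j v • T (finBasis ℝ E j) := fun v => by
    conv_lhs => rw [← sum_coord_smul v, map_sum]
    simp only [map_smul]
  have ι_comp : ∀ j, (ι ℝ ((finBasis ℝ E).coord j ∘ₗ A.toLinearMap) : FormFibre E) =
      ∑ i, (finBasis ℝ E).coord j (A (finBasis ℝ E i)) • ι ℝ ((finBasis ℝ E).coord i) :=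
    fun j => by
      conv_lhs => rw [← sum_apply_smul_coord ((finBasis ℝ E).coord j ∘ₗ A.toLinearMap), map_sum]
      simp only [map_smul, LinearMap.comp_apply, ContinuousLinearMap.coe_coe]
  rw [antisymmetrize_apply, antisymmetrize_apply, map_sum]
  simp only [map_mul, pullback_ι, ι_comp, Finset.sum_mul]
  rw [Finset.sum_comm]
  refine Finset.sum_congr rfl fun i _ => ?_
  rw [hS, map_expand, map_sum, Finset.mul_sum]
  exact Finset.sum_congr rfl fun j _ => by rw [map_smul, mul_smul_comm, smul_mul_assoc]

theorem sum_ι_mul_ι_mul_eq_zero {D : Fin (finrank ℝ E) → Fin (finrank ℝ E) → FormFibre E}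
    (hD : ∀ i j, D i j = D j i) :
    ∑ i, ∑ j, ι ℝ ((finBasis ℝ E).coord i) * (ι ℝ ((finBasis ℝ E).coord j) * D i j) = 0 := by
  suffices h : ∑ i, ∑ j, ι ℝ ((finBasis ℝ E).coord i) * (ι ℝ ((finBasis ℝ E).coord j) * D i j) =
      -∑ i, ∑ j, ι ℝ ((finBasis ℝ E).coord i) * (ι ℝ ((finBasis ℝ E).coord j) * D i j) by
    have two_smul_eq_zero := add_eq_zero_iff_eq_neg.mpr h
    rw [← two_smul ℝ] at two_smul_eq_zero
    exact (smul_eq_zero.mp two_smul_eq_zero).resolve_left two_ne_zero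
  conv_lhs => rw [Finset.sum_comm]
  simp only [← Finset.sum_neg_distrib]
  refine Finset.sum_congr rfl fun i _ => Finset.sum_congr rfl fun j _ => ?_
  rw [← mul_assoc, ι_mul_ι_anticomm, hD, neg_mul, mul_assoc]

theorem sum_ι_mul_ι_eq_zero {B : E → Dual ℝ E} (hB : ∀ v w, B v w = B w v) :
    ∑ i, ι ℝ ((finBasis ℝ E).coord i) * ι ℝ (B (finBasis ℝ E i)) = (0 : FormFibre E) := by
  have expand : ∀ v, (ι ℝ (B v) : FormFibre E) = ∑ j,
      ι ℝ ((finBasis ℝ E).coord j) * algebraMap ℝ _ (B v (finBasis ℝ E j)) := fun v => by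
    conv_lhs => rw [← sum_apply_smul_coord (B v), map_sum]
    simp only [map_smul, Algebra.smul_def, Algebra.commutes]
  simp only [expand, Finset.mul_sum]
  exact sum_ι_mul_ι_mul_eq_zero fun i j => by rw [hB]

/-- The exterior derivative of a form on a vector space, given as a function with values in
`⋀ E*`. -/
def extd (f : E → FormFibre E) (y : E) : FormFibre E := antisymmetrize (fderiv ℝ f y)

theorem extd_apply (f : E → FormFibre E) (y : E) :
    extd f y = ∑ i, ι ℝ ((finBasis ℝ E).coord i) * fderiv ℝ f y (finBasis ℝ E i) :=
  antisymmetrize_apply _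

theorem extd_congr {f g : E → FormFibre E} {y : E} (h : f =ᶠ[𝓝 y] g) : extd f y = extd g y := by
  rw [extd, extd, h.fderiv_eq]

section Leibniz

variable {f g : E → FormFibre E} {y : E}

theorem extd_smul (r : ℝ) (hf : DifferentiableAt ℝ f y) :
    extd (fun z => r • f z) y = r • extd f y := by
  rw [extd, extd, fderiv_fun_const_smul hf, map_smul]

variable (hf : DifferentiableAt ℝ f y) (hg : DifferentiableAt ℝ g y)
include hf hg

theorem extd_add : extd (fun z => f z + g z) y = extd f y + extd g y := by
  rw [extd, extd, extd, fderiv_fun_add hf hg, map_add]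

theorem differentiableAt_mul : DifferentiableAt ℝ (fun z => f z * g z) y :=
  differentiableAt_bilin (LinearMap.mul ℝ (FormFibre E)) hf hg

theorem fderiv_mul (v : E) :
    fderiv ℝ (fun z => f z * g z) y v = fderiv ℝ f y v * g y + f y * fderiv ℝ g y v :=
  fderiv_bilin (LinearMap.mul ℝ (FormFibre E)) hf hg v

theorem extd_mul :
    extd (fun z => f z * g z) y = extd f y * g y + parity (f y) * extd g y := by
  simp only [extd_apply, fderiv_mul hf hg, mul_add, Finset.sum_add_distrib, Finset.sum_mul,
    Finset.mul_sum, ← mul_assoc, ι_mul_eq_parity_mul_ι _ (f y)]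

end Leibniz

theorem extd_extd {f : E → FormFibre E} {y : E} (hf : ContDiffAt ℝ 2 f y) :
    extd (extd f) y = 0 := by
  have fderiv_extd : ∀ v, fderiv ℝ (extd f) y v = ∑ j, ι ℝ ((finBasis ℝ E).coord j) *
      fderiv ℝ (fderiv ℝ f) y v (finBasis ℝ E j) := fun v =>
    (fderiv_linearMap_comp antisymmetrize (differentiableAt_fderiv hf) v).trans
      (antisymmetrize_apply _)
  rw [extd_apply]
  simp only [fderiv_extd, Finset.mul_sum]
  exact sum_ι_mul_ι_mul_eq_zero fun i j => (hf.isSymmSndFDerivAt (by simp)).eq _ _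

section Pullback

variable {F : E → E} {y : E} (hF : ContDiffAt ℝ 2 F y)
include hF

theorem differentiableAt_ι_comp_fderiv (a : Dual ℝ E) :
    DifferentiableAt ℝ (fun z => (ι ℝ (a ∘ₗ (fderiv ℝ F z).toLinearMap) : FormFibre E)) y :=
  differentiableAt_linearMap_comp (ι ℝ ∘ₗ a.compRight ℝ ∘ₗ ContinuousLinearMap.coeLM ℝ)
    (differentiableAt_fderiv hF)

theorem extd_ι_comp_fderiv (a : Dual ℝ E) :
    extd (fun z => (ι ℝ (a ∘ₗ (fderiv ℝ F z).toLinearMap) : FormFibre E)) y = 0 := by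
  have fderiv_ι := fderiv_linearMap_comp
    (ι ℝ ∘ₗ a.compRight ℝ ∘ₗ ContinuousLinearMap.coeLM ℝ) (differentiableAt_fderiv hF)
  refine (extd_apply _ _).trans ((Finset.sum_congr rfl fun i _ =>
    congrArg _ (fderiv_ι (finBasis ℝ E i))).trans (sum_ι_mul_ι_eq_zero
      (B := fun v => a ∘ₗ (fderiv ℝ (fderiv ℝ F) y v).toLinearMap) fun v w => ?_))
  exact congrArg a ((hF.isSymmSndFDerivAt (by simp)).eq v w)

theorem differentiableAt_pullback_fderiv (γ : FormFibre E) :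
    DifferentiableAt ℝ (fun z => pullback (fderiv ℝ F z).toLinearMap γ) y := by
  induction γ using CliffordAlgebra.left_induction with
  | algebraMap r => simp
  | add x x' hx hx' =>
    simp only [map_add]
    exact hx.add hx'
  | ι_mul x a hx =>
    simp only [map_mul, pullback_ι]
    exact differentiableAt_mul (differentiableAt_ι_comp_fderiv hF a) hx

theorem extd_pullback_fderiv (γ : FormFibre E) :
    extd (fun z => pullback (fderiv ℝ F z).toLinearMap γ) y = 0 := by
  have differentiableAt := differentiableAt_pullback_fderiv hF
  induction γ using CliffordAlgebra.left_induction with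
  | algebraMap r => simp [extd]
  | add x x' hx hx' =>
    simp only [map_add]
    rw [extd_add (differentiableAt x) (differentiableAt x'), hx, hx', add_zero]
  | ι_mul x a hx =>
    simp only [map_mul, pullback_ι]
    rw [extd_mul (differentiableAt_ι_comp_fderiv hF a) (differentiableAt x),
      extd_ι_comp_fderiv hF, hx, zero_mul, mul_zero, add_zero]

theorem extd_pullback {β : E → FormFibre E} (hβ : DifferentiableAt ℝ β (F y)) :
    extd (fun z => pullback (fderiv ℝ F z).toLinearMap (β (F z))) y =
      pullback (fderiv ℝ F y).toLinearMap (extd β (F y)) := by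
  have hβF : HasFDerivAt (fun z => β (F z)) ((fderiv ℝ β (F y)).comp (fderiv ℝ F y)) y :=
    hβ.hasFDerivAt.comp y (hF.differentiableAt two_ne_zero).hasFDerivAt
  have fderiv_eq := fderiv_linearMap_apply
    (T := fun z => (pullback (fderiv ℝ F z).toLinearMap).toLinearMap)
    (differentiableAt_pullback_fderiv hF) hβF.differentiableAt
  simp only [AlgHom.toLinearMap_apply, hβF.fderiv] at fderiv_eq
  have antisymmetrize_sub := antisymmetrize_pullback_comp (fderiv ℝ F y) (fderiv ℝ β (F y))
    (fderiv ℝ (fun z => pullback (fderiv ℝ F z).toLinearMap (β (F z))) y -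
      fderiv ℝ (fun z => pullback (fderiv ℝ F z).toLinearMap (β (F y))) y) fun v => by
        rw [sub_apply, fderiv_eq, add_sub_cancel_right]
        rfl
  rwa [map_sub, ← extd, ← extd, ← extd, extd_pullback_fderiv hF, sub_zero] at antisymmetrize_sub

end Pullback

end FormFibre

namespace FormFibre

variable {E : Type*} [NormedAddCommGroup E] [NormedSpace ℝ E] [FiniteDimensional ℝ E]

/-! ### Families of nondegenerate 2-forms -/

/-- The endomorphism of `E` obtained from `v ↦ τ(v, ·)` by identifying `E*` with `E` through a fixed
basis, as a linear function of the `2`-form `τ`; it brings inversion of `τ` within the reach of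
differential calculus. -/
def flatEnd : FormFibre E →ₗ[ℝ] E →L[ℝ] E where
  toFun τ := ((finBasis ℝ E).toDualEquiv.symm.toLinearMap ∘ₗ flat τ).toContinuousLinearMap
  map_add' τ τ' := by
    ext v
    simp [flat_add]
  map_smul' r τ := by
    ext v
    simp [flat_apply]

/-- The linear equivalence `v ↦ σ(v, ·)` of a nondegenerate `2`-form. -/
def IsSharp.flatEquiv {σ : FormFibre E} {P : Dual ℝ E →ₗ[ℝ] E} (hs : IsSharp σ P) :
    E ≃ₗ[ℝ] Dual ℝ E :=
  .ofLinearMap (flat σ) P (LinearMap.ext hs.flat_sharp) (LinearMap.ext hs.sharp_flat)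

theorem IsSharp.inverse_flatEnd {σ : FormFibre E} {P : Dual ℝ E →ₗ[ℝ] E} (hs : IsSharp σ P)
    (a : Dual ℝ E) : (flatEnd σ).inverse ((finBasis ℝ E).toDualEquiv.symm a) = P a := by
  refine (DFunLike.congr_fun (ContinuousLinearMap.inverse_equiv (hs.flatEquiv.trans
    (finBasis ℝ E).toDualEquiv.symm).toContinuousLinearEquiv) _).trans ?_
  exact congrArg P ((finBasis ℝ E).toDualEquiv.apply_symm_apply a)

theorem IsSharp.contDiffAt_inverse_flatEnd {σ : FormFibre E} {P : Dual ℝ E →ₗ[ℝ] E}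
    (hs : IsSharp σ P) {n : WithTop ℕ∞} :
    ContDiffAt ℝ n ContinuousLinearMap.inverse (flatEnd σ) :=
  contDiffAt_map_inverse
    (hs.flatEquiv.trans (finBasis ℝ E).toDualEquiv.symm).toContinuousLinearEquiv

/-- A smooth family of nondegenerate `2`-forms on an open set, with their inverses. -/
structure SharpFamily (U : Set E) (σ : E → FormFibre E) (P : E → Dual ℝ E →ₗ[ℝ] E) :
    Prop where
  isOpen : IsOpen U
  smooth : ContDiffOn ℝ ∞ σ U
  sharp : ∀ z ∈ U, IsSharp (σ z) (P z)

namespace SharpFamily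

variable {U : Set E} {σ : E → FormFibre E} {P : E → Dual ℝ E →ₗ[ℝ] E}
  (h : SharpFamily U σ P) {y : E} (hy : y ∈ U)
include h

theorem contDiffOn_sharp (a : Dual ℝ E) : ContDiffOn ℝ ∞ (fun z => P z a) U := by
  have contDiffOn_inverse : ContDiffOn ℝ ∞
      (fun z => (flatEnd (σ z)).inverse ((finBasis ℝ E).toDualEquiv.symm a)) U := fun z hz =>
    ((h.sharp z hz).contDiffAt_inverse_flatEnd.comp_contDiffWithinAt z
      (contDiffOn_linearMap_comp flatEnd h.smooth z hz)).clm_apply contDiffWithinAt_const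
  exact contDiffOn_inverse.congr fun z hz => ((h.sharp z hz).inverse_flatEnd a).symm

theorem contDiffOn_contractBivector {f : E → FormFibre E} (hf : ContDiffOn ℝ ∞ f U) :
    ContDiffOn ℝ ∞ (fun z => contractBivector (P z) (f z)) U := by
  simp only [contractBivector_apply]
  exact ContDiffOn.const_smul _ (ContDiffOn.sum fun i _ =>
    contDiffOn_linearMap_comp (interior (finBasis ℝ E i))
      (contDiffOn_bilin interiorHom (h.contDiffOn_sharp ((finBasis ℝ E).coord i)) hf))

include hy

theorem mem_nhds : U ∈ 𝓝 y := h.isOpen.mem_nhds hy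

theorem differentiableAt : DifferentiableAt ℝ σ y :=
  (h.smooth.contDiffAt (h.mem_nhds hy)).differentiableAt (by simp)

theorem fderiv_mem (v : E) : fderiv ℝ σ y v ∈ ⋀[ℝ]^2 (Dual ℝ E) :=
  fderiv_mem_of_eventually (h.differentiableAt hy) _
    (Filter.eventually_of_mem (h.mem_nhds hy) fun z hz => (h.sharp z hz).mem) v

theorem differentiableAt_sharp (a : Dual ℝ E) : DifferentiableAt ℝ (fun z => P z a) y :=
  ((h.contDiffOn_sharp a).contDiffAt (h.mem_nhds hy)).differentiableAt (by simp)

-- Differentiate the identity `ι_{P a} σ = a`.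
theorem fderiv_sharp (a : Dual ℝ E) (v : E) :
    fderiv ℝ (fun z => P z a) y v = -P y (flat (fderiv ℝ σ y v) (P y a)) := by
  have hs := h.sharp y hy
  have interior_sharp : (fun z => interiorHom (P z a) (σ z)) =ᶠ[𝓝 y] fun _ => ι ℝ a := by
    filter_upwards [h.mem_nhds hy] with z hz
    rw [interiorHom_apply, ← ι_flat (h.sharp z hz).mem, (h.sharp z hz).flat_sharp]
  have fderiv_interior := fderiv_bilin interiorHom (h.differentiableAt_sharp hy a)
    (h.differentiableAt hy) v
  rw [interior_sharp.fderiv_eq, fderiv_const_apply, zero_apply, interiorHom_apply,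
    interiorHom_apply, ← ι_flat hs.mem, ← ι_flat (h.fderiv_mem hy v), ← map_add, eq_comm,
    ExteriorAlgebra.ι_eq_zero_iff] at fderiv_interior
  rw [← hs.sharp_flat (fderiv ℝ (fun z => P z a) y v),
    eq_neg_of_add_eq_zero_left fderiv_interior, map_neg]

theorem differentiableAt_interior_sharp (a : Dual ℝ E) {f : E → FormFibre E}
    (hf : DifferentiableAt ℝ f y) : DifferentiableAt ℝ (fun z => interior (P z a) (f z)) y :=
  differentiableAt_bilin interiorHom (h.differentiableAt_sharp hy a) hf

theorem fderiv_interior_sharp (a : Dual ℝ E) {f : E → FormFibre E}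
    (hf : DifferentiableAt ℝ f y) (v : E) :
    fderiv ℝ (fun z => interior (P z a) (f z)) y v =
      interior (P y a) (fderiv ℝ f y v) -
        interior (P y (flat (fderiv ℝ σ y v) (P y a))) (f y) := by
  refine (fderiv_bilin interiorHom (h.differentiableAt_sharp hy a) hf v).trans ?_
  rw [h.fderiv_sharp hy, interiorHom_apply, interiorHom_apply, interior_neg, LinearMap.neg_apply,
    neg_add_eq_sub]

theorem differentiableAt_contractBivector (γ : FormFibre E) :
    DifferentiableAt ℝ (fun z => contractBivector (P z) γ) y := by
  simp only [contractBivector_apply]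
  exact (DifferentiableAt.fun_sum fun i _ => differentiableAt_linearMap_comp _
    (h.differentiableAt_interior_sharp hy _ (differentiableAt_const γ))).fun_const_smul _

theorem fderiv_contractBivector (γ : FormFibre E) (v : E) :
    fderiv ℝ (fun z => contractBivector (P z) γ) y v =
      -dualLefschetz (P y) (fderiv ℝ σ y v) γ := by
  have differentiableAt_interior := fun a =>
    h.differentiableAt_interior_sharp hy a (differentiableAt_const γ)
  have differentiableAt_summand := fun i => differentiableAt_linearMap_comp
    (interior (finBasis ℝ E i)) (differentiableAt_interior ((finBasis ℝ E).coord i))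
  simp only [contractBivector_apply, dualLefschetz]
  rw [fderiv_fun_const_smul (DifferentiableAt.fun_sum fun i _ => differentiableAt_summand i),
    fderiv_fun_sum fun i _ => differentiableAt_summand i]
  simp only [smul_apply, sum_apply, fderiv_linearMap_comp _ (differentiableAt_interior _),
    h.fderiv_interior_sharp hy _ (differentiableAt_const γ), fderiv_const_apply, zero_apply,
    map_zero, zero_sub, map_neg, Finset.sum_neg_distrib, LinearMap.comp_apply, smul_neg]

theorem differentiableAt_pow (r : ℕ) : DifferentiableAt ℝ (fun z => σ z ^ r) y := by
  induction r with
  | zero => simp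
  | succ r ih =>
    simp only [pow_succ]
    exact differentiableAt_mul ih (h.differentiableAt hy)

theorem fderiv_pow (r : ℕ) (v : E) :
    fderiv ℝ (fun z => σ z ^ (r + 1)) y v = ((r : ℝ) + 1) • (fderiv ℝ σ y v * σ y ^ r) := by
  induction r with
  | zero => simp
  | succ r ih =>
    simp only [pow_succ _ (r + 1)]
    rw [fderiv_mul (h.differentiableAt_pow hy _) (h.differentiableAt hy), ih,
      ← commute_of_mem_exteriorPower_two (h.fderiv_mem hy v), smul_mul_assoc, mul_assoc,
      ← pow_succ]
    push_cast
    module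

theorem differentiableAt_liouvilleVolume : DifferentiableAt ℝ (fun z => liouvilleVolume (σ z)) y :=
  (h.differentiableAt_pow hy _).fun_const_smul _

theorem weight_liouvilleVolume (v : E) :
    weight (flat (fderiv ℝ σ y v) ∘ₗ P y) (liouvilleVolume (σ y)) =
      -(fderiv ℝ σ y v * contractBivector (P y) (liouvilleVolume (σ y))) := by
  have hs := h.sharp y hy
  have contract_mul :=
    contractBivector_two_mul hs.antisymm (h.fderiv_mem hy v) (liouvilleVolume (σ y))
  rw [hs.mul_liouvilleVolume (h.fderiv_mem hy v), map_zero] at contract_mul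
  exact eq_neg_of_add_eq_zero_right contract_mul.symm

theorem fderiv_liouvilleVolume (v : E) :
    fderiv ℝ (fun z => liouvilleVolume (σ z)) y v =
      -weight (flat (fderiv ℝ σ y v) ∘ₗ P y) (liouvilleVolume (σ y)) := by
  have hs := h.sharp y hy
  rw [h.weight_liouvilleVolume hy, neg_neg]
  unfold liouvilleVolume
  rw [fderiv_fun_const_smul (h.differentiableAt_pow hy _), smul_apply]
  have cast_half := hs.cast_finrank_half
  generalize finrank ℝ E / 2 = n at cast_half
  cases n with
  | zero => simp
  | succ r =>
    rw [h.fderiv_pow hy, map_smul, hs.contractBivector_pow, ← cast_half, mul_smul_comm,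
      mul_smul_comm]
    congr 2
    push_cast
    ring

theorem differentiableAt_symplecticStar (γ : FormFibre E) :
    DifferentiableAt ℝ (fun z => symplecticStar (P z) (σ z) γ) y := by
  induction γ using CliffordAlgebra.right_induction with
  | algebraMap r =>
    simp only [symplecticStar_algebraMap]
    exact (h.differentiableAt_liouvilleVolume hy).fun_const_smul r
  | add x x' hx hx' =>
    simp only [map_add]
    exact hx.add hx'
  | mul_ι b x hx =>
    simp only [symplecticStar_mul_ι]
    exact (h.differentiableAt_interior_sharp hy b hx).neg

theorem fderiv_symplecticStar (γ : FormFibre E) (v : E) :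
    fderiv ℝ (fun z => symplecticStar (P z) (σ z) γ) y v =
      -weight (flat (fderiv ℝ σ y v) ∘ₗ P y) (symplecticStar (P y) (σ y) γ) := by
  have differentiableAt := h.differentiableAt_symplecticStar hy
  induction γ using CliffordAlgebra.right_induction with
  | algebraMap r =>
    simp only [symplecticStar_algebraMap]
    rw [fderiv_fun_const_smul (h.differentiableAt_liouvilleVolume hy), smul_apply,
      h.fderiv_liouvilleVolume hy, map_smul, smul_neg]
  | add x x' hx hx' =>
    simp only [map_add]
    rw [fderiv_fun_add (differentiableAt x) (differentiableAt x'), add_apply, hx, hx', neg_add]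
  | mul_ι b x hx =>
    simp only [symplecticStar_mul_ι]
    rw [fderiv_fun_neg, neg_apply, h.fderiv_interior_sharp hy b (differentiableAt x), hx, map_neg,
      map_neg, (h.sharp y hy).interior_weight (h.fderiv_mem hy v)]
    abel

theorem adjoint_extd :
    adjoint (dualForm (P y)) (LinearMap.mulLeft ℝ (extd σ y)) =
      ∑ i, dualLefschetz (P y) (fderiv ℝ σ y (finBasis ℝ E i)) *
        interior (P y ((finBasis ℝ E).coord i)) := by
  have hs := h.sharp y hy
  have mulLeft_extd : LinearMap.mulLeft ℝ (extd σ y) = ∑ i, LinearMap.mulLeft ℝ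
      (ι ℝ ((finBasis ℝ E).coord i) * fderiv ℝ σ y (finBasis ℝ E i)) := LinearMap.ext fun β => by
    simp [extd_apply, Finset.sum_mul, mul_assoc]
  rw [mulLeft_extd, adjoint_sum hs.surjective_dualForm]
  exact Finset.sum_congr rfl fun i _ => hs.adjoint_ι_mul (h.fderiv_mem hy _) _

variable {f : E → FormFibre E} (hf : DifferentiableAt ℝ f y)
include hf

theorem fderiv_contractBivector_apply (v : E) :
    fderiv ℝ (fun z => contractBivector (P z) (f z)) y v =
      contractBivector (P y) (fderiv ℝ f y v) -
        dualLefschetz (P y) (fderiv ℝ σ y v) (f y) := by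
  rw [fderiv_linearMap_apply (h.differentiableAt_contractBivector hy) hf,
    h.fderiv_contractBivector hy, sub_eq_add_neg]

theorem contractBivector_extd_sub :
    contractBivector (P y) (extd f y) - extd (fun z => contractBivector (P z) (f z)) y =
      ∑ i, (ι ℝ ((finBasis ℝ E).coord i) *
          dualLefschetz (P y) (fderiv ℝ σ y (finBasis ℝ E i)) (f y) -
        interior (P y ((finBasis ℝ E).coord i)) (fderiv ℝ f y (finBasis ℝ E i))) := by
  simp only [extd_apply, map_sum, h.fderiv_contractBivector_apply hy hf,
    contractBivector_ι_mul (h.sharp y hy).antisymm, ← Finset.sum_sub_distrib]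
  exact Finset.sum_congr rfl fun i _ => by rw [mul_sub]; abel

theorem differentiableAt_contractBivector_apply :
    DifferentiableAt ℝ (fun z => contractBivector (P z) (f z)) y :=
  differentiableAt_linearMap_apply (h.differentiableAt_contractBivector hy) hf

theorem contractBivector_commutator_extd :
    contractBivector (P y)
          (contractBivector (P y) (extd f y) - extd (fun z => contractBivector (P z) (f z)) y) -
        (contractBivector (P y) (extd (fun z => contractBivector (P z) (f z)) y) -
          extd (fun z => contractBivector (P z) (contractBivector (P z) (f z))) y) =
      (-2 : ℝ) • adjoint (dualForm (P y)) (LinearMap.mulLeft ℝ (extd σ y)) (f y) := by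
  have antisymm := (h.sharp y hy).antisymm
  rw [h.contractBivector_extd_sub hy hf,
    h.contractBivector_extd_sub hy (h.differentiableAt_contractBivector_apply hy hf),
    h.adjoint_extd hy, map_sum, ← Finset.sum_sub_distrib, LinearMap.sum_apply, Finset.smul_sum]
  refine Finset.sum_congr rfl fun i _ => ?_
  simp only [h.fderiv_contractBivector_apply hy hf, dualLefschetz, map_sub,
    contractBivector_ι_mul antisymm, Module.End.mul_apply, interior_contractBivector,
    contractBivector_comm (P y) (P y ∘ₗ _)]
  module

theorem fderiv_symplecticStar_parity (v : E) :
    fderiv ℝ (fun z => symplecticStar (P z) (σ z) (parity (f z))) y v =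
      symplecticStar (P y) (σ y) (parity (fderiv ℝ f y v)) -
        weight (flat (fderiv ℝ σ y v) ∘ₗ P y) (symplecticStar (P y) (σ y) (parity (f y))) := by
  have differentiableAt_parity : DifferentiableAt ℝ (fun z => parity (f z)) y :=
    differentiableAt_linearMap_comp parity.toLinearMap hf
  have fderiv_parity : fderiv ℝ (fun z => parity (f z)) y v = parity (fderiv ℝ f y v) :=
    fderiv_linearMap_comp parity.toLinearMap hf v
  rw [fderiv_linearMap_apply (h.differentiableAt_symplecticStar hy) differentiableAt_parity,
    h.fderiv_symplecticStar hy, fderiv_parity, sub_eq_add_neg]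

theorem symplecticStar_extd_symplecticStar :
    symplecticStar (P y) (σ y) (extd (fun z => symplecticStar (P z) (σ z) (parity (f z))) y) =
      contractBivector (P y) (extd f y) - extd (fun z => contractBivector (P z) (f z)) y -
        adjoint (dualForm (P y)) (contractBivector (P y) * LinearMap.mulLeft ℝ (extd σ y) -
          LinearMap.mulLeft ℝ (extd σ y) * contractBivector (P y)) (f y) := by
  have hs := h.sharp y hy
  have commutator_eq : contractBivector (P y) * LinearMap.mulLeft ℝ (extd σ y) -
      LinearMap.mulLeft ℝ (extd σ y) * contractBivector (P y) =
      ∑ i, (contractBivector (P y) * LinearMap.mulLeft ℝ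
        (ι ℝ ((finBasis ℝ E).coord i) * fderiv ℝ σ y (finBasis ℝ E i)) - LinearMap.mulLeft ℝ
        (ι ℝ ((finBasis ℝ E).coord i) * fderiv ℝ σ y (finBasis ℝ E i)) *
          contractBivector (P y)) :=
    LinearMap.ext fun β => by
      simp [extd_apply, Finset.sum_mul, Finset.sum_sub_distrib, Module.End.mul_apply, mul_assoc]
  rw [h.contractBivector_extd_sub hy hf, commutator_eq, adjoint_sum hs.surjective_dualForm,
    LinearMap.sum_apply, ← Finset.sum_sub_distrib, extd_apply, map_sum]
  refine Finset.sum_congr rfl fun i _ => ?_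
  rw [h.fderiv_symplecticStar_parity hy hf, mul_sub, map_sub,
    hs.symplecticStar_ι_mul_symplecticStar, hs.symplecticStar_ι_mul_weight (h.fderiv_mem hy _),
    sub_right_comm, hs.ι_mul_dualLefschetz_sub_adjoint (h.fderiv_mem hy _)]
  abel

end SharpFamily

end FormFibre

section Charts

open FormFibre

variable {E : Type*} [NormedAddCommGroup E] [NormedSpace ℝ E]
  {M : Type*} [TopologicalSpace M] [ChartedSpace E M]

/-! ### Forms in charts -/

variable (E) in
/-- The coordinate change from the chart at `x` to the chart at `q`. -/
def transition (x q : M) : E → E :=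
  extChartAt 𝓘(ℝ, E) q ∘ (extChartAt 𝓘(ℝ, E) x).symm

variable {x p q : M} {y : E}

theorem eventually_mem_overlap (hy : y ∈ (extChartAt 𝓘(ℝ, E) x).target)
    (hq : (extChartAt 𝓘(ℝ, E) x).symm y ∈ (extChartAt 𝓘(ℝ, E) q).source) :
    ∀ᶠ z in 𝓝 y, z ∈ (extChartAt 𝓘(ℝ, E) x).target ∧
      (extChartAt 𝓘(ℝ, E) x).symm z ∈ (extChartAt 𝓘(ℝ, E) q).source :=
  Filter.Eventually.and (extChartAt_target_mem_nhds' hy)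
    ((continuousAt_extChartAt_symm'' hy).eventually_mem
      ((isOpen_extChartAt_source q).mem_nhds hq))

theorem extChartAt_symm_transition
    (hq : (extChartAt 𝓘(ℝ, E) x).symm y ∈ (extChartAt 𝓘(ℝ, E) q).source) :
    (extChartAt 𝓘(ℝ, E) q).symm (transition E x q y) = (extChartAt 𝓘(ℝ, E) x).symm y :=
  (extChartAt 𝓘(ℝ, E) q).left_inv hq

theorem transition_mem_target
    (hq : (extChartAt 𝓘(ℝ, E) x).symm y ∈ (extChartAt 𝓘(ℝ, E) q).source) :
    transition E x q y ∈ (extChartAt 𝓘(ℝ, E) q).target :=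
  (extChartAt 𝓘(ℝ, E) q).map_source hq

theorem transition_transition (hy : y ∈ (extChartAt 𝓘(ℝ, E) x).target)
    (hq : (extChartAt 𝓘(ℝ, E) x).symm y ∈ (extChartAt 𝓘(ℝ, E) q).source) :
    transition E q x (transition E x q y) = y :=
  (congrArg (extChartAt 𝓘(ℝ, E) x) (extChartAt_symm_transition hq)).trans
    ((extChartAt 𝓘(ℝ, E) x).right_inv hy)

theorem fderiv_transition_self (hy : y ∈ (extChartAt 𝓘(ℝ, E) x).target) :
    fderiv ℝ (transition E x x) y = ContinuousLinearMap.id ℝ E := by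
  have transition_eq_id : transition E x x =ᶠ[𝓝 y] id := by
    filter_upwards [extChartAt_target_mem_nhds' hy] with z hz
    exact (extChartAt 𝓘(ℝ, E) x).right_inv hz
  rw [transition_eq_id.fderiv_eq, fderiv_id]

section IsManifold

variable [IsManifold 𝓘(ℝ, E) ∞ M]

theorem contDiffAt_transition (hy : y ∈ (extChartAt 𝓘(ℝ, E) x).target)
    (hq : (extChartAt 𝓘(ℝ, E) x).symm y ∈ (extChartAt 𝓘(ℝ, E) q).source) :
    ContDiffAt ℝ ∞ (transition E x q) y := by
  have contDiffWithinAt := contDiffWithinAt_ext_coord_change (I := 𝓘(ℝ, E)) (n := ∞) q x (y := y)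
    (by rw [PartialEquiv.trans_source]; exact ⟨hy, hq⟩)
  rwa [ModelWithCorners.range_eq_univ, contDiffWithinAt_univ] at contDiffWithinAt

theorem fderiv_transition_comp (hy : y ∈ (extChartAt 𝓘(ℝ, E) x).target)
    (hp : (extChartAt 𝓘(ℝ, E) x).symm y ∈ (extChartAt 𝓘(ℝ, E) p).source)
    (hq : (extChartAt 𝓘(ℝ, E) x).symm y ∈ (extChartAt 𝓘(ℝ, E) q).source) :
    fderiv ℝ (transition E x q) y =
      (fderiv ℝ (transition E p q) (transition E x p y)).comp (fderiv ℝ (transition E x p) y) := by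
  have transition_eq_comp :
      transition E x q =ᶠ[𝓝 y] transition E p q ∘ transition E x p := by
    filter_upwards [eventually_mem_overlap hy hp] with z hz
    exact congrArg (extChartAt 𝓘(ℝ, E) q) (extChartAt_symm_transition hz.2).symm
  rw [transition_eq_comp.fderiv_eq]
  refine fderiv_comp y ?_ ?_
  · refine (contDiffAt_transition (transition_mem_target hp) ?_).differentiableAt (by simp)
    rwa [extChartAt_symm_transition hp]
  · exact (contDiffAt_transition hy hp).differentiableAt (by simp)

theorem fderiv_transition_leftInverse (hy : y ∈ (extChartAt 𝓘(ℝ, E) x).target)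
    (hq : (extChartAt 𝓘(ℝ, E) x).symm y ∈ (extChartAt 𝓘(ℝ, E) q).source) :
    Function.LeftInverse (fderiv ℝ (transition E q x) (transition E x q y))
      (fderiv ℝ (transition E x q) y) := fun v => by
  have comp_eq := fderiv_transition_comp hy hq ((extChartAt 𝓘(ℝ, E) x).map_target hy)
  rw [fderiv_transition_self hy] at comp_eq
  exact (DFunLike.congr_fun comp_eq v).symm

theorem fderiv_transition_rightInverse (hy : y ∈ (extChartAt 𝓘(ℝ, E) x).target)
    (hq : (extChartAt 𝓘(ℝ, E) x).symm y ∈ (extChartAt 𝓘(ℝ, E) q).source) :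
    Function.RightInverse (fderiv ℝ (transition E q x) (transition E x q y))
      (fderiv ℝ (transition E x q) y) := by
  have left_inverse := fderiv_transition_leftInverse (q := x) (transition_mem_target hq)
    (by rw [extChartAt_symm_transition hq]; exact (extChartAt 𝓘(ℝ, E) x).map_target hy)
  rwa [transition_transition hy hq] at left_inverse

theorem surjective_fderiv_transition (hy : y ∈ (extChartAt 𝓘(ℝ, E) x).target) :
    Function.Surjective
      (fderiv ℝ (transition E x ((extChartAt 𝓘(ℝ, E) x).symm y)) y).toLinearMap :=
  (fderiv_transition_rightInverse hy (mem_extChartAt_source _)).surjective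

end IsManifold

namespace FormSection

theorem inChart_apply (x : M) (α : FormSection E M) (y : E) :
    α.inChart x y = pullback
      (fderiv ℝ (transition E x ((extChartAt 𝓘(ℝ, E) x).symm y)) y).toLinearMap
      (α ((extChartAt 𝓘(ℝ, E) x).symm y)) := rfl

theorem inChart_self (x : M) (α : FormSection E M) :
    α.inChart x (extChartAt 𝓘(ℝ, E) x x) = α x := by
  rw [inChart_apply, extChartAt_to_inv x, fderiv_transition_self (mem_extChartAt_target x)]
  exact pullback_id _

theorem inChart_eq_pullback [IsManifold 𝓘(ℝ, E) ∞ M]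
    (hy : y ∈ (extChartAt 𝓘(ℝ, E) x).target)
    (hp : (extChartAt 𝓘(ℝ, E) x).symm y ∈ (extChartAt 𝓘(ℝ, E) p).source) (α : FormSection E M) :
    α.inChart x y = pullback (fderiv ℝ (transition E x p) y).toLinearMap
      (α.inChart p (transition E x p y)) := by
  rw [inChart_apply, inChart_apply, extChartAt_symm_transition hp, pullback_pullback,
    fderiv_transition_comp hy hp (mem_extChartAt_source _)]
  rfl

variable [FiniteDimensional ℝ E]

theorem d_apply (α : FormSection E M) (x : M) :
    α.d x = extd (α.inChart x) (extChartAt 𝓘(ℝ, E) x x) :=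
  (extd_apply _ _).symm

variable {α : FormSection E M}

theorem IsSmooth.contDiffAt (hα : α.IsSmooth) (hy : y ∈ (extChartAt 𝓘(ℝ, E) x).target) :
    ContDiffAt ℝ ∞ (α.inChart x) y :=
  (hα x).contDiffAt (extChartAt_target_mem_nhds' hy)

theorem IsSmooth.differentiableAt (hα : α.IsSmooth) (hy : y ∈ (extChartAt 𝓘(ℝ, E) x).target) :
    DifferentiableAt ℝ (α.inChart x) y :=
  (hα.contDiffAt hy).differentiableAt (by simp)

variable [IsManifold 𝓘(ℝ, E) ∞ M]

theorem IsSmooth.inChart_d (hα : α.IsSmooth) (hy : y ∈ (extChartAt 𝓘(ℝ, E) x).target) :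
    α.d.inChart x y = extd (α.inChart x) y := by
  have hp := mem_extChartAt_source (I := 𝓘(ℝ, E)) ((extChartAt 𝓘(ℝ, E) x).symm y)
  rw [inChart_apply, d_apply, extd_congr (y := y)
    ((eventually_mem_overlap hy hp).mono fun z hz => inChart_eq_pullback hz.1 hz.2 α)]
  exact (extd_pullback
    ((contDiffAt_transition hy hp).of_le (WithTop.coe_le_coe.mpr le_top))
    (hα.differentiableAt (transition_mem_target hp))).symm

theorem IsSmooth.d (hα : α.IsSmooth) : α.d.IsSmooth := fun x =>
  (contDiffOn_linearMap_comp antisymmetrize ((hα x).fderiv_of_isOpen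
    (isOpen_extChartAt_target x) (by simp))).congr fun _ hy => hα.inChart_d hy

theorem IsSmooth.d_d (hα : α.IsSmooth) : α.d.d = 0 := by
  funext x
  have inChart_d_eq : α.d.inChart x =ᶠ[𝓝 (extChartAt 𝓘(ℝ, E) x x)] extd (α.inChart x) := by
    filter_upwards [extChartAt_target_mem_nhds (I := 𝓘(ℝ, E)) x] with y hy
    exact hα.inChart_d hy
  rw [d_apply, extd_congr inChart_d_eq, extd_extd
    ((hα.contDiffAt (mem_extChartAt_target x)).of_le (WithTop.coe_le_coe.mpr le_top)),
    Pi.zero_apply]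

end FormSection

end Charts

section AlmostSymplecticOperators

variable {E : Type*} [NormedAddCommGroup E] [NormedSpace ℝ E] [FiniteDimensional ℝ E]

/-! ### The operators of an almost symplectic manifold -/

namespace FormFibre

open Classical in
/-- The inverse of `v ↦ σ(v, ·)` for a nondegenerate `2`-form `σ`, and zero otherwise. -/
def sharp (σ : FormFibre E) : Dual ℝ E →ₗ[ℝ] E :=
  if h : Function.Bijective (flat σ) then (LinearEquiv.ofBijective (flat σ) h).symm else 0

theorem isSharp_sharp {σ : FormFibre E} (hσ : σ ∈ ⋀[ℝ]^2 (Dual ℝ E))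
    (h : Function.Bijective (flat σ)) : IsSharp σ (sharp σ) where
  mem := hσ
  sharp_flat v := by
    rw [sharp, dif_pos h]
    exact (LinearEquiv.ofBijective (flat σ) h).symm_apply_apply v
  flat_sharp a := by
    rw [sharp, dif_pos h]
    exact (LinearEquiv.ofBijective (flat σ) h).apply_symm_apply a

theorem IsSharp.isSharp_sharp {σ : FormFibre E} {P : Dual ℝ E →ₗ[ℝ] E} (h : IsSharp σ P) :
    IsSharp σ (sharp σ) :=
  FormFibre.isSharp_sharp h.mem ⟨Function.LeftInverse.injective h.sharp_flat,
    Function.RightInverse.surjective h.flat_sharp⟩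

end FormFibre

open FormFibre

namespace AlmostSymplectic

variable {M : Type*} [TopologicalSpace M] [ChartedSpace E M] (S : AlmostSymplectic E M)

theorem isSharp (x : M) : IsSharp (S.form x) (sharp (S.form x)) :=
  isSharp_sharp (S.degree_two x) (S.nondegenerate x)

theorem inverse_eq (x : M) : S.inverse x = dualForm (sharp (S.form x)) := by
  rw [inverse, inverseForm, dualForm, sharp, dif_pos (S.nondegenerate x)]

theorem starω_eq (x : M) : S.starω x = symplecticStar (sharp (S.form x)) (S.form x) := by
  rw [starω, inverse_eq]
  exact (S.isSharp x).star_eq_symplecticStar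

theorem adjointω_eq (x : M) : S.adjointω x = adjoint (dualForm (sharp (S.form x))) := by
  funext φ
  rw [adjointω, inverse_eq]

theorem Lam_eq (x : M) : S.Lam x = contractBivector (sharp (S.form x)) := by
  rw [Lam, adjointω_eq, L, (S.isSharp x).adjoint_mulLeft (S.degree_two x),
    (S.isSharp x).dualLefschetz_self]

theorem contractPoisson_apply (α : FormSection E M) (x : M) :
    S.contractPoisson α x = contractBivector (sharp (S.form x)) (α x) := by
  rw [contractPoisson, contractBivector_apply]
  congr 1
  refine Finset.sum_congr rfl fun i _ => ?_
  rw [← LinearMap.congr_fun (congrArg FormFibre.interior (sum_coord_smul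
    (sharp (S.form x) ((finBasis ℝ E).coord i)))) (α x), FormFibre.interior_sum]
  simp only [LinearMap.sum_apply, map_sum, FormFibre.interior_smul, LinearMap.smul_apply, map_smul,
    inverse_eq, dualForm_apply]

theorem dω_apply (α : FormSection E M) (x : M) :
    S.dω α x = symplecticStar (sharp (S.form x)) (S.form x) (FormSection.d (fun y =>
      symplecticStar (sharp (S.form y)) (S.form y) (parity (α y))) x) := by
  simp only [dω, starω_eq]

variable [IsManifold 𝓘(ℝ, E) ∞ M] {x : M} {y : E} (α : FormSection E M)

theorem isSharp_inChart (hy : y ∈ (extChartAt 𝓘(ℝ, E) x).target) :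
    IsSharp (S.form.inChart x y) (sharp (S.form.inChart x y)) :=
  have hq := mem_extChartAt_source (I := 𝓘(ℝ, E)) ((extChartAt 𝓘(ℝ, E) x).symm y)
  ((S.isSharp _).of_pullback (B := (fderiv ℝ (transition E _ x) _).toLinearMap)
    (fderiv_transition_rightInverse hy hq) (fderiv_transition_leftInverse hy hq)).isSharp_sharp

theorem sharpFamily (x : M) : SharpFamily (extChartAt 𝓘(ℝ, E) x).target (S.form.inChart x)
    (fun y => sharp (S.form.inChart x y)) where
  isOpen := isOpen_extChartAt_target x
  smooth := S.smooth x
  sharp _ hz := S.isSharp_inChart hz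

theorem inChart_contractPoisson (hy : y ∈ (extChartAt 𝓘(ℝ, E) x).target) :
    (S.contractPoisson α).inChart x y =
      contractBivector (sharp (S.form.inChart x y)) (α.inChart x y) := by
  rw [FormSection.inChart_apply, contractPoisson_apply]
  exact ((S.isSharp _).contractBivector_pullback (surjective_fderiv_transition hy)
    (S.isSharp_inChart hy) _).symm

theorem inChart_symplecticStar (hy : y ∈ (extChartAt 𝓘(ℝ, E) x).target) :
    FormSection.inChart x
        (fun p => symplecticStar (sharp (S.form p)) (S.form p) (parity (α p))) y =
      symplecticStar (sharp (S.form.inChart x y)) (S.form.inChart x y)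
        (parity (α.inChart x y)) := by
  rw [FormSection.inChart_apply, FormSection.inChart_apply x α, ← pullback_parity]
  exact ((S.isSharp _).symplecticStar_pullback (surjective_fderiv_transition hy)
    (S.isSharp_inChart hy) _).symm

theorem d_contractPoisson (x : M) : (S.contractPoisson α).d x =
    extd (fun z => contractBivector (sharp (S.form.inChart x z)) (α.inChart x z))
      (extChartAt 𝓘(ℝ, E) x x) := by
  rw [FormSection.d_apply]
  refine extd_congr ?_
  filter_upwards [extChartAt_target_mem_nhds (I := 𝓘(ℝ, E)) x] with z hz
  exact S.inChart_contractPoisson α hz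

theorem d_contractPoisson_contractPoisson (x : M) :
    (S.contractPoisson (S.contractPoisson α)).d x =
      extd (fun z => contractBivector (sharp (S.form.inChart x z))
        (contractBivector (sharp (S.form.inChart x z)) (α.inChart x z)))
        (extChartAt 𝓘(ℝ, E) x x) := by
  rw [d_contractPoisson]
  refine extd_congr ?_
  filter_upwards [extChartAt_target_mem_nhds (I := 𝓘(ℝ, E)) x] with z hz
  rw [S.inChart_contractPoisson α hz]

theorem d_symplecticStar (x : M) :
    FormSection.d (fun p => symplecticStar (sharp (S.form p)) (S.form p) (parity (α p))) x =
      extd (fun z => symplecticStar (sharp (S.form.inChart x z)) (S.form.inChart x z)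
        (parity (α.inChart x z))) (extChartAt 𝓘(ℝ, E) x x) := by
  rw [FormSection.d_apply]
  refine extd_congr ?_
  filter_upwards [extChartAt_target_mem_nhds (I := 𝓘(ℝ, E)) x] with z hz
  exact S.inChart_symplecticStar α hz

variable {α} (hα : α.IsSmooth)
include hα

theorem isSmooth_contractPoisson : (S.contractPoisson α).IsSmooth := fun x =>
  ((S.sharpFamily x).contDiffOn_contractBivector (hα x)).congr fun _ hy =>
    S.inChart_contractPoisson α hy

theorem dω_add_LamdLω :
    S.dω α + S.LamdLω α = S.contractPoisson α.d - (S.contractPoisson α).d := by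
  funext x
  have hx := mem_extChartAt_target (I := 𝓘(ℝ, E)) x
  have adjoint_d := (S.sharpFamily x).symplecticStar_extd_symplecticStar hx
    (hα.differentiableAt hx)
  simp only [← S.d_symplecticStar, ← S.d_contractPoisson, FormSection.inChart_self,
    ← FormSection.d_apply] at adjoint_d
  simp only [Pi.add_apply, Pi.sub_apply, dω_apply, adjoint_d, contractPoisson_apply, LamdLω, LamdL,
    Lam_eq, dL, adjointω_eq, sub_add_cancel]

theorem contractPoisson_commutator :
    S.contractPoisson (S.contractPoisson α.d - (S.contractPoisson α).d) -
      (S.contractPoisson (S.contractPoisson α).d -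
        (S.contractPoisson (S.contractPoisson α)).d) = (-2 : ℝ) • S.dLω α := by
  funext x
  have hx := mem_extChartAt_target (I := 𝓘(ℝ, E)) x
  have commutator_d := (S.sharpFamily x).contractBivector_commutator_extd hx
    (hα.differentiableAt hx)
  simp only [← S.d_contractPoisson_contractPoisson, ← S.d_contractPoisson,
    FormSection.inChart_self, ← FormSection.d_apply] at commutator_d
  simpa only [Pi.sub_apply, Pi.smul_apply, contractPoisson_apply, dLω, dL, adjointω_eq]
    using commutator_d

end AlmostSymplectic

end AlmostSymplecticOperators

section AlmostHermitianOperators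

open FormFibre

variable {E : Type*} [NormedAddCommGroup E] [NormedSpace ℝ E] [FiniteDimensional ℝ E]
  {M : Type*} [TopologicalSpace M] [ChartedSpace E M]

theorem FormSection.IsSmooth.d_mem {α : FormSection E M} (hα : α.IsSmooth) {k : ℕ}
    (hk : ∀ x, α x ∈ ⋀[ℝ]^k (Dual ℝ E)) (x : M) : α.d x ∈ ⋀[ℝ]^(k + 1) (Dual ℝ E) := by
  rw [FormSection.d_apply, extd_apply]
  refine Submodule.sum_mem _ fun i _ => ι_mul_mem_exteriorPower _ ?_
  exact fderiv_mem_of_eventually (hα.differentiableAt (mem_extChartAt_target x)) _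
    (Filter.Eventually.of_forall fun y => pullback_mem _ (hk _)) _

variable [IsManifold 𝓘(ℝ, E) ∞ M]

namespace AlmostHermitian

variable (H : AlmostHermitian E M)

theorem isCompatible (x : M) : IsCompatible (H.form x) (H.Jlin x) where
  sq := H.J_sq x
  symm := H.symm x

theorem inverseMetric_eq (x : M) :
    H.inverseMetric x = dualForm (H.Jlin x ∘ₗ sharp (H.form x)) := by
  have hs := H.isSharp x
  rw [inverseMetric, inverseForm, dualForm]
  congr 1
  refine LinearMap.ext fun a => ?_
  rw [LinearEquiv.coe_coe, LinearEquiv.symm_apply_eq]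
  refine LinearMap.ext fun w => ?_
  have flat_J_sharp := flat_pullback (H.Jlin x) hs.mem (sharp (H.form x) a)
  rw [(H.isCompatible x).pullback_form hs, hs.flat_sharp] at flat_J_sharp
  exact LinearMap.congr_fun flat_J_sharp w

theorem hodgeStar_eq (x : M) : H.hodgeStar x =
    symplecticStar (sharp (H.form x)) (H.form x) * (pullback (H.Jlin x)).toLinearMap := by
  rw [hodgeStar, inverseMetric_eq]
  exact (H.isSharp x).star_dualForm_comp (H.Jlin x)

theorem adjoint_eq (x : M) :
    H.adjoint x = FormFibre.adjoint (dualForm (H.Jlin x ∘ₗ sharp (H.form x))) := by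
  funext φ
  rw [adjoint, inverseMetric_eq]

theorem metricLam_eq (x : M) : H.metricLam x = contractBivector (sharp (H.form x)) := by
  rw [metricLam, adjoint_eq]
  exact (H.isCompatible x).adjoint_metric_mulLeft (H.isSharp x)

theorem torsion_eq (x : M) : H.torsion x = H.LamdL x := by
  rw [torsion, metricLam_eq, AlmostSymplectic.LamdL, AlmostSymplectic.Lam_eq]
  rfl

theorem Jform_hodgeStar (x : M) (φ : FormFibre E) : H.Jform x (H.hodgeStar x φ) =
    symplecticStar (sharp (H.form x)) (H.form x) (parity φ) := by
  rw [hodgeStar_eq, Jform, Module.End.mul_apply, AlgHom.toLinearMap_apply,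
    AlgHom.toLinearMap_apply, ← (H.isCompatible x).symplecticStar_pullback (H.isSharp x),
    (H.isCompatible x).pullback_sq]

theorem dcStar_eq (α : FormSection E M) : H.dcStar α = -H.dω α := by
  funext x
  simp only [dcStar, dc, Jform_hodgeStar]
  rw [hodgeStar_eq, Pi.neg_apply, AlmostSymplectic.dω_apply, JformInv,
    Module.End.mul_apply, AlgHom.toLinearMap_apply, AlgHom.toLinearMap_apply,
    (H.isCompatible x).pullback_pullback_neg]

theorem d_form_mul_parity (x : M) (β : FormFibre E) :
    H.form.d x * parity β = -parity (H.form.d x * β) := by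
  rw [map_mul, parity_of_mem (H.smooth.d_mem H.degree_two x)]
  norm_num

theorem torsion_parity (x : M) (β : FormFibre E) :
    H.torsion x (parity β) = -parity (H.torsion x β) := by
  simp only [torsion, metricLam_eq, LinearMap.sub_apply, Module.End.mul_apply,
    LinearMap.mulLeft_apply, contractBivector_parity, H.d_form_mul_parity, map_neg, map_sub]
  abel

theorem dωcStar_eq (α : FormSection E M) : H.dωcStar α = -H.dLω α := by
  funext x
  rw [dωcStar, adjoint_eq, JformInv, Jform,
    (H.isCompatible x).adjoint_metric_conj (H.isSharp x) (H.d_form_mul_parity x),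
    ← AlmostSymplectic.adjointω_eq]
  rfl

theorem TcStar_eq (α : FormSection E M) : H.TcStar α = -H.LamdLω α := by
  funext x
  rw [TcStar, adjoint_eq, JformInv, Jform,
    (H.isCompatible x).adjoint_metric_conj (H.isSharp x) (H.torsion_parity x),
    ← AlmostSymplectic.adjointω_eq, torsion_eq]
  rfl

theorem hermitianΔ_eq (n : ℕ) (α : FormSection E M) :
    H.hermitianΔ n α = H.toAlmostSymplectic.Δ n α := by
  match n with
  | 0 => rfl
  | 1 => simp only [hermitianΔ, AlmostSymplectic.Δ, dcStar_eq, TcStar_eq]; abel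
  | 2 => simp only [hermitianΔ, AlmostSymplectic.Δ, dωcStar_eq]
  | n + 3 => rfl

end AlmostHermitian

end AlmostHermitianOperators

/-! ### The de Rham algebra -/

section DeRhamAlgebra

namespace FormFibre

variable {E : Type*} [NormedAddCommGroup E] [NormedSpace ℝ E] [FiniteDimensional ℝ E]

theorem deg_cases {k : ℤ} {x : FormFibre E} (hx : x ∈ deg k) :
    x = 0 ∨ ∃ n : ℕ, k = n ∧ x ∈ ⋀[ℝ]^n (Dual ℝ E) := by
  match k with
  | Int.ofNat n => exact Or.inr ⟨n, rfl, hx⟩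
  | Int.negSucc n => exact Or.inl hx

theorem parity_of_mem_deg {k : ℤ} {x : FormFibre E} (hx : x ∈ deg k) :
    parity x = (-1 : ℝ) ^ k • x := by
  obtain rfl | ⟨n, rfl, hxn⟩ := deg_cases hx
  · simp
  · rw [parity_of_mem hxn, zpow_natCast]

theorem mul_mem_deg_add {j k : ℤ} {x y : FormFibre E} (hx : x ∈ deg j) (hy : y ∈ deg k) :
    x * y ∈ deg (j + k) := by
  obtain rfl | ⟨n, rfl, hxn⟩ := deg_cases hx
  · rw [zero_mul]
    exact zero_mem _
  obtain rfl | ⟨m, rfl, hym⟩ := deg_cases hy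
  · rw [mul_zero]
    exact zero_mem _
  exact mul_mem_exteriorPower hxn hym

theorem deg_comm {j k : ℤ} {x y : FormFibre E} (hx : x ∈ deg j) (hy : y ∈ deg k) :
    x * y = (-1 : ℝ) ^ (j * k) • (y * x) := by
  obtain rfl | ⟨n, rfl, hxn⟩ := deg_cases hx
  · simp
  obtain rfl | ⟨m, rfl, hym⟩ := deg_cases hy
  · simp
  rw [mul_comm_of_mem_exteriorPower hxn hym]
  norm_cast

theorem interior_mem_deg (v : E) {k : ℤ} {x : FormFibre E} (hx : x ∈ deg k) :
    interior v x ∈ deg (k + -1) := by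
  obtain rfl | ⟨n, rfl, hxn⟩ := deg_cases hx
  · rw [map_zero]
    exact zero_mem _
  cases n with
  | zero =>
    rw [interior, contractLeft_of_mem_exteriorPower_zero _ hxn]
    exact zero_mem _
  | succ n =>
    rw [Nat.cast_succ, add_neg_cancel_right]
    exact interior_mem v hxn

theorem hasOrderLE_interior (v : E) : HasOrderLE (deg (E := E)) 1 (-1) (interior v) := by
  refine .of_leibniz (fun j a ha => interior_mem_deg v ha) fun j a ha b => ?_
  rw [interior_mul, parity_of_mem_deg ha, smul_mul_assoc, mul_neg_one, zpow_neg,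
    ← inv_zpow, inv_neg, inv_one]

theorem hasOrderLE_contractBivector (Q : Dual ℝ E →ₗ[ℝ] E) :
    HasOrderLE (deg (E := E)) 2 (-2) (contractBivector Q) :=
  .smul (.sum _ fun _ => .mul (fun _ _ _ ha _ hb => mul_mem_deg_add ha hb)
    (fun _ _ _ ha _ hb => deg_comm ha hb) (hasOrderLE_interior _) (hasOrderLE_interior _)) _

/-- The projection to the component of degree `k`. -/
def proj (k : ℕ) : End ℝ (FormFibre E) :=
  GradedAlgebra.proj (fun i : ℕ => ⋀[ℝ]^i (Dual ℝ E)) k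

theorem proj_mem (k : ℕ) (x : FormFibre E) : proj k x ∈ ⋀[ℝ]^k (Dual ℝ E) :=
  (DirectSum.decompose (fun i : ℕ => ⋀[ℝ]^i (Dual ℝ E)) x k).2

theorem proj_of_mem {k n : ℕ} {x : FormFibre E} (hx : x ∈ ⋀[ℝ]^n (Dual ℝ E)) :
    proj k x = if k = n then x else 0 := by
  rw [proj, GradedAlgebra.proj_apply]
  split_ifs with hkn
  · subst hkn
    exact DirectSum.decompose_of_mem_same _ hx
  · exact DirectSum.decompose_of_mem_ne _ hx (Ne.symm hkn)

theorem sum_proj (x : FormFibre E) : ∑ k ∈ Finset.range (finrank ℝ E + 1), proj k x = x := by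
  rw [← Subspace.dual_finrank_eq (K := ℝ) (V := E)]
  exact sum_decompose_exteriorPower x

theorem proj_pullback (A : E →ₗ[ℝ] E) (k : ℕ) (x : FormFibre E) :
    proj k (pullback A x) = pullback A (proj k x) := by
  have comp_eq : proj k ∘ₗ (pullback A).toLinearMap = (pullback A).toLinearMap ∘ₗ proj k := by
    refine exteriorAlgebra_linearMap_ext fun n _ x hx => ?_
    simp only [LinearMap.comp_apply, AlgHom.toLinearMap_apply, proj_of_mem hx,
      proj_of_mem (pullback_mem A hx)]
    split_ifs <;> simp only [map_zero]
  exact LinearMap.congr_fun comp_eq x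

end FormFibre

open FormFibre

variable {E : Type*} [NormedAddCommGroup E] [NormedSpace ℝ E]
  {M : Type*} [TopologicalSpace M] [ChartedSpace E M]

namespace FormSection

theorem inChart_add (x : M) (α β : FormSection E M) :
    (α + β).inChart x = fun y => α.inChart x y + β.inChart x y := by
  funext y
  simp [inChart]

theorem inChart_smul (x : M) (r : ℝ) (α : FormSection E M) :
    FormSection.inChart x (r • α) = fun y => r • α.inChart x y := by
  funext y
  simp [inChart]

theorem inChart_mul (x : M) (α β : FormSection E M) :
    FormSection.inChart x (α * β) = fun y => α.inChart x y * β.inChart x y := by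
  funext y
  simp [inChart]

variable [FiniteDimensional ℝ E] {α β : FormSection E M}

theorem IsSmooth.d_add (hα : α.IsSmooth) (hβ : β.IsSmooth) :
    FormSection.d (α + β) = α.d + β.d := by
  funext x
  have hx := mem_extChartAt_target (I := 𝓘(ℝ, E)) x
  rw [Pi.add_apply, d_apply, d_apply, d_apply, inChart_add,
    extd_add (hα.differentiableAt hx) (hβ.differentiableAt hx)]

theorem IsSmooth.d_smul (hα : α.IsSmooth) (r : ℝ) : FormSection.d (r • α) = r • α.d := by
  funext x
  rw [Pi.smul_apply, d_apply, d_apply, inChart_smul,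
    extd_smul r (hα.differentiableAt (mem_extChartAt_target x))]

theorem IsSmooth.d_mul (hα : α.IsSmooth) (hβ : β.IsSmooth) (x : M) :
    FormSection.d (α * β) x = α.d x * β x + parity (α x) * β.d x := by
  have hx := mem_extChartAt_target (I := 𝓘(ℝ, E)) x
  rw [d_apply, d_apply, d_apply, inChart_mul,
    extd_mul (hα.differentiableAt hx) (hβ.differentiableAt hx), inChart_self, inChart_self]

theorem IsSmooth.d_mem_deg (hα : α.IsSmooth) {k : ℤ} (hk : ∀ x, α x ∈ deg k) (x : M) :
    α.d x ∈ deg (k + 1) := by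
  match k with
  | Int.ofNat n => exact hα.d_mem hk x
  | Int.negSucc n =>
    have zero_smul_eq : (0 : ℝ) • α = α := funext fun y => (zero_smul ℝ _).trans (hk y).symm
    rw [← zero_smul_eq, hα.d_smul, zero_smul]
    exact zero_mem _

end FormSection

variable [FiniteDimensional ℝ E]

namespace DeRham

/-- The operator on the de Rham algebra given by operators on the fibres. -/
def fibrewise (τ : M → End ℝ (FormFibre E))
    (smooth : ∀ α : FormSection E M, α.IsSmooth → FormSection.IsSmooth fun x => τ x (α x)) :
    End ℝ (DeRham E M) where
  toFun α := ⟨fun x => τ x ((α : FormSection E M) x), smooth α α.2⟩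
  map_add' _ _ := Subtype.ext <| funext fun x => map_add (τ x) _ _
  map_smul' r _ := Subtype.ext <| funext fun x => map_smul (τ x) r _

theorem hasOrderLE_of_fibrewise {τ : M → End ℝ (FormFibre E)} {T : End ℝ (DeRham E M)}
    (hT : ∀ α x, (T α : FormSection E M) x = τ x ((α : FormSection E M) x)) {r : ℕ} {k : ℤ}
    (hτ : ∀ x, HasOrderLE FormFibre.deg r k (τ x)) : HasOrderLE (DeRham.deg E M) r k T := by
  induction r generalizing k τ T with
  | zero =>
    choose c hc τ_eq using hτ
    have T_one : ∀ x, (T 1 : FormSection E M) x = c x := fun x => by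
      rw [hT, τ_eq]; exact mul_one _
    refine ⟨T 1, fun x => by rw [T_one]; exact hc x, LinearMap.ext fun α => Subtype.ext ?_⟩
    funext x
    rw [hT, τ_eq]
    exact congrArg (· * (α : FormSection E M) x) (T_one x).symm
  | succ r ih =>
    refine ⟨fun j α hα x => ?_, fun j α hα => ?_⟩
    · rw [hT]; exact (hτ x).1 j _ (hα x)
    · refine ih (τ := fun x => gradedCommutator j k (LinearMap.mulLeft ℝ ((α : FormSection E M) x))
        (τ x)) (fun β x => ?_) fun x => (hτ x).2 j _ (hα x)
      change (α : FormSection E M) x * (T β : FormSection E M) x -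
        (-1 : ℝ) ^ (j * k) • (T (α * β) : FormSection E M) x = _
      rw [hT, hT]
      rfl

theorem mul_mem_deg (j k : ℤ) (α : DeRham E M) (hα : α ∈ DeRham.deg E M j) (β : DeRham E M)
    (hβ : β ∈ DeRham.deg E M k) : α * β ∈ DeRham.deg E M (j + k) :=
  fun x => mul_mem_deg_add (hα x) (hβ x)

theorem deg_comm (j k : ℤ) (α : DeRham E M) (hα : α ∈ DeRham.deg E M j) (β : DeRham E M)
    (hβ : β ∈ DeRham.deg E M k) : α * β = ((-1 : ℝ) ^ (j * k)) • (β * α) :=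
  Subtype.ext <| funext fun x => FormFibre.deg_comm (hα x) (hβ x)

/-- The projection to the component of degree `k`. -/
def proj (k : ℕ) : End ℝ (DeRham E M) :=
  fibrewise (fun _ => FormFibre.proj k) fun _ hα x =>
    (contDiffOn_linearMap_comp (FormFibre.proj k) (hα x)).congr
      fun _ _ => (proj_pullback _ k _).symm

theorem proj_mem (k : ℕ) (α : DeRham E M) : proj k α ∈ DeRham.deg E M k :=
  fun _ => FormFibre.proj_mem k _

theorem sum_proj (α : DeRham E M) :
    ∑ k ∈ Finset.range (finrank ℝ E + 1), proj k α = α := by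
  refine Subtype.ext <| funext fun x => ?_
  rw [AddSubmonoidClass.coe_finsetSum, Finset.sum_apply]
  exact FormFibre.sum_proj _

theorem proj_of_mem {k n : ℕ} {α : DeRham E M} (hα : α ∈ DeRham.deg E M n) :
    proj k α = if k = n then α else 0 := by
  refine Subtype.ext <| funext fun x => (FormFibre.proj_of_mem (hα x)).trans ?_
  split_ifs <;> rfl

theorem eq_zero_of_mem_negSucc {n : ℕ} {α : DeRham E M}
    (hα : α ∈ DeRham.deg E M (Int.negSucc n)) : α = 0 :=
  Subtype.ext <| funext hα

theorem isInternal : DirectSum.IsInternal (DeRham.deg E M) := by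
  refine DirectSum.isInternal_submodule_of_iSupIndep_of_iSup_eq_top (fun i => ?_)
    (eq_top_iff.mpr fun α _ => ?_)
  · rw [Submodule.disjoint_def]
    intro α hα hα'
    match i with
    | Int.negSucc n => exact eq_zero_of_mem_negSucc hα
    | Int.ofNat n =>
      have iSup_le_ker : ⨆ (j : ℤ) (_ : j ≠ n), DeRham.deg E M j ≤ LinearMap.ker (proj n) := by
        refine iSup₂_le fun j hj β hβ => ?_
        match j with
        | Int.negSucc l =>
          rw [eq_zero_of_mem_negSucc hβ]
          exact zero_mem _
        | Int.ofNat l =>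
          rw [LinearMap.mem_ker, proj_of_mem hβ, if_neg]
          rintro rfl
          exact hj rfl
      rw [← LinearMap.mem_ker.mp (iSup_le_ker hα'), proj_of_mem hα, if_pos rfl]
  · rw [← sum_proj α]
    exact Submodule.sum_mem _ fun k _ => Submodule.mem_iSup_of_mem (k : ℤ) (proj_mem k α)

end DeRham

end DeRhamAlgebra

/-! ### The `BV_∞`-structure -/

section CommBVInfty

open FormFibre

variable {E : Type*} [NormedAddCommGroup E] [NormedSpace ℝ E] [FiniteDimensional ℝ E]
  {M : Type*} [TopologicalSpace M] [ChartedSpace E M]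

namespace AlmostSymplectic

variable (S : AlmostSymplectic E M)

theorem commute_Lam_adjointω_dL (x : M) : Commute (S.Lam x) (S.adjointω x (S.dL x)) := by
  have commute_L_dL : Commute (S.L x) (S.dL x) := LinearMap.ext fun β => by
    simp only [L, dL, Module.End.mul_apply, LinearMap.mulLeft_apply, ← mul_assoc,
      (commute_of_mem_exteriorPower_two (S.degree_two x) _).eq]
  rw [Commute, SemiconjBy, Lam, adjointω_eq, ← adjoint_mul (S.isSharp x).surjective_dualForm,
    ← adjoint_mul (S.isSharp x).surjective_dualForm, commute_L_dL.eq]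

theorem d_form_mul {α : FormSection E M} (hα : α.IsSmooth) :
    FormSection.d (S.form * α) - S.form * α.d = S.form.d * α := by
  funext x
  rw [Pi.sub_apply, S.smooth.d_mul hα, parity_of_mem_two (S.degree_two x)]
  exact add_sub_cancel_right _ _

variable {S}

theorem LamdLω_of_d_eq_zero (h : S.form.d = 0) (α : FormSection E M) : S.LamdLω α = 0 := by
  funext x
  rw [LamdLω, LamdL, dL, h, adjointω_eq, Pi.zero_apply, LinearMap.mulLeft_zero_eq_zero, mul_zero,
    zero_mul, sub_zero, adjoint_zero (S.isSharp x).surjective_dualForm]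
  rfl

theorem dLω_of_d_eq_zero (h : S.form.d = 0) (α : FormSection E M) : S.dLω α = 0 := by
  funext x
  rw [dLω, dL, h, adjointω_eq, Pi.zero_apply, LinearMap.mulLeft_zero_eq_zero,
    adjoint_zero (S.isSharp x).surjective_dualForm]
  rfl

theorem Δ_one_of_d_eq_zero (h : S.form.d = 0) (α : FormSection E M) : S.Δ 1 α = S.dω α := by
  simp only [Δ, LamdLω_of_d_eq_zero h, add_zero]

theorem Δ_two_of_d_eq_zero (h : S.form.d = 0) (α : FormSection E M) : S.Δ 2 α = 0 := by
  simp only [Δ, dLω_of_d_eq_zero h, neg_zero]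

theorem ext_form {S S' : AlmostSymplectic E M} (h : S'.form = S.form) : S' = S := by
  cases S
  cases S'
  congr

end AlmostSymplectic

variable [IsManifold 𝓘(ℝ, E) ∞ M]

namespace DeRham

variable (E M) in
/-- The exterior derivative on the de Rham algebra. -/
def d : End ℝ (DeRham E M) where
  toFun α := ⟨FormSection.d (α : FormSection E M), FormSection.IsSmooth.d α.2⟩
  map_add' α β := Subtype.ext <| FormSection.IsSmooth.d_add α.2 β.2
  map_smul' r α := Subtype.ext <| FormSection.IsSmooth.d_smul α.2 r

theorem coe_d (α : DeRham E M) :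
    (d E M α : FormSection E M) = FormSection.d (α : FormSection E M) := rfl

theorem d_mul_d : d E M * d E M = 0 :=
  LinearMap.ext fun α => Subtype.ext <| FormSection.IsSmooth.d_d α.2

theorem d_mul (j : ℤ) (α : DeRham E M) (hα : α ∈ DeRham.deg E M j) (β : DeRham E M) :
    d E M (α * β) = d E M α * β + (-1 : ℝ) ^ j • (α * d E M β) :=
  Subtype.ext <| funext fun x => by
    refine (FormSection.IsSmooth.d_mul α.2 β.2 x).trans ?_
    rw [parity_of_mem_deg (hα x), smul_mul_assoc]
    rfl

theorem hasOrderLE_d : HasOrderLE (DeRham.deg E M) 1 1 (d E M) :=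
  .of_leibniz (fun _ α hα => FormSection.IsSmooth.d_mem_deg α.2 hα) fun j α hα β => by
    rw [mul_one]
    exact d_mul j α hα β

end DeRham

namespace AlmostSymplectic

variable (S : AlmostSymplectic E M)

/-- The contraction `i_π` on the de Rham algebra. -/
def contract : End ℝ (DeRham E M) :=
  DeRham.fibrewise (fun x => contractBivector (sharp (S.form x))) fun α hα =>
    (funext (S.contractPoisson_apply α)) ▸ S.isSmooth_contractPoisson hα

theorem coe_contract (α : DeRham E M) :
    (S.contract α : FormSection E M) = S.contractPoisson (α : FormSection E M) :=
  (funext (S.contractPoisson_apply (α : FormSection E M))).symm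

theorem hasOrderLE_contract : HasOrderLE (DeRham.deg E M) 2 (-2) S.contract :=
  DeRham.hasOrderLE_of_fibrewise (fun _ _ => rfl) fun _ => hasOrderLE_contractBivector _

/-- The operators of the almost symplectic manifold on the de Rham algebra, obtained from
`exp(i_π) d exp(-i_π)`; the comparison with `AlmostSymplectic.Δ` is `coe_bvOperator`. -/
def bvOperator : ℕ → End ℝ (DeRham E M) := expConjCoeff ℝ S.contract (DeRham.d E M)

theorem coe_bvOperator_one (α : DeRham E M) :
    (S.bvOperator 1 α : FormSection E M) = S.Δ 1 (α : FormSection E M) := by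
  have bvOperator_one : S.bvOperator 1 = ⁅S.contract, DeRham.d E M⁆ := by
    simp [bvOperator, expConjCoeff]
  rw [bvOperator_one]
  change (S.contract (DeRham.d E M α) : FormSection E M) - DeRham.d E M (S.contract α) = _
  rw [coe_contract, DeRham.coe_d, DeRham.coe_d, coe_contract]
  exact (S.dω_add_LamdLω α.2).symm

theorem coe_bvOperator_two (α : DeRham E M) :
    (S.bvOperator 2 α : FormSection E M) = S.Δ 2 (α : FormSection E M) := by
  have bvOperator_two : S.bvOperator 2 = (2 : ℝ)⁻¹ • ⁅S.contract, S.bvOperator 1⁆ := by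
    rw [bvOperator, expConjCoeff, Nat.cast_one, one_add_one_eq_two]
  rw [bvOperator_two]
  change (2 : ℝ)⁻¹ • ((S.contract (S.bvOperator 1 α) : FormSection E M) -
    S.bvOperator 1 (S.contract α)) = _
  rw [coe_contract, coe_bvOperator_one, coe_bvOperator_one, coe_contract]
  simp only [Δ]
  rw [S.dω_add_LamdLω α.2, S.dω_add_LamdLω (S.isSmooth_contractPoisson α.2),
    S.contractPoisson_commutator α.2, smul_smul]
  norm_num [Δ]

theorem commute_contract_bvOperator_two : Commute S.contract (S.bvOperator 2) := by
  refine LinearMap.ext fun α => Subtype.ext <| funext fun x => ?_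
  have commute_Lam := LinearMap.congr_fun (S.commute_Lam_adjointω_dL x).eq
    ((α : FormSection E M) x)
  rw [Lam_eq, Module.End.mul_apply, Module.End.mul_apply] at commute_Lam
  simp only [Module.End.mul_apply, coe_contract, coe_bvOperator_two, contractPoisson_apply, Δ,
    dLω, Pi.neg_apply, map_neg, commute_Lam]

theorem bvOperator_add_three (n : ℕ) : S.bvOperator (n + 3) = 0 := by
  refine expConjCoeff_eq_zero_of_le ℝ (Nat.le_add_left 3 n) ?_
  rw [expConjCoeff, S.commute_contract_bvOperator_two.lie_eq, smul_zero]

theorem coe_bvOperator (n : ℕ) (α : DeRham E M) :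
    (S.bvOperator n α : FormSection E M) = S.Δ n (α : FormSection E M) := by
  match n with
  | 0 => rfl
  | 1 => exact S.coe_bvOperator_one α
  | 2 => exact S.coe_bvOperator_two α
  | n + 3 =>
    rw [bvOperator_add_three]
    rfl

theorem hasOrderLE_bvOperator (n : ℕ) :
    HasOrderLE (DeRham.deg E M) (n + 1) (1 - 2 * n) (S.bvOperator n) :=
  DeRham.hasOrderLE_d.expConjCoeff S.hasOrderLE_contract n

theorem isCommBVInfty : IsCommBVInfty (DeRham.deg E M) S.bvOperator where
  isInternal := DeRham.isInternal
  one_mem _ := (by simp : (1 : FormFibre E) ∈ ⋀[ℝ]^0 (Dual ℝ E))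
  mul_mem := DeRham.mul_mem_deg
  graded_comm := DeRham.deg_comm
  leibniz := DeRham.d_mul
  degree n _ _ ha := (S.hasOrderLE_bvOperator n).1 _ _ ha
  multicomplex := sum_expConjCoeff_mul_expConjCoeff ℝ DeRham.d_mul_d
  order := S.hasOrderLE_bvOperator

variable {S}

theorem Δ_eq_koszul (h : S.form.d = 0) {α : FormSection E M} (hα : α.IsSmooth) (n : ℕ) :
    S.Δ n α = S.koszul n α := by
  match n with
  | 0 => rfl
  | 1 => exact S.dω_add_LamdLω hα
  | 2 => exact Δ_two_of_d_eq_zero h α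
  | n + 3 => rfl

end AlmostSymplectic

end CommBVInfty

end

theorem mainTheorem11
    {E : Type*} [NormedAddCommGroup E] [NormedSpace ℝ E] [FiniteDimensional ℝ E]
    {M : Type*} [TopologicalSpace M] [ChartedSpace E M] [IsManifold 𝓘(ℝ, E) ∞ M]
    (H : AlmostHermitian E M) :
    -- the identities between metric and symplectic adjoints, and `[d, L] = dω ∧ ·`
    (∀ α ∈ DeRham E M,
      H.dcStar α = -H.dω α ∧
      H.dωcStar α = -H.dLω α ∧
      H.TcStar α = -H.LamdLω α ∧
      FormSection.d (H.form * α) - H.form * α.d = H.form.d * α) ∧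
    -- both tuples of operators are one and the same commutative `BV_∞`-structure
    (∃ Δ : ℕ → Module.End ℝ (DeRham E M),
      (∀ n α, (Δ n α : FormSection E M) = H.hermitianΔ n α) ∧
      (∀ n α, (Δ n α : FormSection E M) = H.toAlmostSymplectic.Δ n α) ∧
      IsCommBVInfty (DeRham.deg E M) Δ) ∧
    -- it depends only on `ω`
    (∀ H' : AlmostHermitian E M, H'.form = H.form →
      ∀ n, ∀ α ∈ DeRham E M, H'.hermitianΔ n α = H.hermitianΔ n α) ∧
    -- in the almost Kähler case it is Koszul's `BV`-algebra, with `Δ₁ = [i_π, d] = d^ω`, `Δ₂ = 0`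
    (H.form.d = 0 → ∀ α ∈ DeRham E M,
      H.hermitianΔ 1 α = H.dω α ∧
      H.hermitianΔ 2 α = 0 ∧
      ∀ n, H.hermitianΔ n α = H.toAlmostSymplectic.koszul n α) := by
  refine ⟨fun α hα => ⟨H.dcStar_eq α, H.dωcStar_eq α, H.TcStar_eq α, H.d_form_mul hα⟩,
    ⟨H.bvOperator, fun n α => ?_, H.coe_bvOperator, H.isCommBVInfty⟩,
    fun H' same_form n α _ => ?_, fun closed α hα => ⟨?_, ?_, fun n => ?_⟩⟩
  · rw [H.coe_bvOperator, H.hermitianΔ_eq]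
  · rw [H.hermitianΔ_eq, H'.hermitianΔ_eq, AlmostSymplectic.ext_form same_form]
  · rw [H.hermitianΔ_eq, AlmostSymplectic.Δ_one_of_d_eq_zero closed]
  · rw [H.hermitianΔ_eq, AlmostSymplectic.Δ_two_of_d_eq_zero closed]
  · rw [H.hermitianΔ_eq, AlmostSymplectic.Δ_eq_koszul closed hα]
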